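/- Let $k$ be a field, and let $\mathcal T$ and $\mathcal S$ be $k$-linear (with $k$-linear suspension $[1]$), Hom-finite, Krull-Schmidt triangulated categories. For an object $G$ of a triangulated category, $\langle G\rangle_1$ denotes the smallest full subcategory that contains $G$ and is closed under finite direct sums, direct summands and the shifts $[n]$, $n\in\mathbb Z$. An object $G\in\mathcal T$ is called a linear generator if the smallest thick subcategory of $\mathcal T$ containing $G$ is $\mathcal T$ and the following hold, where $P,Q,R$ denote indecomposable objects of $\langle G\rangle_1$ and $Q\le P$ means $\operatorname{Hom}_{\mathcal T}(P,Q)\cong k$ as $k$-vector spaces: 1. $\le$ is a total order on the set of isomorphism classes of indecomposable objects of $\langle G\rangle_1$, and if $Q\le P$ and $Q\not\cong P$, then $\operatorname{Hom}_{\mathcal T}(Q,P)=0$; 2. $P\le P[1]$ for all $P$; 3. if $P\le Q\le P[1]$, then $Q\cong P$ or $Q\cong P[1]$; 4. if $R\le Q\le P$, then every morphism $P\to R$ factors through $Q$. Suppose that $\mathcal T$ and $\mathcal S$ have linear generators $G$ and $G'$, respectively, and let $F\colon\langle G\rangle_1\to\langle G'\rangle_1$ be a fully faithful additive functor that commutes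 with suspension, that is, $F\circ[1]\cong[1]\circ F$. Then there are a fully faithful additive functor $\mathscr F\colon\mathcal T\to\mathcal S$ and a natural isomorphism $\phi\colon\mathscr F\circ[1]\to[1]\circ\mathscr F$ such that: (a) $\mathscr F$ extends $F$: the restriction of $\mathscr F$ to $\langle G\rangle_1$ is naturally isomorphic to $F$ followed by the inclusion $\langle G'\rangle_1\subseteq\mathcal S$; (b) $\mathscr F$ preserves triangles with at least two indecomposable terms: for every distinguished triangle $X\xrightarrow{f}Y\xrightarrow{g}Z\xrightarrow{h}X[1]$ in $\mathcal T$ such that at least two of $X,Y,Z$ are indecomposable, the triangle $\mathscr F(X)\xrightarrow{\mathscr F(f)}\mathscr F(Y)\xrightarrow{\mathscr F(g)}\mathscr F(Z)\xrightarrow{\phi_X\circ\mathscr F(h)}\mathscr F(X)[1]$ is distinguished in $\mathcal S$; (c) $\mathscr F$ is an equivalence if and only if $F$ is an equivalence. -/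

import Mathlib

open CategoryTheory Category Limits Pretriangulated

universe w v₁ u₁ v₂ u₂

namespace LinearGen

section Setup

variable (k : Type w) [Field k] (C : Type u₁) [Category.{v₁} C] [Preadditive C]

/-- A `k`-linear category is Hom-finite if all its Hom spaces are finite-dimensional over `k`. -/
def IsHomFinite [Linear k C] : Prop :=
  ∀ X Y : C, Module.Finite k (X ⟶ Y)

/-- An additive category is Krull-Schmidt if every object is a finite direct sum of objects
with local endomorphism rings. -/
def IsKrullSchmidt [HasFiniteBiproducts C] : Prop :=
  ∀ X : C, ∃ (n : ℕ) (Y : Fin n → C),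
    (∀ i, IsLocalRing (End (Y i))) ∧ Nonempty (X ≅ ⨁ Y)

end Setup

section Generators

variable (k : Type w) [Field k] {C : Type u₁} [Category.{v₁} C] [Preadditive C]
  [HasZeroObject C] [HasShift C ℤ] [∀ n : ℤ, (shiftFunctor C n).Additive] [Pretriangulated C]

/-- `⟨G⟩₁`: the (isomorphism closed) class of the direct summands of finite direct sums of
shifts `G⟦n⟧`, `n : ℤ`. It is the smallest class of objects which contains `G` and is closed
under finite direct sums, direct summands and the autoequivalence `⟦1⟧` (and its inverse). -/
abbrev langOne (G : C) : ObjectProperty C :=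
  ((ObjectProperty.singleton G).shiftClosure ℤ).binaryProductsClosure.retractClosure

/-- `P` is an indecomposable object of `⟨G⟩₁`. -/
def IsIndIn (G P : C) : Prop :=
  Indecomposable P ∧ langOne G P

/-- The relation `Q ≤ P`, meaning that `Hom(P, Q)` is one-dimensional over `k`. -/
def HomLE [Linear k C] (Q P : C) : Prop :=
  Nonempty ((P ⟶ Q) ≃ₗ[k] k)

/-- `G` is a linear generator: it is a classical generator, the relation `HomLE` is a total order
on the isomorphism classes of indecomposable objects of `⟨G⟩₁`, nonzero morphisms between
non-isomorphic indecomposables only go downwards, `P ≤ P⟦1⟧`, nothing lies strictly between `P`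
and `P⟦1⟧`, and every morphism `P ⟶ R` factors through every `Q` with `R ≤ Q ≤ P`. -/
structure IsLinearGenerator [Linear k C] (G : C) : Prop where
  classical : (ObjectProperty.singleton G).IsClassicalTriangulatedGenerator
  le_refl : ∀ P : C, IsIndIn G P → HomLE k P P
  le_antisymm : ∀ P Q : C, IsIndIn G P → IsIndIn G Q →
    HomLE k Q P → HomLE k P Q → Nonempty (Q ≅ P)
  le_trans : ∀ P Q R : C, IsIndIn G P → IsIndIn G Q → IsIndIn G R →
    HomLE k R Q → HomLE k Q P → HomLE k R P
  le_total : ∀ P Q : C, IsIndIn G P → IsIndIn G Q → HomLE k Q P ∨ HomLE k P Q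
  hom_eq_zero : ∀ P Q : C, IsIndIn G P → IsIndIn G Q →
    HomLE k Q P → ¬ Nonempty (Q ≅ P) → ∀ f : Q ⟶ P, f = 0
  le_shift : ∀ P : C, IsIndIn G P → HomLE k P (P⟦(1 : ℤ)⟧)
  convex : ∀ P Q : C, IsIndIn G P → IsIndIn G Q →
    HomLE k P Q → HomLE k Q (P⟦(1 : ℤ)⟧) → Nonempty (Q ≅ P) ∨ Nonempty (Q ≅ P⟦(1 : ℤ)⟧)
  factors : ∀ P Q R : C, IsIndIn G P → IsIndIn G Q → IsIndIn G R →
    HomLE k R Q → HomLE k Q P →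
    ∀ f : P ⟶ R, ∃ (g : P ⟶ Q) (h : Q ⟶ R), g ≫ h = f

/-- At least two of the three terms of a triangle are indecomposable. -/
def HasTwoIndecomposableTerms (t : Triangle C) : Prop :=
  (Indecomposable t.obj₁ ∧ Indecomposable t.obj₂) ∨
  (Indecomposable t.obj₂ ∧ Indecomposable t.obj₃) ∨
  (Indecomposable t.obj₁ ∧ Indecomposable t.obj₃)

end Generators

section Functors

variable {C : Type u₁} [Category.{v₁} C] [HasShift C ℤ]
  {D : Type u₂} [Category.{v₂} D] [HasShift D ℤ]

/-- Natural isomorphisms `Φ(X⟦1⟧) ≅ Φ(X)⟦1⟧`; the functor `Φ` commutes with suspension if there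
is one. -/
abbrev SuspIso (Φ : C ⥤ D) :=
  shiftFunctor C (1 : ℤ) ⋙ Φ ≅ Φ ⋙ shiftFunctor D (1 : ℤ)

/-- The functor `Φ` sends the triangle `t` to a distinguished triangle, where `Φ(X⟦1⟧)` is
identified with `Φ(X)⟦1⟧` through `φ`. -/
def PreservesTriangle [Preadditive D] [HasZeroObject D]
    [∀ n : ℤ, (shiftFunctor D n).Additive] [Pretriangulated D]
    (Φ : C ⥤ D) (φ : SuspIso Φ) (t : Triangle C) : Prop :=
  Triangle.mk (Φ.map t.mor₁) (Φ.map t.mor₂) (Φ.map t.mor₃ ≫ φ.hom.app t.obj₁) ∈ distTriang D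

end Functors

end LinearGen

/-! The indecomposables of `langOne G` form a chain with one-dimensional Hom spaces going down, and
the factorization axiom makes composites of nonzero downward morphisms nonzero. Generators can
therefore be rescaled to satisfy `e p q ≫ e q r = e p r` (`exists_multiplicative_generators`). What
remains is the order, the shift `s` on it, and scalars `c` by which the shift rescales the
generators; with a top element for the zero object this is a `LinSys`. A fully faithful linear
functor commuting with suspension carries it to a `LinSys` with the same `s` and `c`. The given `F`
is only additive, but it is semilinear for some ring endomorphism of `k` (`exists_semilinear`), and
restricting the scalars of the target along that endomorphism makes it linear.

The cone `X i` of `e p q`, for `q < p`, behaves like an interval module on `[q, p)`: it receives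
nonzero morphisms from `obj r` exactly for `q ≤ r < p`. The Hom space between two cones is spanned
by one morphism `b`, which is either visible on the objects of the system (`C1`) or a phantom that
factors through the connecting morphism (`C2`). Its composition and shift constants are expressions
in `s` and `c` alone (`b_comp`, `rho_b`). Hence `b ↦ b` identifies the categories of cones on both
sides, compatibly with suspension.

Every object of the source is a finite sum of cones (`sumsOf_X_eq_top`): Gauss elimination treats
cones of morphisms between sums of objects of the system, an octahedron treats further extensions,
and Krull-Schmidt treats retracts. So the functor on cones extends additively to everything.

The triangles `obj p ⟶ obj q ⟶ X i` are preserved by construction. For any other nonzero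
noninvertible morphism between cones, the image triangle is distinguished after rescaling the
connecting morphism, because endomorphisms of cones are scalars. Suitable pre- and postcompositions
do not change this scalar (`smul_eq_of_comp_left`, `smul_eq_of_comp_right`), which reduces to the
standard triangles. Finally, a genuine cone never lands in `langOne G'`, since composites there
cannot vanish as they do in a triangle; this gives the statement about equivalences. -/

namespace LinearGen

/-! ### Finite direct sums of members of a family -/

section Decomposition

variable {C : Type u₁} [Category.{v₁} C] [Preadditive C] {I : Type*}

/-- A decomposition of `Y` as a finite direct sum of members of the family `X`. -/
structure Decomp (X : I → C) (Y : C) where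
  J : Type
  [fin : Fintype J]
  idx : J → I
  ι : ∀ j, X (idx j) ⟶ Y
  π : ∀ j, Y ⟶ X (idx j)
  ι_π_self : ∀ j, ι j ≫ π j = 𝟙 _
  ι_π_ne : ∀ j j', j ≠ j' → ι j ≫ π j' = 0
  total : ∑ j, π j ≫ ι j = 𝟙 Y

attribute [instance] Decomp.fin

attribute [simp] Decomp.ι_π_self

@[simp]
lemma Decomp.ι_π_self_assoc {X : I → C} {Y : C} (d : Decomp X Y) (j : d.J) {Z : C}
    (f : X (d.idx j) ⟶ Z) : d.ι j ≫ d.π j ≫ f = f := by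
  rw [← Category.assoc, d.ι_π_self, Category.id_comp]

/-- The class of finite direct sums of members of the family `X`. -/
def sumsOf (X : I → C) : ObjectProperty C := fun Y => Nonempty (Decomp X Y)

variable {X : I → C}

/-- Decompositions can be transported along isomorphisms. -/
def Decomp.ofIso {Y Y' : C} (d : Decomp X Y) (e : Y ≅ Y') : Decomp X Y' where
  J := d.J
  idx := d.idx
  ι j := d.ι j ≫ e.hom
  π j := e.inv ≫ d.π j
  ι_π_self j := by simp
  ι_π_ne j j' h := by simp [d.ι_π_ne j j' h]
  total := by
    have := e.inv ≫= d.total =≫ e.hom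
    simpa [Preadditive.comp_sum, Preadditive.sum_comp] using this

instance : (sumsOf X).IsClosedUnderIsomorphisms where
  of_iso e h := h.map (fun d => d.ofIso e)

/-- The trivial decomposition of a member of the family. -/
def Decomp.single (X : I → C) (i : I) : Decomp X (X i) where
  J := Unit
  idx _ := i
  ι _ := 𝟙 _
  π _ := 𝟙 _
  ι_π_self j := by simp
  ι_π_ne j j' h := (h rfl).elim
  total := by simp

lemma sumsOf_single (X : I → C) (i : I) : sumsOf X (X i) := ⟨Decomp.single X i⟩

lemma sumsOf_of_isZero {Y : C} (hY : IsZero Y) : sumsOf X Y :=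
  ⟨{ J := Empty
     idx := Empty.elim
     ι := fun j => j.elim
     π := fun j => j.elim
     ι_π_self := fun j => j.elim
     ι_π_ne := fun j => j.elim
     total := hY.eq_of_src _ _ }⟩

/-- The decomposition of a finite biproduct of members of the family. -/
noncomputable def Decomp.biproduct {J : Type} [Fintype J] (idx : J → I)
    [HasBiproduct fun j => X (idx j)] :
    Decomp X (⨁ fun j => X (idx j)) where
  J := J
  idx := idx
  ι j := biproduct.ι (fun j => X (idx j)) j
  π j := biproduct.π (fun j => X (idx j)) j
  ι_π_self j := by simp
  ι_π_ne j j' h := biproduct.ι_π_ne _ h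
  total := biproduct.total

/-- Nested decompositions can be composed. -/
def Decomp.trans {K : Type*} {Z : K → C} {Y : C} (d : Decomp Z Y)
    (d' : ∀ j, Decomp X (Z (d.idx j))) : Decomp X Y where
  J := Σ j : d.J, (d' j).J
  idx a := (d' a.1).idx a.2
  ι a := (d' a.1).ι a.2 ≫ d.ι a.1
  π a := d.π a.1 ≫ (d' a.1).π a.2
  ι_π_self a := by simp
  ι_π_ne := by
    rintro ⟨a, a'⟩ ⟨b, b'⟩ h
    by_cases hab : a = b
    · subst hab
      have : a' ≠ b' := fun h' => h (by rw [h'])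
      simp [(d' a).ι_π_ne _ _ this]
    · have := d.ι_π_ne _ _ hab
      simp [reassoc_of% this]
  total := by
    rw [Fintype.sum_sigma]
    rw [← d.total]
    refine Finset.sum_congr rfl fun j _ => ?_
    have := d.π j ≫= (d' j).total =≫ d.ι j
    simpa [Preadditive.comp_sum, Preadditive.sum_comp] using this

lemma sumsOf_trans {K : Type*} {Z : K → C} {Y : C} (hY : sumsOf Z Y)
    (h : ∀ j, sumsOf X (Z j)) : sumsOf X Y :=
  hY.map fun d => d.trans fun j => (h (d.idx j)).some

/-- The tautological decomposition of a binary biproduct. -/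
noncomputable def Decomp.biprod (Y Y' : C) [HasBinaryBiproduct Y Y'] :
    Decomp (fun b : Bool => cond b Y Y') (Y ⊞ Y') where
  J := Bool
  idx b := b
  ι | true => (biprod.inl : Y ⟶ Y ⊞ Y')
    | false => (biprod.inr : Y' ⟶ Y ⊞ Y')
  π | true => (biprod.fst : Y ⊞ Y' ⟶ Y)
    | false => (biprod.snd : Y ⊞ Y' ⟶ Y')
  ι_π_self j := by cases j <;> simp
  ι_π_ne j j' h := by cases j <;> cases j' <;> simp_all
  total := by
    rw [Fintype.sum_bool]
    exact biprod.total (X := Y) (Y := Y')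

lemma sumsOf_biprod {Y Y' : C} [HasBinaryBiproduct Y Y'] (h : sumsOf X Y) (h' : sumsOf X Y') :
    sumsOf X (Y ⊞ Y') :=
  sumsOf_trans ⟨Decomp.biprod Y Y'⟩ (by rintro (_ | _) <;> assumption)

/-- An additive functor preserves decompositions. -/
def Decomp.map {D : Type u₂} [Category.{v₂} D] [Preadditive D] {Y : C} (d : Decomp X Y)
    (F : C ⥤ D) [F.Additive] : Decomp (fun i => F.obj (X i)) (F.obj Y) where
  J := d.J
  idx := d.idx
  ι j := F.map (d.ι j)
  π j := F.map (d.π j)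
  ι_π_self j := by rw [← F.map_comp, d.ι_π_self, F.map_id]
  ι_π_ne j j' h := by rw [← F.map_comp, d.ι_π_ne j j' h, F.map_zero]
  total := by
    simp_rw [← F.map_comp]
    rw [← F.map_sum, d.total, F.map_id]

/-- An object with a decomposition is isomorphic to the biproduct. -/
noncomputable def Decomp.isoBiproduct {Y : C} (d : Decomp X Y)
    [HasBiproduct fun j => X (d.idx j)] : Y ≅ ⨁ fun j => X (d.idx j) where
  hom := biproduct.lift d.π
  inv := biproduct.desc d.ι
  hom_inv_id := by rw [biproduct.lift_desc, d.total]
  inv_hom_id := by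
    ext j j'
    by_cases h : j = j'
    · subst h; simp
    · simp [d.ι_π_ne _ _ (Ne.symm h), biproduct.ι_π_ne _ (Ne.symm h)]

/-- The class of finite direct sums is the smallest one that contains zero objects and the members
of the family and is closed under isomorphisms and binary direct sums. -/
lemma sumsOf_le [HasFiniteBiproducts C] [HasBinaryBiproducts C] {Q : ObjectProperty C}
    [Q.IsClosedUnderIsomorphisms] (h₀ : ∀ Y, IsZero Y → Q Y) (h₁ : ∀ i, Q (X i))
    (h₂ : ∀ Y Y' : C, Q Y → Q Y' → Q (Y ⊞ Y')) : sumsOf X ≤ Q := by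
  -- The index type varies in the induction, since splitting off a summand replaces `J` by a
  -- subtype.
  suffices H : ∀ (n : ℕ) (J : Type) [Fintype J] (_ : Fintype.card J = n) (idx : J → I),
      Q (⨁ fun j => X (idx j)) by
    rintro Y ⟨d⟩
    exact Q.prop_of_iso d.isoBiproduct.symm (H _ d.J rfl d.idx)
  intro n
  induction n with
  | zero =>
    intro J _ hJ idx
    have := Fintype.card_eq_zero_iff.1 hJ
    exact h₀ _ ((IsZero.iff_id_eq_zero _).2 (biproduct.hom_ext _ _ fun j => isEmptyElim j))
  | succ n ih =>
    intro J _ hJ idx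
    have : Nonempty J := by
      rw [← Fintype.card_pos_iff]; omega
    classical
    obtain ⟨j₀⟩ := this
    have hc : Fintype.card {j : J // j ≠ j₀} = n := by
      rw [Fintype.card_subtype_compl]; simp [hJ]
    refine Q.prop_of_iso ?_ (h₂ _ _ (h₁ (idx j₀)) (ih {j : J // j ≠ j₀} hc (fun j => idx j.1)))
    exact
    { hom := biprod.desc (biproduct.ι (fun j => X (idx j)) j₀)
        (biproduct.desc fun j => biproduct.ι (fun j => X (idx j)) j.1)
      inv := biprod.lift (biproduct.π (fun j => X (idx j)) j₀)
        (biproduct.lift fun j => biproduct.π (fun j => X (idx j)) j.1)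
      hom_inv_id := by
        ext a b
        · simp
        · have := biproduct.ι_π_ne (fun j => X (idx j)) a.2.symm
          simp [this]
        · have := biproduct.ι_π_ne (fun j => X (idx j)) a.2
          simp [this]
        · by_cases h : a = b
          · subst h; simp
          · have h' : a.1 ≠ b.1 := fun h' => h (Subtype.ext h')
            simp [biproduct.ι_π_ne _ h, biproduct.ι_π_ne (fun j => X (idx j)) h']
      inv_hom_id := by
        rw [biprod.lift_desc, biproduct.lift_desc, ← biproduct.total,
          ← Finset.add_sum_erase _ _ (Finset.mem_univ j₀)]
        congr 1
        exact (Finset.sum_subtype (Finset.univ.erase j₀) (p := fun j => j ≠ j₀)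
          (by simp) (fun j => biproduct.π (fun j => X (idx j)) j ≫
            biproduct.ι (fun j => X (idx j)) j)).symm }

end Decomposition

/-! ### Additive extension of functors and natural isomorphisms -/

section Extension

variable {C : Type u₁} [Category.{v₁} C] [Preadditive C] {D : Type u₂} [Category.{v₂} D]
  [Preadditive D] {I : Type*} {X : I → C}

section Functor

variable [HasFiniteBiproducts D] (dec : ∀ Y, Decomp X Y) {X' : I → D}
  (ψ : ∀ i j, (X i ⟶ X j) →+ (X' i ⟶ X' j)) (ψ_id : ∀ i, ψ i i (𝟙 _) = 𝟙 _)
  (ψ_comp : ∀ i j l (f : X i ⟶ X j) (g : X j ⟶ X l), ψ i l (f ≫ g) = ψ i j f ≫ ψ j l g)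

/-- The extension to finite direct sums of a functor given on the members of a family. -/
noncomputable def extend : C ⥤ D where
  obj Y := ⨁ fun a : (dec Y).J => X' ((dec Y).idx a)
  map {Y Z} f := biproduct.matrix fun a b => ψ _ _ ((dec Y).ι a ≫ f ≫ (dec Z).π b)
  map_id Y := by
    ext b a
    simp only [biproduct.matrix_π, biproduct.ι_desc, id_comp]
    by_cases h : a = b
    · subst h
      simp [ψ_id]
    · simp [(dec Y).ι_π_ne _ _ h, biproduct.ι_π_ne _ h]
  map_comp {Y Z W} f g := by
    ext b a
    simp only [biproduct.matrix_π, biproduct.ι_desc, assoc, biproduct.ι_matrix_assoc]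
    rw [biproduct.lift_desc]
    simp_rw [← ψ_comp]
    rw [← map_sum]
    congr 1
    have := ((dec Y).ι a ≫ f) ≫= (dec Z).total =≫ (g ≫ (dec W).π b)
    simpa [Preadditive.comp_sum, Preadditive.sum_comp] using this.symm

instance extend_additive : (extend dec ψ ψ_id ψ_comp).Additive where
  map_add {Y Z f g} := by
    suffices h : biproduct.matrix (fun a b => ψ _ _ ((dec Y).ι a ≫ (f + g) ≫ (dec Z).π b)) =
        biproduct.matrix (fun a b => ψ _ _ ((dec Y).ι a ≫ f ≫ (dec Z).π b)) +
        biproduct.matrix (fun a b => ψ _ _ ((dec Y).ι a ≫ g ≫ (dec Z).π b)) from h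
    ext b a
    simp [Preadditive.comp_add, Preadditive.add_comp]

/-- Auxiliary definition for `extendIso`. -/
noncomputable def extendIsoAux (i : I) :
    (⨁ fun a : (dec (X i)).J => X' ((dec (X i)).idx a)) ≅ X' i where
  hom := biproduct.desc fun a => ψ _ _ ((dec (X i)).ι a)
  inv := biproduct.lift fun a => ψ _ _ ((dec (X i)).π a)
  hom_inv_id := by
    ext a b
    simp only [assoc, biproduct.ι_desc_assoc, biproduct.lift_π]
    rw [← ψ_comp]
    by_cases h : b = a
    · subst h
      simp [ψ_id]
    · simp [(dec (X i)).ι_π_ne _ _ h, biproduct.ι_π_ne _ h]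
  inv_hom_id := by
    rw [biproduct.lift_desc]
    simp_rw [← ψ_comp]
    rw [← map_sum, (dec (X i)).total, ψ_id]

/-- The extension of a functor given on a family takes the prescribed values. -/
noncomputable def extendIso (i : I) : (extend dec ψ ψ_id ψ_comp).obj (X i) ≅ X' i :=
  extendIsoAux dec ψ ψ_id ψ_comp i

lemma extendIso_naturality {i j : I} (f : X i ⟶ X j) :
    (extend dec ψ ψ_id ψ_comp).map f ≫ (extendIso dec ψ ψ_id ψ_comp j).hom =
      (extendIso dec ψ ψ_id ψ_comp i).hom ≫ ψ i j f := by
  change biproduct.matrix _ ≫ biproduct.desc _ = biproduct.desc _ ≫ _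
  ext a
  rw [biproduct.ι_matrix_assoc, biproduct.lift_desc, biproduct.ι_desc_assoc]
  simp_rw [← ψ_comp]
  rw [← map_sum]
  congr 1
  have := ((dec (X i)).ι a ≫ f) ≫= (dec (X j)).total
  simpa [Preadditive.comp_sum, Preadditive.sum_comp] using this

lemma extend_faithful (hψ : ∀ i j, Function.Injective (ψ i j)) :
    (extend dec ψ ψ_id ψ_comp).Faithful where
  map_injective {Y Z} f g h := by
    have key : ∀ a b, (dec Y).ι a ≫ f ≫ (dec Z).π b = (dec Y).ι a ≫ g ≫ (dec Z).π b := by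
      intro a b
      apply hψ
      have h' : biproduct.matrix _ = biproduct.matrix _ := h
      have := biproduct.ι (fun a => X' ((dec Y).idx a)) a ≫= h' =≫
        biproduct.π (fun a => X' ((dec Z).idx a)) b
      simpa using this
    have h₁ : ∀ (f : Y ⟶ Z), f = ∑ a, ∑ b, (dec Y).π a ≫ ((dec Y).ι a ≫ f ≫ (dec Z).π b) ≫
        (dec Z).ι b := by
      intro f
      calc f = (∑ a, (dec Y).π a ≫ (dec Y).ι a) ≫ f ≫ (∑ b, (dec Z).π b ≫ (dec Z).ι b) := by
            rw [(dec Y).total, (dec Z).total, id_comp, comp_id]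
        _ = _ := by
            simp only [Preadditive.comp_sum, Preadditive.sum_comp, assoc]
            rw [Finset.sum_comm]
    rw [h₁ f, h₁ g]
    simp_rw [key]

lemma extend_full (hψ : ∀ i j, Function.Surjective (ψ i j)) :
    (extend dec ψ ψ_id ψ_comp).Full where
  map_surjective {Y Z} f := by
    let f' : (⨁ fun a => X' ((dec Y).idx a)) ⟶ ⨁ fun b => X' ((dec Z).idx b) := f
    choose g hg using fun a b => hψ _ _ (biproduct.ι (fun a => X' ((dec Y).idx a)) a ≫ f' ≫
      biproduct.π (fun b => X' ((dec Z).idx b)) b)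
    refine ⟨∑ a, ∑ b, (dec Y).π a ≫ g a b ≫ (dec Z).ι b, ?_⟩
    change biproduct.matrix _ = f'
    ext b a
    simp only [biproduct.matrix_π, biproduct.ι_desc]
    rw [← hg a b]
    congr 1
    simp only [Preadditive.comp_sum, Preadditive.sum_comp]
    rw [Finset.sum_eq_single a, Finset.sum_eq_single b]
    · simp
    · intro b' _ hb'
      simp [(dec Z).ι_π_ne _ _ hb']
    · simp
    · intro a' _ ha'
      refine Finset.sum_eq_zero fun b' _ => ?_
      have := (dec Y).ι_π_ne _ _ ha'.symm
      simp [reassoc_of% this]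
    · simp

end Functor

section NatIso

variable (dec : ∀ Y, Decomp X Y) {F F' : C ⥤ D} [F'.Additive]
  (α : ∀ i, F.obj (X i) ⟶ F'.obj (X i))

/-- The extension to finite direct sums of a natural transformation given on a family. -/
def extendApp (Y : C) : F.obj Y ⟶ F'.obj Y :=
  ∑ a, F.map ((dec Y).π a) ≫ α _ ≫ F'.map ((dec Y).ι a)

lemma map_extendApp (hα : ∀ i j (f : X i ⟶ X j), F.map f ≫ α j = α i ≫ F'.map f) {i : I} {Y : C}
    (g : X i ⟶ Y) :
    F.map g ≫ extendApp dec α Y = α i ≫ F'.map g := by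
  have := g ≫= (dec Y).total
  rw [comp_id, Preadditive.comp_sum] at this
  conv_rhs => rw [← this, F'.map_sum, Preadditive.comp_sum]
  rw [extendApp, Preadditive.comp_sum]
  refine Finset.sum_congr rfl fun a _ => ?_
  rw [← Functor.map_comp_assoc, ← assoc, hα, assoc, ← F'.map_comp, assoc]

lemma extendApp_naturality [F.Additive]
    (hα : ∀ i j (f : X i ⟶ X j), F.map f ≫ α j = α i ≫ F'.map f) {Y Z : C} (f : Y ⟶ Z) :
    F.map f ≫ extendApp dec α Z = extendApp dec α Y ≫ F'.map f := by
  have := (dec Y).total =≫ f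
  rw [id_comp, Preadditive.sum_comp] at this
  have h : F.map f = ∑ j, F.map (((dec Y).π j ≫ (dec Y).ι j) ≫ f) := by rw [← F.map_sum, this]
  rw [h, Preadditive.sum_comp, extendApp.eq_def dec α Y, Preadditive.sum_comp]
  refine Finset.sum_congr rfl fun a _ => ?_
  rw [assoc, F.map_comp, assoc, map_extendApp dec α hα, assoc, assoc, ← F'.map_comp]

lemma extendApp_self (hα : ∀ i j (f : X i ⟶ X j), F.map f ≫ α j = α i ≫ F'.map f) (i : I) :
    extendApp dec α (X i) = α i := by
  simpa using map_extendApp dec α hα (𝟙 (X i))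

end NatIso

/-- Additive functors are determined by their matrices, so compatibility on the family suffices.
This reduces the suspension isomorphism and the comparison with `F` to cones and to objects of the
system. -/
lemma exists_iso_of_family (dec : ∀ Y, Decomp X Y) {F F' : C ⥤ D} [F.Additive] [F'.Additive]
    (α : ∀ i, F.obj (X i) ≅ F'.obj (X i))
    (hα : ∀ i j (f : X i ⟶ X j), F.map f ≫ (α j).hom = (α i).hom ≫ F'.map f) :
    ∃ e : F ≅ F', ∀ i, e.hom.app (X i) = (α i).hom := by
  have hα' : ∀ i j (f : X i ⟶ X j), F'.map f ≫ (α j).inv = (α i).inv ≫ F.map f := by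
    intro i j f
    rw [Iso.comp_inv_eq, assoc, hα, Iso.inv_hom_id_assoc]
  refine ⟨NatIso.ofComponents (fun Y => ⟨extendApp dec (fun i => (α i).hom) Y,
    extendApp dec (fun i => (α i).inv) Y, ?_, ?_⟩)
    (fun f => extendApp_naturality dec _ hα f), fun i => extendApp_self dec _ hα i⟩
  · rw [extendApp, Preadditive.sum_comp]
    simp only [assoc, map_extendApp dec (fun i => (α i).inv) hα', Iso.hom_inv_id_assoc]
    simp_rw [← F.map_comp]
    rw [← F.map_sum, (dec Y).total, F.map_id]
  · rw [extendApp, Preadditive.sum_comp]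
    simp only [assoc, map_extendApp dec (fun i => (α i).hom) hα, Iso.inv_hom_id_assoc]
    simp_rw [← F'.map_comp]
    rw [← F'.map_sum, (dec Y).total, F'.map_id]

end Extension

/-! ### Local endomorphism rings, retracts and indecomposables -/

section KrullSchmidt

variable {C : Type u₁} [Category.{v₁} C] [Preadditive C] {I : Type*} {X : I → C}

/-- In a local ring a finite sum of nonunits is a nonunit. -/
lemma exists_isIso_of_sum_eq_id {Y : C} [IsLocalRing (End Y)] {J : Type*} (s : Finset J)
    (f : J → (Y ⟶ Y)) (h : ∑ j ∈ s, f j = 𝟙 Y) : ∃ j ∈ s, IsIso (f j) := by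
  have key : ∀ t : Finset J, IsIso (∑ j ∈ t, f j) → ∃ j ∈ t, IsIso (f j) := by
    classical
    intro t
    induction t using Finset.induction_on with
    | empty =>
      intro h
      have h0 : (0 : End Y) ∈ nonunits (End Y) := fun h => zero_ne_one (isUnit_zero_iff.1 h)
      rw [Finset.sum_empty] at h
      exact (h0 ((isUnit_iff_isIso (0 : End Y)).2 h)).elim
    | insert a t ha ih =>
      intro h
      rw [Finset.sum_insert ha] at h
      have h' : IsUnit (M := End Y) (f a + ∑ j ∈ t, f j) := (isUnit_iff_isIso _).2 h
      rcases IsLocalRing.isUnit_or_isUnit_of_isUnit_add (R := End Y) h' with h₁ | h₁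
      · exact ⟨a, Finset.mem_insert_self _ _, (isUnit_iff_isIso _).1 h₁⟩
      · obtain ⟨j, hj, hj'⟩ := ih ((isUnit_iff_isIso _).1 h₁)
        exact ⟨j, Finset.mem_insert_of_mem hj, hj'⟩
  exact key s (by rw [h]; infer_instance)

/-- A retract with local endomorphism ring of a finite direct sum is a retract of a summand. -/
lemma exists_retract_of_decomp {Y Z : C} [IsLocalRing (End Y)] (r : Retract Y Z)
    (d : Decomp X Z) : ∃ j, Nonempty (Retract Y (X (d.idx j))) := by
  have h : ∑ j, (r.i ≫ d.π j) ≫ (d.ι j ≫ r.r) = 𝟙 Y := by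
    have := r.i ≫= d.total =≫ r.r
    simpa [Preadditive.comp_sum, Preadditive.sum_comp] using this
  obtain ⟨j, -, hj⟩ := exists_isIso_of_sum_eq_id _ _ h
  exact ⟨j, ⟨⟨r.i ≫ d.π j, (d.ι j ≫ r.r) ≫ inv ((r.i ≫ d.π j) ≫ (d.ι j ≫ r.r)), by
    rw [← assoc]; exact IsIso.hom_inv_id _⟩⟩⟩

/-- The idempotent `r.r ≫ r.i` of `Z` is trivial, and it cannot be zero unless `Y` is. -/
lemma isIso_of_retract {Y Z : C} (r : Retract Y Z) (hY : ¬ IsZero Y)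
    (hZ : ∀ f : Z ⟶ Z, f ≫ f = f → f = 0 ∨ f = 𝟙 Z) : IsIso r.i := by
  rcases hZ (r.r ≫ r.i) (by simp) with h | h
  · refine (hY ((IsZero.iff_id_eq_zero _).2 ?_)).elim
    have := r.i ≫= h =≫ r.r
    simpa using this
  · exact ⟨r.r, r.retract, h⟩

lemma not_isZero_of_isLocalRing {Y : C} [IsLocalRing (End Y)] : ¬ IsZero Y := fun h =>
  one_ne_zero (α := End Y) (h.eq_of_src _ _)

lemma isIso_or_eq_zero_of_idempotent {Y : C} [IsLocalRing (End Y)] (f : Y ⟶ Y) (hf : f ≫ f = f) :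
    f = 0 ∨ f = 𝟙 Y := by
  have h : f + (𝟙 Y - f) = 𝟙 Y := add_sub_cancel f (𝟙 Y)
  rcases IsLocalRing.isUnit_or_isUnit_of_add_one (R := End Y) h with h₁ | h₁
  · have : IsIso f := (isUnit_iff_isIso _).1 h₁
    right
    rw [← cancel_epi f, hf, comp_id]
  · have : IsIso (𝟙 Y - f) := (isUnit_iff_isIso _).1 h₁
    left
    rw [← cancel_mono (𝟙 Y - f), zero_comp, Preadditive.comp_sub, hf, comp_id, sub_self]

/-- An object with local endomorphism ring is indecomposable. -/
lemma indecomposable_of_idempotents [HasBinaryBiproducts C] {Y : C} (hY : ¬ IsZero Y)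
    (h : ∀ f : Y ⟶ Y, f ≫ f = f → f = 0 ∨ f = 𝟙 Y) : Indecomposable Y := by
  refine ⟨hY, fun Z W e => ?_⟩
  rcases h (e.hom ≫ biprod.fst ≫ biprod.inl ≫ e.inv) (by simp) with h | h
  · left
    rw [IsZero.iff_id_eq_zero]
    have := (biprod.inl ≫ e.inv) ≫= h =≫ (e.hom ≫ biprod.fst)
    simpa using this
  · right
    rw [IsZero.iff_id_eq_zero]
    have := (biprod.inr ≫ e.inv) ≫= h =≫ (e.hom ≫ biprod.snd)
    simpa using this.symm

/-- An indecomposable object which is a finite direct sum of nonzero members of a family is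
isomorphic to a member of the family. -/
lemma exists_iso_of_indecomposable [HasFiniteBiproducts C] [HasBinaryBiproducts C] {Y : C}
    (hY : Indecomposable Y) (h : sumsOf X Y) : ∃ i, Nonempty (Y ≅ X i) := by
  let Q : ObjectProperty C := fun Y => Indecomposable Y → ∃ i, Nonempty (Y ≅ X i)
  have : Q.IsClosedUnderIsomorphisms := ⟨fun {Y Z} e h hZ => by
    obtain ⟨i, ⟨e'⟩⟩ := h ⟨fun h0 => hZ.1 (h0.of_iso e.symm), fun A B e' => hZ.2 A B (e.symm ≪≫ e')⟩
    exact ⟨i, ⟨e.symm ≪≫ e'⟩⟩⟩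
  refine sumsOf_le (Q := Q) (fun Y h0 hY => (hY.1 h0).elim) (fun i _ => ⟨i, ⟨Iso.refl _⟩⟩) ?_ Y h hY
  intro Y Y' h h' hY
  rcases hY.2 Y Y' (Iso.refl _) with h0 | h0
  · have e : Y ⊞ Y' ≅ Y' :=
      { hom := biprod.snd
        inv := biprod.inr
        hom_inv_id := by
          ext
          · exact h0.eq_of_src _ _
          · exact h0.eq_of_src _ _
          · exact h0.eq_of_tgt _ _
          · simp }
    obtain ⟨i, ⟨e'⟩⟩ := h' ⟨fun hz => hY.1 (hz.of_iso e), fun A B e' => hY.2 A B (e ≪≫ e')⟩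
    exact ⟨i, ⟨e ≪≫ e'⟩⟩
  · have e : Y ⊞ Y' ≅ Y :=
      { hom := biprod.fst
        inv := biprod.inl
        hom_inv_id := by
          ext
          · simp
          · exact h0.eq_of_tgt _ _
          · exact h0.eq_of_src _ _
          · exact h0.eq_of_src _ _ }
    obtain ⟨i, ⟨e'⟩⟩ := h ⟨fun hz => hY.1 (hz.of_iso e), fun A B e' => hY.2 A B (e ≪≫ e')⟩
    exact ⟨i, ⟨e ≪≫ e'⟩⟩

/-- In a Krull-Schmidt category, objects are direct sums of objects with local endomorphism
rings. -/
lemma IsKrullSchmidt.exists_decomp [HasFiniteBiproducts C] (hC : IsKrullSchmidt C) (Y : C) :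
    ∃ (n : ℕ) (Z : Fin n → C), (∀ i, IsLocalRing (End (Z i))) ∧ Nonempty (Decomp Z Y) := by
  obtain ⟨n, Z, hZ, ⟨e⟩⟩ := hC Y
  exact ⟨n, Z, hZ, ⟨(Decomp.biproduct (X := Z) id).ofIso e.symm⟩⟩

/-- The summand of an object that has a given index in a decomposition, as a retract. -/
def Decomp.retract {Y : C} (d : Decomp X Y) (j : d.J) : Retract (X (d.idx j)) Y :=
  ⟨d.ι j, d.π j, d.ι_π_self j⟩

/-- In a Krull-Schmidt category, the members of a class of objects that is stable under retracts
are finite direct sums of those that have local endomorphism rings. -/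
lemma IsKrullSchmidt.sumsOf_of_isStableUnderRetracts [HasFiniteBiproducts C]
    (hC : IsKrullSchmidt C) (Q : ObjectProperty C) [Q.IsStableUnderRetracts]
    (hQ : ∀ Y, IsLocalRing (End Y) → Q Y → sumsOf X Y) {Y : C} (hY : Q Y) : sumsOf X Y := by
  obtain ⟨n, Z, hZ, ⟨d⟩⟩ := hC.exists_decomp Y
  exact ⟨d.trans fun j => (hQ _ (hZ _) (Q.prop_of_retract (d.retract j) hY)).some⟩

/-- In a Krull-Schmidt category, a class of finite direct sums of objects without nontrivial
idempotent endomorphisms is stable under retracts. -/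
lemma IsKrullSchmidt.isStableUnderRetracts [HasFiniteBiproducts C] (hC : IsKrullSchmidt C)
    (hX : ∀ i, ∀ f : X i ⟶ X i, f ≫ f = f → f = 0 ∨ f = 𝟙 _) :
    (sumsOf X).IsStableUnderRetracts where
  of_retract {Y Z} r := by
    rintro ⟨d'⟩
    obtain ⟨n, W, hW, ⟨d⟩⟩ := hC.exists_decomp Y
    refine ⟨d.trans fun j => Nonempty.some ?_⟩
    have := hW (d.idx j)
    obtain ⟨a, ⟨r'⟩⟩ := exists_retract_of_decomp ((d.retract j).trans r) d'
    have := isIso_of_retract r' not_isZero_of_isLocalRing (hX _)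
    exact ⟨(Decomp.single X _).ofIso (asIso r'.i).symm⟩

end KrullSchmidt

/-! ### Exactness properties of distinguished triangles -/

section Exactness

variable {C : Type u₁} [Category.{v₁} C] [Preadditive C] [HasZeroObject C] [HasShift C ℤ]
  [∀ n : ℤ, (shiftFunctor C n).Additive] [Pretriangulated C]
  {X Y Z : C} {f : X ⟶ Y} {g : Y ⟶ Z} {h : Z ⟶ X⟦(1 : ℤ)⟧}

lemma dist_zero₁₂ (H : Triangle.mk f g h ∈ distTriang C) : f ≫ g = 0 :=
  comp_distTriang_mor_zero₁₂ _ H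

lemma dist_zero₂₃ (H : Triangle.mk f g h ∈ distTriang C) : g ≫ h = 0 :=
  comp_distTriang_mor_zero₂₃ _ H

lemma dist_zero₃₁ (H : Triangle.mk f g h ∈ distTriang C) : h ≫ f⟦(1 : ℤ)⟧' = 0 :=
  comp_distTriang_mor_zero₃₁ _ H

lemma dist_rotate (H : Triangle.mk f g h ∈ distTriang C) :
    Triangle.mk g h (-f⟦(1 : ℤ)⟧') ∈ distTriang C :=
  rot_of_distTriang _ H

lemma dist_lift₂ (H : Triangle.mk f g h ∈ distTriang C) {W : C} (a : W ⟶ Y) (ha : a ≫ g = 0) :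
    ∃ b : W ⟶ X, a = b ≫ f :=
  Triangle.coyoneda_exact₂ _ H a ha

lemma dist_lift₃ (H : Triangle.mk f g h ∈ distTriang C) {W : C} (a : W ⟶ Z) (ha : a ≫ h = 0) :
    ∃ b : W ⟶ Y, a = b ≫ g :=
  Triangle.coyoneda_exact₃ _ H a ha

lemma dist_lift₁ (H : Triangle.mk f g h ∈ distTriang C) {W : C} (a : W ⟶ X⟦(1 : ℤ)⟧)
    (ha : a ≫ f⟦(1 : ℤ)⟧' = 0) : ∃ b : W ⟶ Z, a = b ≫ h :=
  Triangle.coyoneda_exact₁ _ H a ha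

lemma dist_desc₂ (H : Triangle.mk f g h ∈ distTriang C) {W : C} (a : Y ⟶ W) (ha : f ≫ a = 0) :
    ∃ b : Z ⟶ W, a = g ≫ b :=
  Triangle.yoneda_exact₂ _ H a ha

lemma dist_desc₃ (H : Triangle.mk f g h ∈ distTriang C) {W : C} (a : Z ⟶ W) (ha : g ≫ a = 0) :
    ∃ b : X⟦(1 : ℤ)⟧ ⟶ W, a = h ≫ b :=
  Triangle.yoneda_exact₃ _ H a ha

lemma dist_desc₁ (H : Triangle.mk f g h ∈ distTriang C) {W : C} (a : X⟦(1 : ℤ)⟧ ⟶ W)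
    (ha : h ≫ a = 0) : ∃ b : Y⟦(1 : ℤ)⟧ ⟶ W, a = f⟦(1 : ℤ)⟧' ≫ b := by
  obtain ⟨b, hb⟩ := dist_desc₃ (dist_rotate H) a ha
  exact ⟨-b, by rw [hb, Preadditive.neg_comp, Preadditive.comp_neg]⟩

lemma dist_fill {X' Y' Z' : C} {f' : X' ⟶ Y'} {g' : Y' ⟶ Z'} {h' : Z' ⟶ X'⟦(1 : ℤ)⟧}
    (H : Triangle.mk f g h ∈ distTriang C) (H' : Triangle.mk f' g' h' ∈ distTriang C)
    (a : X ⟶ X') (b : Y ⟶ Y') (w : f ≫ b = a ≫ f') :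
    ∃ c : Z ⟶ Z', g ≫ c = b ≫ g' ∧ h ≫ a⟦(1 : ℤ)⟧' = c ≫ h' :=
  complete_distinguished_triangle_morphism _ _ H H' a b w

lemma dist_of_iso {X' Y' Z' : C} {f' : X' ⟶ Y'} {g' : Y' ⟶ Z'} {h' : Z' ⟶ X'⟦(1 : ℤ)⟧}
    (H : Triangle.mk f g h ∈ distTriang C) (a : X ≅ X') (b : Y ≅ Y') (c : Z ≅ Z')
    (w₁ : f ≫ b.hom = a.hom ≫ f') (w₂ : g ≫ c.hom = b.hom ≫ g')
    (w₃ : h ≫ a.hom⟦(1 : ℤ)⟧' = c.hom ≫ h') : Triangle.mk f' g' h' ∈ distTriang C :=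
  isomorphic_distinguished _ H _ (Triangle.isoMk _ _ a b c w₁ w₂ w₃).symm

lemma dist_fill_iso {X' Y' Z' : C} {f' : X' ⟶ Y'} {g' : Y' ⟶ Z'} {h' : Z' ⟶ X'⟦(1 : ℤ)⟧}
    (H : Triangle.mk f g h ∈ distTriang C) (H' : Triangle.mk f' g' h' ∈ distTriang C)
    (a : X ≅ X') (b : Y ≅ Y') (w : f ≫ b.hom = a.hom ≫ f') :
    ∃ c : Z ≅ Z', g ≫ c.hom = b.hom ≫ g' ∧ h ≫ a.hom⟦(1 : ℤ)⟧' = c.hom ≫ h' := by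
  obtain ⟨c, hc, hc'⟩ := dist_fill H H' a.hom b.hom w
  have := isIso₃_of_isIso₁₂ (Triangle.homMk _ _ a.hom b.hom c w hc hc') H H'
    (inferInstanceAs (IsIso a.hom)) (inferInstanceAs (IsIso b.hom))
  exact ⟨@asIso _ _ _ _ c this, hc, hc'⟩

/-- The direct sum of two distinguished triangles can be completed to a distinguished triangle
whose second morphism is the expected one. -/
lemma dist_biprod {X' Y' Z' : C} {f' : X' ⟶ Y'} {g' : Y' ⟶ Z'} {h' : Z' ⟶ X'⟦(1 : ℤ)⟧}
    (H : Triangle.mk f g h ∈ distTriang C) (H' : Triangle.mk f' g' h' ∈ distTriang C) :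
    ∃ h'' : Z ⊞ Z' ⟶ (X ⊞ X')⟦(1 : ℤ)⟧,
      Triangle.mk (biprod.map f f') (biprod.map g g') h'' ∈ distTriang C := by
  let T : WalkingPair → Triangle C
    | WalkingPair.left => Triangle.mk f g h
    | WalkingPair.right => Triangle.mk f' g' h'
  have hT := productTriangle_distinguished T (by rintro (_ | _) <;> assumption)
  let e (F : WalkingPair → C) : ∏ᶜ F ≅ F .left ⊞ F .right :=
    { hom := biprod.lift (Pi.π F _) (Pi.π F _)
      inv := Pi.lift fun | .left => biprod.fst | .right => biprod.snd
      hom_inv_id := by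
        ext (_ | _) <;> simp
      inv_hom_id := by ext <;> simp }
  have he (F F' : WalkingPair → C) (φ : ∀ j, F j ⟶ F' j) :
      Limits.Pi.map φ ≫ (e F').hom = (e F).hom ≫ biprod.map (φ .left) (φ .right) := by
    ext <;> simp [e]
  exact ⟨(e fun j => (T j).obj₃).inv ≫ (productTriangle T).mor₃ ≫
    (e fun j => (T j).obj₁).hom⟦(1 : ℤ)⟧', dist_of_iso (f := (productTriangle T).mor₁)
    (g := (productTriangle T).mor₂) (h := (productTriangle T).mor₃) hT (e _) (e _) (e _)
    (he _ _ fun j => (T j).mor₁) (he _ _ fun j => (T j).mor₂)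
    (Iso.hom_inv_id_assoc (e fun j => (T j).obj₃) _).symm⟩

end Exactness

/-! ### Linear systems and the morphisms between their cones -/

section System

variable {k : Type w} [Field k] {M : Type*} [LinearOrder M] [OrderTop M]

/-- A linear system: objects `obj p` of a triangulated category indexed by a linear order with a
top element (the corresponding object being zero), such that the Hom space from `obj p` to `obj q`
is spanned by a morphism `e p q` which is nonzero exactly when `q ≤ p ≠ ⊤`, where the morphisms
`e p q` are compatible with the composition, and with the shift up to the scalars `c`. -/
structure LinSys (s : M → M) (c : M → M → k) (C : Type u₁) [Category.{v₁} C] [Preadditive C]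
    [Linear k C] [HasShift C ℤ] where
  obj : M → C
  e : ∀ p q, obj p ⟶ obj q
  σ : ∀ p, obj (s p) ≅ (obj p)⟦(1 : ℤ)⟧
  isZero_top : IsZero (obj ⊤)
  e_self : ∀ p, e p p = 𝟙 _
  e_comp : ∀ p q r, q ≤ p → r ≤ q → e p q ≫ e q r = e p r
  e_ne_zero : ∀ p q, p ≠ ⊤ → q ≤ p → e p q ≠ 0
  e_eq_zero : ∀ p q, ¬ q ≤ p → e p q = 0
  span : ∀ p q (f : obj p ⟶ obj q), ∃ a : k, f = a • e p q
  σ_nat : ∀ p q, (σ p).hom ≫ (e p q)⟦(1 : ℤ)⟧' = c p q • e (s p) (s q) ≫ (σ q).hom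
  s_mono : StrictMono s
  le_s : ∀ p, p ≤ s p
  s_surj : Function.Surjective s
  c_ne : ∀ p q, c p q ≠ 0

/-- A nonempty half-open interval `[q, p)`. -/
structure Ival (M : Type*) [LT M] where
  p : M
  q : M
  lt : q < p

/-- The condition for the existence of a nonzero morphism that is detected by the members of a
linear system. -/
def C1 (i j : Ival M) : Prop := j.q ≤ i.q ∧ i.q < j.p ∧ j.p ≤ i.p

/-- The condition for the existence of a nonzero morphism that is not detected by the members of a
linear system. -/
def C2 (s : M → M) (i j : Ival M) : Prop := s i.q < j.q ∧ j.q ≤ s i.p ∧ s i.p < j.p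

lemma C1_self {M : Type*} [LinearOrder M] (i : Ival M) : C1 i i := ⟨le_rfl, i.lt, le_rfl⟩

namespace LinSys

variable {s : M → M} {c : M → M → k} {C : Type u₁} [Category.{v₁} C] [Preadditive C]
    [Linear k C] [HasShift C ℤ] (D : LinSys s c C)

lemma s_top (D : LinSys s c C) : s ⊤ = ⊤ := top_le_iff.1 (D.le_s ⊤)

/-- The interval obtained by applying the shift to both ends. -/
abbrev shiftIval (i : Ival M) : Ival M := ⟨s i.p, s i.q, D.s_mono i.lt⟩

lemma C1_shiftIval {i j : Ival M} : C1 (D.shiftIval i) (D.shiftIval j) ↔ C1 i j := by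
  simp only [C1, D.s_mono.le_iff_le, D.s_mono.lt_iff_lt]

lemma shiftIval_surjective : Function.Surjective D.shiftIval := by
  rintro ⟨p, q, h⟩
  obtain ⟨p, rfl⟩ := D.s_surj p
  obtain ⟨q, rfl⟩ := D.s_surj q
  exact ⟨⟨p, q, D.s_mono.lt_iff_lt.1 h⟩, rfl⟩

lemma e_top_left (q : M) : D.e ⊤ q = 0 := D.isZero_top.eq_of_src _ _

lemma e_eq_zero_iff (p q : M) : D.e p q = 0 ↔ p = ⊤ ∨ ¬ q ≤ p := by
  constructor
  · intro h
    by_contra! h'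
    exact D.e_ne_zero p q h'.1 h'.2 h
  · rintro (rfl | h)
    · exact D.e_top_left q
    · exact D.e_eq_zero p q h

lemma smul_e_cancel {p q : M} {a : k} (h : a • D.e p q ≠ 0) : p ≠ ⊤ ∧ q ≤ p ∧ a ≠ 0 := by
  refine ⟨?_, ?_, ?_⟩
  · rintro rfl
    exact h (D.isZero_top.eq_of_src _ _)
  · by_contra hq
    exact h (by rw [D.e_eq_zero _ _ hq, smul_zero])
  · rintro rfl
    exact h (zero_smul _ _)

/-- A nonzero entry in a matrix of morphisms between members of a linear system, whose column has
the smallest possible index, divides all entries of its row. -/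
lemma exists_row {A : C} (d : Decomp D.obj A) (a : d.J) {q : M} (y : A ⟶ D.obj q)
    (hx : d.ι a ≫ y ≠ 0) (ha : ∀ a', d.ι a' ≫ y ≠ 0 → d.idx a ≤ d.idx a') :
    ∃ φ : A ⟶ D.obj (d.idx a), φ ≫ d.ι a ≫ y = y ∧ d.ι a ≫ φ = 𝟙 _ := by
  obtain ⟨u, hu⟩ := D.span _ _ (d.ι a ≫ y)
  obtain ⟨hp, hq, hu0⟩ := D.smul_e_cancel (hu ▸ hx)
  have h₁ : ∀ a', ∃ φ : D.obj (d.idx a') ⟶ D.obj (d.idx a), φ ≫ d.ι a ≫ y = d.ι a' ≫ y := by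
    intro a'
    by_cases h : d.ι a' ≫ y = 0
    · exact ⟨0, by rw [zero_comp, h]⟩
    · obtain ⟨u', hu'⟩ := D.span _ _ (d.ι a' ≫ y)
      refine ⟨(u' * u⁻¹) • D.e _ _, ?_⟩
      rw [hu, hu', Linear.smul_comp, Linear.comp_smul, D.e_comp _ _ _ (ha a' h) hq, smul_smul,
        mul_assoc, inv_mul_cancel₀ hu0, mul_one]
  choose φ hφ using h₁
  have hsum : (∑ a', d.π a' ≫ φ a') ≫ d.ι a ≫ y = y := by
    rw [Preadditive.sum_comp]
    simp_rw [assoc, hφ]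
    have := d.total =≫ y
    simpa [Preadditive.sum_comp] using this
  -- The restriction of the sum to the summand `a` is a scalar `v`, and `hsum` makes `v` fix the
  -- nonzero pivot, so `v = 1`.
  refine ⟨∑ a', d.π a' ≫ φ a', hsum, ?_⟩
  obtain ⟨v, hv⟩ := D.span _ _ (d.ι a ≫ ∑ a', d.π a' ≫ φ a')
  rw [D.e_self] at hv
  have h₂ := d.ι a ≫= hsum
  rw [← assoc, hv, Linear.smul_comp, id_comp] at h₂
  have h₃ : (v - 1) • (d.ι a ≫ y) = 0 := by rw [sub_smul, one_smul, h₂, sub_self]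
  rw [hv, sub_eq_zero.1 ((smul_eq_zero.1 h₃).resolve_right hx), one_smul]

/-- A nonzero entry in a matrix of morphisms between members of a linear system, whose row has
the largest possible index, divides all entries of its column. -/
lemma exists_column {B : C} (d : Decomp D.obj B) (b : d.J) {p : M} (y : D.obj p ⟶ B)
    (hx : y ≫ d.π b ≠ 0) (hb : ∀ b', y ≫ d.π b' ≠ 0 → d.idx b' ≤ d.idx b) :
    ∃ θ : D.obj (d.idx b) ⟶ B, (y ≫ d.π b) ≫ θ = y ∧ θ ≫ d.π b = 𝟙 _ := by
  obtain ⟨u, hu⟩ := D.span _ _ (y ≫ d.π b)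
  obtain ⟨hp, hq, hu0⟩ := D.smul_e_cancel (hu ▸ hx)
  have h₁ : ∀ b', ∃ θ : D.obj (d.idx b) ⟶ D.obj (d.idx b'), (y ≫ d.π b) ≫ θ = y ≫ d.π b' := by
    intro b'
    by_cases h : y ≫ d.π b' = 0
    · exact ⟨0, by rw [comp_zero, h]⟩
    · obtain ⟨u', hu'⟩ := D.span _ _ (y ≫ d.π b')
      refine ⟨(u' * u⁻¹) • D.e _ _, ?_⟩
      rw [hu, hu', Linear.smul_comp, Linear.comp_smul, D.e_comp _ _ _ hq (hb b' h), smul_smul,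
        mul_comm, mul_assoc, inv_mul_cancel₀ hu0, mul_one]
  choose θ hθ using h₁
  have hsum : (y ≫ d.π b) ≫ (∑ b', θ b' ≫ d.ι b') = y := by
    rw [Preadditive.comp_sum]
    simp_rw [← assoc (y ≫ d.π b), hθ]
    have := y ≫= d.total
    simpa [Preadditive.comp_sum] using this
  refine ⟨∑ b', θ b' ≫ d.ι b', hsum, ?_⟩
  obtain ⟨v, hv⟩ := D.span _ _ ((∑ b', θ b' ≫ d.ι b') ≫ d.π b)
  rw [D.e_self] at hv
  have h₂ := hsum =≫ d.π b
  rw [assoc, hv, Linear.comp_smul, comp_id] at h₂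
  have h₃ : (v - 1) • (y ≫ d.π b) = 0 := by rw [sub_smul, one_smul, h₂, sub_self]
  rw [hv, sub_eq_zero.1 ((smul_eq_zero.1 h₃).resolve_right hx), one_smul]

/-- Tested on objects of the system, `e p q` is a monomorphism, because composites of nonzero
generators are nonzero. This is why the connecting morphisms of cones are phantoms. -/
lemma comp_e_eq_zero {r p q : M} (hq : q ≤ p) (g : D.obj r ⟶ D.obj p) (h : g ≫ D.e p q = 0) :
    g = 0 := by
  obtain ⟨a, rfl⟩ := D.span _ _ g
  by_cases hr : p ≤ r
  · rw [Linear.smul_comp, D.e_comp _ _ _ hr hq, smul_eq_zero] at h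
    rcases h with h | h
    · simp [h]
    · rcases (D.e_eq_zero_iff _ _).1 h with rfl | h
      · simp [D.e_top_left]
      · exact (h (hq.trans hr)).elim
  · simp [D.e_eq_zero _ _ hr]

/-- A morphism that spans the Hom space from the shift of `obj p` to `obj q`. -/
def eS (p q : M) : (D.obj p)⟦(1 : ℤ)⟧ ⟶ D.obj q := (D.σ p).inv ≫ D.e (s p) q

lemma σ_inv_nat (p q : M) : (D.e p q)⟦(1 : ℤ)⟧' ≫ (D.σ q).inv =
    c p q • (D.σ p).inv ≫ D.e (s p) (s q) := by
  rw [Iso.comp_inv_eq, Linear.smul_comp, assoc, ← Linear.comp_smul, ← D.σ_nat,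
    Iso.inv_hom_id_assoc]

lemma shift_e_comp_eS {p q r : M} (hq : q ≤ p) (hr : r ≤ s q) :
    (D.e p q)⟦(1 : ℤ)⟧' ≫ D.eS q r = c p q • D.eS p r := by
  rw [eS, ← assoc, D.σ_inv_nat, Linear.smul_comp, assoc,
    D.e_comp _ _ _ (D.s_mono.monotone hq) hr, eS]

lemma eS_comp_e {p q r : M} (hq : q ≤ s p) (hr : r ≤ q) :
    D.eS p q ≫ D.e q r = D.eS p r := by
  rw [eS, assoc, D.e_comp _ _ _ hq hr, eS]

lemma comp_shift_e_eq_zero {r p q : M} (hq : q ≤ p) (g : D.obj r ⟶ (D.obj p)⟦(1 : ℤ)⟧)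
    (h : g ≫ (D.e p q)⟦(1 : ℤ)⟧' = 0) : g = 0 := by
  have h' : (g ≫ (D.σ p).inv) ≫ D.e (s p) (s q) = 0 := by
    have := h =≫ (D.σ q).inv
    rw [assoc, D.σ_inv_nat, zero_comp, Linear.comp_smul] at this
    simpa using (smul_eq_zero.1 this).resolve_left (D.c_ne _ _)
  have := D.comp_e_eq_zero (D.s_mono.monotone hq) _ h'
  rw [← cancel_mono (D.σ p).inv, this, zero_comp]

lemma not_C2_of_C1 (D : LinSys s c C) {i j : Ival M} (h : C1 i j) : ¬ C2 s i j := fun h' =>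
  absurd (D.le_s i.q) (not_le.2 (h'.1.trans_le h.1))

variable [HasZeroObject C] [∀ n : ℤ, (shiftFunctor C n).Additive] [Pretriangulated C]

lemma exists_cone (i : Ival M) : ∃ (Z : C) (g : D.obj i.q ⟶ Z) (h : Z ⟶ (D.obj i.p)⟦(1 : ℤ)⟧),
    Triangle.mk (D.e i.p i.q) g h ∈ distTriang C :=
  distinguished_cocone_triangle _

/-- The cone of `e i.p i.q`. -/
noncomputable def X (i : Ival M) : C := (D.exists_cone i).choose

/-- The canonical morphism to the cone of `e i.p i.q`. -/
noncomputable def qm (i : Ival M) : D.obj i.q ⟶ D.X i := (D.exists_cone i).choose_spec.choose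

/-- The canonical morphism from the cone of `e i.p i.q`. -/
noncomputable def hm (i : Ival M) : D.X i ⟶ (D.obj i.p)⟦(1 : ℤ)⟧ :=
  (D.exists_cone i).choose_spec.choose_spec.choose

lemma dist (i : Ival M) : Triangle.mk (D.e i.p i.q) (D.qm i) (D.hm i) ∈ distTriang C :=
  (D.exists_cone i).choose_spec.choose_spec.choose_spec

@[simp]
lemma e_qm (i : Ival M) : D.e i.p i.q ≫ D.qm i = 0 := comp_distTriang_mor_zero₁₂ _ (D.dist i)

@[simp]
lemma qm_hm (i : Ival M) : D.qm i ≫ D.hm i = 0 := comp_distTriang_mor_zero₂₃ _ (D.dist i)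

@[simp]
lemma hm_e (i : Ival M) : D.hm i ≫ (D.e i.p i.q)⟦(1 : ℤ)⟧' = 0 :=
  comp_distTriang_mor_zero₃₁ _ (D.dist i)

/-- The composite is killed by the shift of `e i.p i.q`, which is monic as far as the system can
see. So morphisms from the system to a cone lift along `qm`. -/
lemma comp_hm_eq_zero (i : Ival M) {r : M} (f : D.obj r ⟶ D.X i) : f ≫ D.hm i = 0 :=
  D.comp_shift_e_eq_zero i.lt.le _ (by simp)

lemma span_X (i : Ival M) {r : M} (f : D.obj r ⟶ D.X i) :
    ∃ a : k, f = a • (D.e r i.q ≫ D.qm i) := by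
  obtain ⟨g, hg⟩ := dist_lift₃ (D.dist i) f (D.comp_hm_eq_zero i f)
  obtain ⟨a, ha⟩ := D.span _ _ g
  exact ⟨a, by rw [hg, ha, Linear.smul_comp]⟩

lemma e_qm_eq_zero_iff (i : Ival M) (r : M) :
    D.e r i.q ≫ D.qm i = 0 ↔ ¬ (i.q ≤ r ∧ r < i.p) := by
  constructor
  · rintro h ⟨h₁, h₂⟩
    -- Vanishing would make `e r i.q` factor through `obj i.p`, to which `obj r` has no nonzero
    -- morphism when `r < i.p`.
    obtain ⟨y, hy⟩ := dist_lift₂ (D.dist i) _ h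
    obtain ⟨a, rfl⟩ := D.span _ _ y
    have h0 : D.e r i.p = 0 := D.e_eq_zero _ _ (not_le.2 h₂)
    refine D.e_ne_zero r i.q h₂.ne_top h₁ ?_
    rw [hy, h0, smul_zero, zero_comp]
  · intro h
    by_cases h₁ : i.q ≤ r
    · have h₂ : i.p ≤ r := by
        by_contra h₂
        exact h ⟨h₁, not_le.1 h₂⟩
      rw [← D.e_comp _ _ _ h₂ i.lt.le, assoc, e_qm, comp_zero]
    · rw [D.e_eq_zero _ _ h₁, zero_comp]

lemma hom_X_eq_zero (i : Ival M) {r : M} (h : ¬ (i.q ≤ r ∧ r < i.p)) (f : D.obj r ⟶ D.X i) :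
    f = 0 := by
  obtain ⟨a, rfl⟩ := D.span_X i f
  rw [(D.e_qm_eq_zero_iff i r).2 h, smul_zero]

/-- The morphisms between the cones that are not detected by the linear system. -/
noncomputable def ph (i j : Ival M) : D.X i ⟶ D.X j := D.hm i ≫ D.eS i.p j.q ≫ D.qm j

/-- Such a morphism factors through `hm i`, and the Hom space from the shift of `obj i.p` to `X j`
is spanned by one element. -/
lemma eq_smul_ph {i j : Ival M} (f : D.X i ⟶ D.X j) (h : D.qm i ≫ f = 0) :
    ∃ a : k, f = a • D.ph i j := by
  obtain ⟨g, hg⟩ := dist_desc₃ (D.dist i) f h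
  obtain ⟨a, ha⟩ := D.span_X j ((D.σ i.p).hom ≫ g)
  refine ⟨a, ?_⟩
  rw [hg, (Iso.eq_inv_comp _).2 ha, ph, eS, Linear.comp_smul, Linear.comp_smul, assoc]

lemma eS_qm_eq_zero_iff (j : Ival M) (p : M) :
    D.eS p j.q ≫ D.qm j = 0 ↔ ¬ (j.q ≤ s p ∧ s p < j.p) := by
  rw [← D.e_qm_eq_zero_iff, eS, assoc]
  constructor
  · intro h
    simpa using (D.σ p).hom ≫= h
  · intro h
    rw [h, comp_zero]

/-- The last two inequalities of `C2` say that `eS i.p j.q ≫ qm j` is nonzero. The first prevents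
that morphism from factoring through the shift of `e i.p i.q`, which is what `hm i` kills. -/
lemma ph_eq_zero_iff (i j : Ival M) : D.ph i j = 0 ↔ ¬ C2 s i j := by
  constructor
  · rintro h ⟨h₁, h₂, h₃⟩
    obtain ⟨y, hy⟩ := dist_desc₁ (D.dist i) _ h
    refine (D.eS_qm_eq_zero_iff j i.p).1 ?_ ⟨h₂, h₃⟩
    have hy0 : y = 0 := by
      rw [← cancel_epi (D.σ i.q).hom, comp_zero]
      exact D.hom_X_eq_zero j (fun h => not_le.2 h₁ h.1) _
    rw [hy, hy0, comp_zero]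
  · intro h
    by_cases h₁ : s i.q < j.q
    · rw [ph, (D.eS_qm_eq_zero_iff j i.p).2 (fun h' => h ⟨h₁, h'⟩), comp_zero]
    · have := D.shift_e_comp_eS i.lt.le (not_lt.1 h₁)
      rw [← inv_smul_eq_iff₀ (D.c_ne _ _)] at this
      simp [ph, ← this, ← assoc]

lemma eq_of_qm_comp {i j : Ival M} (h : ¬ C2 s i j) {f g : D.X i ⟶ D.X j}
    (hfg : D.qm i ≫ f = D.qm i ≫ g) : f = g := by
  obtain ⟨a, ha⟩ := D.eq_smul_ph (f - g) (by rw [Preadditive.comp_sub, hfg, sub_self])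
  rw [(D.ph_eq_zero_iff i j).2 h, smul_zero] at ha
  exact sub_eq_zero.1 ha

lemma exists_m {i j : Ival M} (h : C1 i j) : ∃ f : D.X i ⟶ D.X j,
    D.qm i ≫ f = D.e i.q j.q ≫ D.qm j ∧ D.hm i ≫ (D.e i.p j.p)⟦(1 : ℤ)⟧' = f ≫ D.hm j := by
  refine dist_fill (D.dist i) (D.dist j) (D.e i.p j.p) (D.e i.q j.q) ?_
  rw [D.e_comp _ _ _ i.lt.le h.1, D.e_comp _ _ _ h.2.2 j.lt.le]

open scoped Classical in
/-- A morphism that spans the Hom space between two cones. -/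
noncomputable def b (i j : Ival M) : D.X i ⟶ D.X j :=
  if h : C1 i j then (D.exists_m h).choose else D.ph i j

lemma qm_b {i j : Ival M} (h : C1 i j) : D.qm i ≫ D.b i j = D.e i.q j.q ≫ D.qm j := by
  rw [b, dif_pos h]
  exact (D.exists_m h).choose_spec.1

lemma b_hm {i j : Ival M} (h : C1 i j) :
    D.b i j ≫ D.hm j = D.hm i ≫ (D.e i.p j.p)⟦(1 : ℤ)⟧' := by
  rw [b, dif_pos h]
  exact (D.exists_m h).choose_spec.2.symm

lemma b_of_not_C1 {i j : Ival M} (h : ¬ C1 i j) : D.b i j = D.ph i j := by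
  rw [b, dif_neg h]

lemma b_of_C2 {i j : Ival M} (h : C2 s i j) : D.b i j = D.ph i j :=
  D.b_of_not_C1 (fun h' => D.not_C2_of_C1 h' h)

/-- The restriction along `qm` has one degree of freedom and the phantoms have one, but they never
occur together because `C1` and `C2` exclude each other. -/
lemma span_b {i j : Ival M} (f : D.X i ⟶ D.X j) : ∃ a : k, f = a • D.b i j := by
  obtain ⟨a, ha⟩ := D.span_X j (D.qm i ≫ f)
  by_cases h : C1 i j
  · refine ⟨a, D.eq_of_qm_comp (D.not_C2_of_C1 h) ?_⟩
    rw [ha, Linear.comp_smul, D.qm_b h]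
  · rw [D.b_of_not_C1 h]
    refine D.eq_smul_ph f ?_
    -- Here `C1` can only fail by `i.p < j.p`. Precomposing with `e i.p i.q` kills `qm i ≫ f`, but
    -- not `e i.q j.q ≫ qm j`, so the coefficient is zero.
    by_cases h₁ : j.q ≤ i.q ∧ i.q < j.p
    · have h₂ : i.p < j.p := by
        by_contra h₂
        exact h ⟨h₁.1, h₁.2, not_lt.1 h₂⟩
      have h₃ := D.e i.p i.q ≫= ha
      rw [← assoc, e_qm, zero_comp, Linear.comp_smul, ← assoc, D.e_comp _ _ _ i.lt.le h₁.1] at h₃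
      rcases smul_eq_zero.1 h₃.symm with h₄ | h₄
      · rw [ha, h₄, zero_smul]
      · exact ((D.e_qm_eq_zero_iff j i.p).1 h₄ ⟨h₁.1.trans i.lt.le, h₂⟩).elim
    · exact D.hom_X_eq_zero j h₁ _

lemma b_eq_zero_iff (i j : Ival M) : D.b i j = 0 ↔ ¬ C1 i j ∧ ¬ C2 s i j := by
  by_cases h : C1 i j
  · simp only [h, not_true_eq_false, false_and, iff_false]
    intro h0
    have := D.qm_b h
    rw [h0, comp_zero] at this
    exact (D.e_qm_eq_zero_iff j i.q).1 this.symm ⟨h.1, h.2.1⟩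
  · simp [h, D.b_of_not_C1 h, D.ph_eq_zero_iff]

lemma b_self (i : Ival M) : D.b i i = 𝟙 _ := by
  apply D.eq_of_qm_comp (D.not_C2_of_C1 (C1_self i))
  rw [D.qm_b (C1_self i), D.e_self, id_comp, comp_id]

end LinSys

end System

/-! ### Structure constants for composition and shift -/

section Constants

variable {k : Type w} [Field k] {M : Type*} [LinearOrder M] [OrderTop M]

open scoped Classical in
/-- The structure constants for the composition of the morphisms `LinSys.b`. -/
noncomputable def kappa (s : M → M) (c : M → M → k) (i j l : Ival M) : k :=
  if C1 i j ∧ C1 j l then 1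
  -- Without `C2 s i l` the composite is zero while `b i l` need not vanish, so the constant must be
  -- zero.
  else if C1 i j ∧ C2 s j l ∧ C2 s i l then c i.p j.p
  else if C2 s i j ∧ C1 j l ∧ C2 s i l then 1 else 0

open scoped Classical in
/-- The structure constants for the shift of the morphisms `LinSys.b`. -/
noncomputable def shiftConst (s : M → M) (c : M → M → k) (i j : Ival M) : k :=
  if C1 i j then c i.p i.q * c i.q j.q * (c j.p j.q)⁻¹ else -(c (s i.p) j.q * (c j.p j.q)⁻¹)

namespace LinSys

variable {s : M → M} {c : M → M → k} {C : Type u₁} [Category.{v₁} C] [Preadditive C]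
    [Linear k C] [HasShift C ℤ] [HasZeroObject C] [∀ n : ℤ, (shiftFunctor C n).Additive]
    [Pretriangulated C] (D : LinSys s c C)

lemma b_comp_of_C1_of_C1 {i j l : Ival M} (hij : C1 i j) (hjl : C1 j l) :
    D.b i j ≫ D.b j l = D.b i l := by
  have hlq : l.q ≤ i.q := hjl.1.trans hij.1
  have hlp : l.p ≤ i.p := hjl.2.2.trans hij.2.2
  have h2 : ¬ C2 s i l := fun h => absurd (D.le_s i.q) (not_le.2 (h.1.trans_le hlq))
  apply D.eq_of_qm_comp h2
  rw [← assoc, D.qm_b hij, assoc, D.qm_b hjl, ← assoc, D.e_comp _ _ _ hij.1 hjl.1]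
  by_cases h : C1 i l
  · rw [D.qm_b h]
  · rw [(D.b_eq_zero_iff i l).2 ⟨h, h2⟩, comp_zero, D.e_qm_eq_zero_iff]
    exact fun h' => h ⟨h'.1, h'.2, hlp⟩

/-- On third terms `b i j` induces the shift of `e i.p j.p`, and moving the shift past `σ` costs the
scalar `c i.p j.p`. -/
lemma b_comp_ph {i j l : Ival M} (hij : C1 i j) (hjl : C2 s j l) :
    D.b i j ≫ D.ph j l = c i.p j.p • D.ph i l := by
  have h := D.shift_e_comp_eS hij.2.2 hjl.2.1
  rw [ph, ← assoc, D.b_hm hij, assoc, ← assoc (_⟦(1 : ℤ)⟧'), h, Linear.smul_comp,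
    Linear.comp_smul, ph]

lemma ph_comp_b {i j l : Ival M} (hij : C2 s i j) (hjl : C1 j l) :
    D.ph i j ≫ D.b j l = D.ph i l := by
  rw [ph, assoc, assoc, D.qm_b hjl, ← assoc (D.eS _ _), D.eS_comp_e hij.2.1 hjl.1, ph]

lemma b_comp (i j l : Ival M) : D.b i j ≫ D.b j l = kappa s c i j l • D.b i l := by
  by_cases hij : C1 i j
  · by_cases hjl : C1 j l
    · rw [D.b_comp_of_C1_of_C1 hij hjl, kappa, if_pos ⟨hij, hjl⟩, one_smul]
    · rw [D.b_of_not_C1 hjl, kappa, if_neg (fun h => hjl h.2)]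
      by_cases hjl' : C2 s j l
      · rw [D.b_comp_ph hij hjl']
        by_cases hil : C2 s i l
        · rw [if_pos ⟨hij, hjl', hil⟩, D.b_of_C2 hil]
        · rw [if_neg (fun h => hil h.2.2), if_neg (fun h => hil h.2.2),
            (D.ph_eq_zero_iff i l).2 hil, smul_zero, zero_smul]
      · rw [if_neg (fun h => hjl' h.2.1), if_neg (fun h => hjl h.2.1),
          (D.ph_eq_zero_iff j l).2 hjl', comp_zero, zero_smul]
  · rw [D.b_of_not_C1 hij, kappa, if_neg (fun h => hij h.1), if_neg (fun h => hij h.1)]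
    by_cases hij' : C2 s i j
    · by_cases hjl : C1 j l
      · rw [D.ph_comp_b hij' hjl]
        by_cases hil : C2 s i l
        · rw [if_pos ⟨hij', hjl, hil⟩, one_smul, D.b_of_C2 hil]
        · rw [if_neg (fun h => hil h.2.2), (D.ph_eq_zero_iff i l).2 hil, zero_smul]
      -- Two phantoms compose to zero, because the composite passes through `qm j ≫ hm j`.
      · rw [if_neg (fun h => hjl h.2.1), D.b_of_not_C1 hjl, zero_smul, ph, ph]
        simp only [assoc]
        rw [← assoc (D.qm j), qm_hm, zero_comp, comp_zero, comp_zero]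
    · rw [if_neg (fun h => hij' h.1), (D.ph_eq_zero_iff i j).2 hij', zero_comp, zero_smul]

/-- An isomorphism scaled by a nonzero scalar. -/
def smulIso {a : k} (ha : a ≠ 0) {Y Z : C} (f : Y ≅ Z) : Y ≅ Z where
  hom := a • f.hom
  inv := a⁻¹ • f.inv
  hom_inv_id := by simp [smul_smul, ha]
  inv_hom_id := by simp [smul_smul, ha]

lemma exists_rho (i : Ival M) : ∃ ρ : D.X (D.shiftIval i) ≅ (D.X i)⟦(1 : ℤ)⟧,
    D.qm (D.shiftIval i) ≫ ρ.hom = c i.p i.q • (D.σ i.q).hom ≫ (D.qm i)⟦(1 : ℤ)⟧' ∧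
    ρ.hom ≫ (D.hm i)⟦(1 : ℤ)⟧' = -(D.hm (D.shiftIval i) ≫ (D.σ i.p).hom⟦(1 : ℤ)⟧') := by
  -- Rotating three times negates all three morphisms. The scalar `-c i.p i.q` on the second term
  -- absorbs the sign of the first one and the failure of `σ` to be natural; a sign survives on the
  -- third.
  have hc : -c i.p i.q ≠ 0 := neg_ne_zero.2 (D.c_ne _ _)
  obtain ⟨ρ, h₁, h₂⟩ := dist_fill_iso (D.dist (D.shiftIval i))
    (dist_rotate (dist_rotate (dist_rotate (D.dist i)))) (D.σ i.p) (smulIso hc (D.σ i.q)) (by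
      dsimp only [smulIso]
      rw [Preadditive.comp_neg, D.σ_nat, neg_smul, Preadditive.comp_neg, Linear.comp_smul])
  refine ⟨ρ, ?_, ?_⟩
  · rw [h₁]
    simp [smulIso]
  · rw [h₂, Preadditive.comp_neg, neg_neg]

/-- The comparison between the cones and their shifts. -/
noncomputable def rho (i : Ival M) : D.X (D.shiftIval i) ≅ (D.X i)⟦(1 : ℤ)⟧ :=
  (D.exists_rho i).choose

lemma qm_rho (i : Ival M) : D.qm (D.shiftIval i) ≫ (D.rho i).hom =
    c i.p i.q • (D.σ i.q).hom ≫ (D.qm i)⟦(1 : ℤ)⟧' := (D.exists_rho i).choose_spec.1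

lemma rho_hm (i : Ival M) : (D.rho i).hom ≫ (D.hm i)⟦(1 : ℤ)⟧' =
    -(D.hm (D.shiftIval i) ≫ (D.σ i.p).hom⟦(1 : ℤ)⟧') := (D.exists_rho i).choose_spec.2

lemma σ_qm (i : Ival M) : (D.σ i.q).hom ≫ (D.qm i)⟦(1 : ℤ)⟧' =
    (c i.p i.q)⁻¹ • D.qm (D.shiftIval i) ≫ (D.rho i).hom := by
  rw [qm_rho, smul_smul, inv_mul_cancel₀ (D.c_ne _ _), one_smul]

/-- Under `C1` both sides are determined by their restriction along `qm`. Otherwise both `b` are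
phantoms and can be expanded; the sign is the one in `rho_hm`. -/
lemma rho_b (i j : Ival M) : (D.rho i).hom ≫ (D.b i j)⟦(1 : ℤ)⟧' =
    shiftConst s c i j • D.b (D.shiftIval i) (D.shiftIval j) ≫ (D.rho j).hom := by
  by_cases h : C1 i j
  · have h' := (D.C1_shiftIval (i := i) (j := j)).2 h
    rw [← cancel_mono (D.rho j).inv, Linear.smul_comp]
    simp only [assoc, Iso.hom_inv_id, comp_id]
    apply D.eq_of_qm_comp (D.not_C2_of_C1 h')
    rw [Linear.comp_smul, D.qm_b h', ← assoc, D.qm_rho, Linear.smul_comp, assoc,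
      ← assoc (_⟦(1 : ℤ)⟧'), ← Functor.map_comp, D.qm_b h, Functor.map_comp, assoc,
      ← assoc (D.σ i.q).hom, D.σ_nat, Linear.smul_comp, assoc, ← assoc (D.σ j.q).hom, D.σ_qm,
      Linear.smul_comp, assoc, Iso.hom_inv_id, comp_id, Linear.comp_smul, smul_smul, smul_smul,
      shiftConst, if_pos h]
  · have h' := mt (D.C1_shiftIval (i := i) (j := j)).1 h
    rw [D.b_of_not_C1 h, D.b_of_not_C1 h', shiftConst, if_neg h]
    have h₁ : (D.e (s i.p) j.q)⟦(1 : ℤ)⟧' =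
        c (s i.p) j.q • (D.σ (s i.p)).inv ≫ D.e (s (s i.p)) (s j.q) ≫ (D.σ j.q).hom := by
      rw [← Linear.comp_smul, ← D.σ_nat, Iso.inv_hom_id_assoc]
    have h₂ : (D.σ i.p).hom⟦(1 : ℤ)⟧' ≫ (D.eS i.p j.q)⟦(1 : ℤ)⟧' = (D.e (s i.p) j.q)⟦(1 : ℤ)⟧' := by
      rw [← Functor.map_comp, eS, Iso.hom_inv_id_assoc]
    rw [ph, Functor.map_comp, Functor.map_comp, ← assoc, D.rho_hm, Preadditive.neg_comp, assoc,
      ← assoc (_⟦(1 : ℤ)⟧'), h₂, h₁, Linear.smul_comp, assoc, assoc, D.σ_qm,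
      Linear.comp_smul, Linear.comp_smul, Linear.comp_smul, Linear.comp_smul, smul_smul, neg_smul,
      ph, eS]
    simp only [assoc]

end LinSys

end Constants

/-! ### The functor between two categories with matching linear systems -/

section Comparison

variable {k : Type w} [Field k] {M : Type*} [LinearOrder M] [OrderTop M]
  {s : M → M} {c : M → M → k}
  {C : Type u₁} [Category.{v₁} C] [Preadditive C] [Linear k C] [HasShift C ℤ] [HasZeroObject C]
  [∀ n : ℤ, (shiftFunctor C n).Additive] [Pretriangulated C] (D : LinSys s c C)
  {C' : Type u₂} [Category.{v₂} C'] [Preadditive C'] [Linear k C'] [HasShift C' ℤ]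
  [HasZeroObject C'] [∀ n : ℤ, (shiftFunctor C' n).Additive] [Pretriangulated C']
  (D' : LinSys s c C')

namespace LinSys

/-- The map between Hom spaces that sends `D.b i j` to `D'.b i j`. -/
noncomputable def psiFun {i j : Ival M} (f : D.X i ⟶ D.X j) : D'.X i ⟶ D'.X j :=
  (D.span_b f).choose • D'.b i j

/-- The chosen coefficient is unique if `D.b i j` is nonzero. Otherwise `D'.b i j` vanishes too,
since vanishing depends only on `C1` and `C2`. -/
lemma psiFun_smul {i j : Ival M} (a : k) : psiFun D D' (a • D.b i j) = a • D'.b i j := by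
  have h := (D.span_b (a • D.b i j)).choose_spec
  rw [psiFun]
  by_cases hb : D.b i j = 0
  · have hb' : D'.b i j = 0 := by
      rw [b_eq_zero_iff] at hb ⊢
      exact hb
    rw [hb', smul_zero, smul_zero]
  · rw [smul_left_injective k hb h.symm]

/-- The map between Hom spaces that sends `D.b i j` to `D'.b i j`, as an additive map. -/
noncomputable def psi (i j : Ival M) : (D.X i ⟶ D.X j) →+ (D'.X i ⟶ D'.X j) :=
  AddMonoidHom.mk' (psiFun D D') (by
    intro f g
    obtain ⟨a, rfl⟩ := D.span_b f
    obtain ⟨a', rfl⟩ := D.span_b g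
    rw [← add_smul, psiFun_smul, psiFun_smul, psiFun_smul, add_smul])

@[simp]
lemma psi_smul_b {i j : Ival M} (a : k) : psi D D' i j (a • D.b i j) = a • D'.b i j :=
  psiFun_smul D D' a

@[simp]
lemma psi_b (i j : Ival M) : psi D D' i j (D.b i j) = D'.b i j := by
  simpa using psi_smul_b D D' (i := i) (j := j) 1

lemma psi_id (i : Ival M) : psi D D' i i (𝟙 _) = 𝟙 _ := by
  rw [← D.b_self, psi_b, D'.b_self]

/-- Both sides are governed by the same constant `kappa s c i j l`. -/
lemma psi_comp (i j l : Ival M) (f : D.X i ⟶ D.X j) (g : D.X j ⟶ D.X l) :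
    psi D D' i l (f ≫ g) = psi D D' i j f ≫ psi D D' j l g := by
  obtain ⟨a, rfl⟩ := D.span_b f
  obtain ⟨a', rfl⟩ := D.span_b g
  simp [b_comp, smul_smul]

lemma psi_injective (i j : Ival M) : Function.Injective (psi D D' i j) := by
  rw [injective_iff_map_eq_zero]
  intro f hf
  obtain ⟨a, rfl⟩ := D.span_b f
  rw [psi_smul_b, smul_eq_zero] at hf
  rcases hf with h | h
  · rw [h, zero_smul]
  · have h' : D.b i j = 0 := by
      rw [b_eq_zero_iff] at h ⊢
      exact h
    rw [h', smul_zero]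

lemma psi_surjective (i j : Ival M) : Function.Surjective (psi D D' i j) := by
  intro f
  obtain ⟨a, rfl⟩ := D'.span_b f
  exact ⟨a • D.b i j, psi_smul_b D D' a⟩

lemma psi_shift [(shiftFunctor C (1 : ℤ)).Linear k] [(shiftFunctor C' (1 : ℤ)).Linear k]
    {i j : Ival M} (f : D.X i ⟶ D.X j) :
    psi D D' _ _ ((D.rho i).hom ≫ f⟦(1 : ℤ)⟧' ≫ (D.rho j).inv) ≫ (D'.rho j).hom =
      (D'.rho i).hom ≫ (psi D D' i j f)⟦(1 : ℤ)⟧' := by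
  obtain ⟨a, rfl⟩ := D.span_b f
  have h : (D.rho i).hom ≫ (a • D.b i j)⟦(1 : ℤ)⟧' ≫ (D.rho j).inv =
      (a * shiftConst s c i j) • D.b (D.shiftIval i) (D.shiftIval j) := by
    rw [Functor.map_smul, Linear.smul_comp, Linear.comp_smul, ← assoc, D.rho_b, Linear.smul_comp,
      assoc, Iso.hom_inv_id, comp_id, smul_smul]
  rw [h, psi_smul_b, psi_smul_b, Functor.map_smul, Linear.comp_smul, D'.rho_b, smul_smul,
    Linear.smul_comp]

variable (dec : ∀ Y, Decomp D.X Y)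

/-- The functor determined by two linear systems with the same scalars. -/
noncomputable def functor : C ⥤ C' :=
  extend dec (psi D D') (psi_id D D') (psi_comp D D')

instance functor_additive : (functor D D' dec).Additive := extend_additive _ _ _ _

instance functor_faithful : (functor D D' dec).Faithful :=
  extend_faithful _ _ _ _ (psi_injective D D')

instance functor_full : (functor D D' dec).Full :=
  extend_full _ _ _ _ (psi_surjective D D')

/-- The functor sends the cones to the cones. -/
noncomputable def functorIso (i : Ival M) : (functor D D' dec).obj (D.X i) ≅ D'.X i :=
  extendIso dec (psi D D') (psi_id D D') (psi_comp D D') i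

lemma functorIso_naturality {i j : Ival M} (f : D.X i ⟶ D.X j) :
    (functor D D' dec).map f ≫ (functorIso D D' dec j).hom =
      (functorIso D D' dec i).hom ≫ psi D D' i j f :=
  extendIso_naturality dec (psi D D') (psi_id D D') (psi_comp D D') f

variable [(shiftFunctor C (1 : ℤ)).Linear k] [(shiftFunctor C' (1 : ℤ)).Linear k]

/-- The values of the compatibility of the functor with the shift. -/
noncomputable def suspApp (i : Ival M) :
    (functor D D' dec).obj ((D.X i)⟦(1 : ℤ)⟧) ≅ ((functor D D' dec).obj (D.X i))⟦(1 : ℤ)⟧ :=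
  (functor D D' dec).mapIso (D.rho i).symm ≪≫ functorIso D D' dec (D.shiftIval i) ≪≫
    D'.rho i ≪≫ (shiftFunctor C' (1 : ℤ)).mapIso (functorIso D D' dec i).symm

lemma exists_suspIso : ∃ φ : SuspIso (functor D D' dec),
    ∀ i, φ.hom.app (D.X i) = (suspApp D D' dec i).hom := by
  -- Naturality is needed only on cones, where it comes down to `psi_shift`.
  refine exists_iso_of_family (F := shiftFunctor C (1 : ℤ) ⋙ functor D D' dec)
    (F' := functor D D' dec ⋙ shiftFunctor C' (1 : ℤ)) dec (suspApp D D' dec) fun i j f => ?_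
  have h₁ : (functor D D' dec).map (f⟦(1 : ℤ)⟧') ≫ (functor D D' dec).map (D.rho j).inv =
      (functor D D' dec).map (D.rho i).inv ≫
        (functor D D' dec).map ((D.rho i).hom ≫ f⟦(1 : ℤ)⟧' ≫ (D.rho j).inv) := by
    simp only [← Functor.map_comp, Iso.inv_hom_id_assoc]
  have h₂ : (psi D D' i j f)⟦(1 : ℤ)⟧' ≫ (functorIso D D' dec j).inv⟦(1 : ℤ)⟧' =
      (functorIso D D' dec i).inv⟦(1 : ℤ)⟧' ≫ ((functor D D' dec).map f)⟦(1 : ℤ)⟧' := by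
    simp only [← Functor.map_comp]
    congr 1
    rw [Iso.comp_inv_eq, assoc, functorIso_naturality, Iso.inv_hom_id_assoc]
  dsimp [suspApp]
  simp only [assoc]
  rw [← h₂, ← assoc ((functor D D' dec).map _), h₁, assoc,
    ← assoc ((functor D D' dec).map ((D.rho i).hom ≫ _)), functorIso_naturality, assoc,
    ← assoc (psi D D' _ _ _), psi_shift, assoc]

end LinSys

end Comparison

/-! ### Splitting off a summand along modified maps -/

section Splitting

variable {C : Type u₁} [Category.{v₁} C] [Preadditive C] {I : Type*} {X : I → C}

/-- Splitting off one summand of a decomposition, along modified inclusions and projections. -/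
lemma Decomp.split [HasFiniteBiproducts C] [HasBinaryBiproducts C] {Y : C} (d : Decomp X Y)
    (a : d.J) (ι : X (d.idx a) ⟶ Y) (φ : Y ⟶ X (d.idx a)) (h : ι ≫ φ = 𝟙 _)
    (hd : ι = d.ι a ∨ φ = d.π a) :
    ∃ (K : C) (dK : Decomp X K) (e : Y ≅ X (d.idx a) ⊞ K),
      Fintype.card dK.J + 1 = Fintype.card d.J ∧ e.hom ≫ biprod.fst = φ ∧
      biprod.inl ≫ e.inv = ι := by
  classical
  have hι : ι ≫ (𝟙 _ - φ ≫ ι) = 0 := by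
    rw [Preadditive.comp_sub, ← assoc, h, id_comp, comp_id, sub_self]
  have hφ : (𝟙 _ - φ ≫ ι) ≫ φ = 0 := by
    rw [Preadditive.sub_comp, assoc, h, id_comp, comp_id, sub_self]
  -- The complement is cut out by the idempotent `𝟙 _ - φ ≫ ι`. Since `ι` or `φ` is the original
  -- map, the correction does not change the matrix entries away from `a`.
  have hvu : ∀ x y : d.J, x ≠ a → y ≠ a →
      d.ι x ≫ (𝟙 _ - φ ≫ ι) ≫ (𝟙 _ - φ ≫ ι) ≫ d.π y = d.ι x ≫ d.π y := by
    intro x y hx hy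
    have h₁ : (𝟙 _ - φ ≫ ι) ≫ (𝟙 _ - φ ≫ ι) = 𝟙 _ - φ ≫ ι := by
      rw [Preadditive.comp_sub, comp_id, ← assoc, hφ, zero_comp, sub_zero]
    rw [← assoc (𝟙 _ - φ ≫ ι), h₁, Preadditive.sub_comp, Preadditive.comp_sub, id_comp, assoc]
    rcases hd with rfl | rfl
    · rw [d.ι_π_ne _ _ hy.symm, comp_zero, comp_zero, sub_zero]
    · rw [← assoc (d.ι x), d.ι_π_ne _ _ hx, zero_comp, sub_zero]
  have htot : (𝟙 Y - φ ≫ ι) ≫ d.π a ≫ d.ι a ≫ (𝟙 Y - φ ≫ ι) = 0 := by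
    rcases hd with rfl | rfl
    · rw [hι, comp_zero, comp_zero]
    · rw [← assoc, hφ, zero_comp]
  have hsum : ∑ x : {j : d.J // j ≠ a},
      ((𝟙 Y - φ ≫ ι) ≫ d.π x.1) ≫ (d.ι x.1 ≫ (𝟙 Y - φ ≫ ι)) = 𝟙 Y - φ ≫ ι := by
    have h₁ : ∑ x : d.J, ((𝟙 Y - φ ≫ ι) ≫ d.π x) ≫ (d.ι x ≫ (𝟙 Y - φ ≫ ι)) =
        𝟙 Y - φ ≫ ι := by
      calc _ = (𝟙 Y - φ ≫ ι) ≫ (∑ x : d.J, d.π x ≫ d.ι x) ≫ (𝟙 Y - φ ≫ ι) := by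
            simp only [Preadditive.comp_sum, Preadditive.sum_comp, assoc]
        _ = _ := by
            rw [d.total, id_comp, Preadditive.comp_sub, comp_id, ← assoc, hφ, zero_comp, sub_zero]
    rw [← Finset.add_sum_erase _ _ (Finset.mem_univ a), assoc, htot, zero_add] at h₁
    refine Eq.trans ?_ h₁
    exact (Finset.sum_subtype (Finset.univ.erase a) (p := fun j => j ≠ a) (by simp)
      (fun x => ((𝟙 Y - φ ≫ ι) ≫ d.π x) ≫ (d.ι x ≫ (𝟙 Y - φ ≫ ι)))).symm
  refine ⟨⨁ fun x : {j : d.J // j ≠ a} => X (d.idx x.1),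
    Decomp.biproduct (X := X) (fun x : {j : d.J // j ≠ a} => d.idx x.1),
    { hom := biprod.lift φ (biproduct.lift fun x => (𝟙 _ - φ ≫ ι) ≫ d.π x.1)
      inv := biprod.desc ι (biproduct.desc fun x => d.ι x.1 ≫ (𝟙 _ - φ ≫ ι))
      hom_inv_id := by
        rw [biprod.lift_desc, biproduct.lift_desc, hsum, add_sub_cancel]
      inv_hom_id := ?_ }, ?_, by simp, by simp⟩
  · apply biprod.hom_ext'
    · apply biprod.hom_ext
      · simpa using h
      · refine biproduct.hom_ext _ _ fun x => ?_
        simp only [assoc, biprod.inl_desc_assoc, biprod.lift_snd, biproduct.lift_π, id_comp,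
          biprod.inl_snd, zero_comp]
        rw [← assoc, hι, zero_comp]
    · refine biproduct.hom_ext' _ _ fun x => ?_
      apply biprod.hom_ext
      · simp only [assoc, biprod.inr_desc_assoc, biproduct.ι_desc_assoc, biprod.lift_fst,
          id_comp, biprod.inr_fst, comp_zero]
        rw [hφ, comp_zero]
      · refine biproduct.hom_ext _ _ fun y => ?_
        simp only [assoc, biprod.inr_desc_assoc, biproduct.ι_desc_assoc, biprod.lift_snd,
          biproduct.lift_π, id_comp, biprod.inr_snd_assoc]
        rw [hvu _ _ x.2 y.2]
        by_cases hxy : x = y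
        · subst hxy
          simp
        · rw [d.ι_π_ne _ _ (fun h => hxy (Subtype.ext h)), biproduct.ι_π_ne _ hxy]
  · change Fintype.card {j : d.J // j ≠ a} + 1 = _
    rw [Fintype.card_subtype_compl, Fintype.card_subtype_eq]
    exact Nat.sub_add_cancel (Fintype.card_pos_iff.2 ⟨a⟩)

end Splitting

/-! ### Stability of direct sums under the shift -/

section ShiftStable

variable {C : Type u₁} [Category.{v₁} C] [HasShift C ℤ]

lemma isStableUnderShift_of_one (P : ObjectProperty C) [P.IsClosedUnderIsomorphisms]
    (h₁ : ∀ Y, P Y → P (Y⟦(1 : ℤ)⟧)) (h₂ : ∀ Y, P Y → P (Y⟦(-1 : ℤ)⟧)) :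
    P.IsStableUnderShift ℤ where
  isStableUnderShiftBy n := ⟨fun Y hY => by
    change P (Y⟦n⟧)
    induction n using Int.induction_on with
    | zero => exact P.prop_of_iso ((shiftFunctorZero C ℤ).app Y).symm hY
    | succ n ih => exact P.prop_of_iso ((shiftFunctorAdd C (n : ℤ) 1).app Y).symm (h₁ _ ih)
    | pred n ih => exact P.prop_of_iso ((shiftFunctorAdd C (-n : ℤ) (-1)).app Y).symm (h₂ _ ih)⟩

variable [Preadditive C] [∀ n : ℤ, (shiftFunctor C n).Additive] {I : Type*} {X : I → C}

lemma sumsOf_isStableUnderShift (h₁ : ∀ i, sumsOf X ((X i)⟦(1 : ℤ)⟧))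
    (h₂ : ∀ i, sumsOf X ((X i)⟦(-1 : ℤ)⟧)) : (sumsOf X).IsStableUnderShift ℤ :=
  isStableUnderShift_of_one _
    (fun _ ⟨d⟩ => sumsOf_trans ⟨d.map (shiftFunctor C (1 : ℤ))⟩ h₁)
    (fun _ ⟨d⟩ => sumsOf_trans ⟨d.map (shiftFunctor C (-1 : ℤ))⟩ h₂)

lemma sumsOf_isStableUnderShift_of_iso (s : I → I) (hs : Function.Surjective s)
    (e : ∀ i, X (s i) ≅ (X i)⟦(1 : ℤ)⟧) : (sumsOf X).IsStableUnderShift ℤ := by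
  refine sumsOf_isStableUnderShift
    (fun i => (sumsOf X).prop_of_iso (e i) (sumsOf_single X (s i))) (fun i => ?_)
  obtain ⟨i, rfl⟩ := hs i
  exact (sumsOf X).prop_of_iso ((shiftShiftNeg (X i) (1 : ℤ)).symm ≪≫
    (shiftFunctor C (-1 : ℤ)).mapIso (e i).symm) (sumsOf_single X i)

lemma LinSys.isStableUnderShift_obj {k : Type w} [Field k] {M : Type*} [LinearOrder M]
    [OrderTop M] {s : M → M} {c : M → M → k} [Linear k C] (D : LinSys s c C) :
    (sumsOf D.obj).IsStableUnderShift ℤ :=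
  sumsOf_isStableUnderShift_of_iso s D.s_surj D.σ

end ShiftStable

/-! ### Every object is a direct sum of cones -/

section Decompositions

open scoped ZeroObject

variable {k : Type w} [Field k] {M : Type*} [LinearOrder M] [OrderTop M]
  {s : M → M} {c : M → M → k} {C : Type u₁} [Category.{v₁} C] [Preadditive C]
  [Linear k C] [HasShift C ℤ] [HasZeroObject C] [∀ n : ℤ, (shiftFunctor C n).Additive]
  [Pretriangulated C] (D : LinSys s c C)

namespace LinSys

lemma isStableUnderShift_X : (sumsOf D.X).IsStableUnderShift ℤ :=
  sumsOf_isStableUnderShift_of_iso D.shiftIval D.shiftIval_surjective D.rho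

/-- The interval `[q, ⊤)`. -/
abbrev topIval {q : M} (hq : q ≠ ⊤) : Ival M := ⟨⊤, q, hq.lt_top⟩

/-- The cone of a morphism from a zero object. -/
noncomputable def objIso {q : M} (hq : q ≠ ⊤) : D.obj q ≅ D.X (topIval hq) :=
  @asIso _ _ _ _ (D.qm (topIval hq))
    ((Triangle.isZero₁_iff_isIso₂ _ (D.dist (topIval hq))).1 D.isZero_top)

lemma sumsOf_X_obj (q : M) : sumsOf D.X (D.obj q) := by
  by_cases hq : q = ⊤
  · subst hq
    exact sumsOf_of_isZero D.isZero_top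
  · exact (sumsOf D.X).prop_of_iso (D.objIso hq).symm (sumsOf_single _ _)

lemma sumsOf_obj_le : sumsOf D.obj ≤ sumsOf D.X := fun _ h => sumsOf_trans h D.sumsOf_X_obj

lemma exists_cone_obj {p q : M} (x : D.obj p ⟶ D.obj q) (hx : x ≠ 0) :
    ∃ (Z : C) (g : D.obj q ⟶ Z) (h : Z ⟶ (D.obj p)⟦(1 : ℤ)⟧),
      Triangle.mk x g h ∈ distTriang C ∧ sumsOf D.X Z := by
  obtain ⟨a, rfl⟩ := D.span _ _ x
  obtain ⟨hp, hq, ha⟩ := D.smul_e_cancel hx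
  rcases hq.eq_or_lt with rfl | hq
  · obtain ⟨Z, g, h, H⟩ := distinguished_cocone_triangle (a • D.e q q)
    refine ⟨Z, g, h, H, sumsOf_of_isZero ?_⟩
    refine (Triangle.isZero₃_iff_isIso₁ _ H).2 ?_
    change IsIso (a • D.e q q)
    rw [D.e_self]
    exact inferInstanceAs (IsIso (smulIso ha (Iso.refl (D.obj q))).hom)
  · exact ⟨D.X ⟨p, q, hq⟩, a⁻¹ • D.qm ⟨p, q, hq⟩, D.hm ⟨p, q, hq⟩, dist_of_iso (D.dist ⟨p, q, hq⟩)
      (Iso.refl _) (smulIso ha (Iso.refl _)) (Iso.refl _)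
      (by simp [smulIso]) (by simp [smulIso, smul_smul, ha]) (by simp), sumsOf_single _ _⟩

/-- Gauss elimination: morphisms between direct sums of members of a linear system have cones
that are direct sums of cones of morphisms between members of the linear system. -/
lemma exists_cone_sums (n : ℕ) : ∀ {A B : C} (d : Decomp D.obj A) (_ : Decomp D.obj B)
    (f : A ⟶ B), Fintype.card d.J = n → ∃ (Z : C) (g : B ⟶ Z) (h : Z ⟶ A⟦(1 : ℤ)⟧),
      Triangle.mk f g h ∈ distTriang C ∧ sumsOf D.X Z := by
  induction n with
  | zero =>
    intro A B d d' f hd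
    have := Fintype.card_eq_zero_iff.1 hd
    have hA : IsZero A := by
      rw [IsZero.iff_id_eq_zero, ← d.total]
      simp
    obtain ⟨Z, g, h, H⟩ := distinguished_cocone_triangle f
    have : IsIso g := (Triangle.isZero₁_iff_isIso₂ _ H).1 hA
    exact ⟨Z, g, h, H, (sumsOf D.X).prop_of_iso (asIso g) (D.sumsOf_obj_le _ ⟨d'⟩)⟩
  | succ n ih =>
    intro A B d d' f hd
    by_cases hf : f = 0
    · obtain ⟨Z, g, h, H⟩ := distinguished_cocone_triangle f
      -- The cone of a zero morphism is the sum of its target and the shift of its source.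
      obtain ⟨e, -⟩ := exists_iso_binaryBiproduct_of_distTriang _ (dist_rotate H)
        (by change -f⟦(1 : ℤ)⟧' = 0; rw [hf, Functor.map_zero, neg_zero])
      have := D.isStableUnderShift_X
      exact ⟨Z, g, h, H, (sumsOf D.X).prop_of_iso e.symm
        (sumsOf_biprod (D.sumsOf_obj_le _ ⟨d'⟩)
          ((sumsOf D.X).le_shift (1 : ℤ) _ (D.sumsOf_obj_le _ ⟨d⟩)))⟩
    · classical
      have hS : ∃ a b, d.ι a ≫ f ≫ d'.π b ≠ 0 := by
        by_contra! h
        refine hf ?_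
        calc f = (∑ a, d.π a ≫ d.ι a) ≫ f ≫ (∑ b, d'.π b ≫ d'.ι b) := by
              rw [d.total, d'.total, id_comp, comp_id]
          _ = ∑ b, ∑ a, d.π a ≫ (d.ι a ≫ f ≫ d'.π b) ≫ d'.ι b := by
              simp only [Preadditive.comp_sum, Preadditive.sum_comp, assoc]
          _ = 0 := by simp [h]
      -- The pivot: `a` has the least index among the source summands on which `f` is nonzero, and
      -- `b` the greatest among the targets that `a` reaches. Such an entry divides all others with
      -- the same `a` or the same `b`.
      obtain ⟨a, ha, ha'⟩ := Finset.exists_min_image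
        (Finset.univ.filter fun a => ∃ b, d.ι a ≫ f ≫ d'.π b ≠ 0) d.idx
        (by obtain ⟨a, h⟩ := hS; exact ⟨a, by simpa using h⟩)
      obtain ⟨b, hb, hb'⟩ := Finset.exists_max_image
        (Finset.univ.filter fun b => d.ι a ≫ f ≫ d'.π b ≠ 0) d'.idx
        (by obtain ⟨b, h⟩ := (Finset.mem_filter.1 ha).2; exact ⟨b, by simpa using h⟩)
      have hx : d.ι a ≫ f ≫ d'.π b ≠ 0 := (Finset.mem_filter.1 hb).2
      obtain ⟨φ, hφ, hφ'⟩ := D.exists_row d a (f ≫ d'.π b) hx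
        (fun a' h => ha' a' (Finset.mem_filter.2 ⟨Finset.mem_univ _, b, h⟩))
      obtain ⟨θ, hθ, hθ'⟩ := D.exists_column d' b (d.ι a ≫ f) (by rwa [assoc])
        (fun b' h => hb' b' (Finset.mem_filter.2 ⟨Finset.mem_univ _, by rwa [assoc] at h⟩))
      obtain ⟨K, dK, e, hK, he, he'⟩ := d.split a (d.ι a) φ hφ' (Or.inl rfl)
      obtain ⟨K', dK', e', -, h₁, h₂⟩ := d'.split b θ (d'.π b) hθ' (Or.inr rfl)
      obtain ⟨Z, g, h, H, hZ⟩ := D.exists_cone_obj (d.ι a ≫ f ≫ d'.π b) hx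
      obtain ⟨Z', g', h', H', hZ'⟩ := ih dK dK' (biprod.inr ≫ e.inv ≫ f ≫ e'.hom ≫ biprod.snd)
        (by omega)
      obtain ⟨h'', H''⟩ := dist_biprod H H'
      have hθe : θ ≫ e'.hom = biprod.inl := by rw [← h₂, assoc, Iso.inv_hom_id, comp_id]
      -- In the new coordinates `f` is block diagonal: `hθ` clears the entries out of `a`, and `hφ`
      -- those into `b`.
      have key : biprod.map (d.ι a ≫ f ≫ d'.π b) (biprod.inr ≫ e.inv ≫ f ≫ e'.hom ≫ biprod.snd) =
          e.inv ≫ f ≫ e'.hom := by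
        apply biprod.hom_ext'
        · rw [biprod.inl_map, ← assoc biprod.inl, he', ← hθe, ← assoc (d.ι a), ← assoc (_ ≫ _),
            ← assoc (d.ι a), hθ]
        · apply biprod.hom_ext
          · rw [biprod.inr_map, assoc, biprod.inr_fst, comp_zero, assoc, assoc, assoc, h₁, ← hφ,
              ← he, ← assoc e.inv, ← assoc e.inv, Iso.inv_hom_id, id_comp]
            simp
          · simp
      refine ⟨Z ⊞ Z', e'.hom ≫ biprod.map g g', h'' ≫ e.inv⟦(1 : ℤ)⟧', ?_, sumsOf_biprod hZ hZ'⟩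
      exact dist_of_iso H'' e.symm e'.symm (Iso.refl _)
        (by rw [key]; simp) (by simp) (by simp)

lemma sumsOf_X_cone {A B Z : C} {f : A ⟶ B} {g : B ⟶ Z} {h : Z ⟶ A⟦(1 : ℤ)⟧}
    (H : Triangle.mk f g h ∈ distTriang C) (hA : sumsOf D.obj A) (hB : sumsOf D.obj B) :
    sumsOf D.X Z := by
  obtain ⟨d⟩ := hA
  obtain ⟨d'⟩ := hB
  obtain ⟨Z', g', h', H', hZ'⟩ := D.exists_cone_sums _ d d' f rfl
  obtain ⟨e, -⟩ := dist_fill_iso H' H (Iso.refl _) (Iso.refl _) (by simp)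
  exact (sumsOf D.X).prop_of_iso e hZ'

/-- The middle term of an extension is the cone of a morphism from the negative shift of the last
term to the first. -/
lemma extensionProduct_obj_obj_le :
    ObjectProperty.extensionProduct (sumsOf D.obj) (sumsOf D.obj) ≤ sumsOf D.X := by
  rintro Y ⟨A, B, f, g, h, H, hA, hB⟩
  have := D.isStableUnderShift_obj
  exact D.sumsOf_X_cone (inv_rot_of_distTriang _ H) ((sumsOf D.obj).le_shift (-1 : ℤ) _ hB) hA

/-- The class of objects that are presented by direct sums of members of the linear system, with
a phantom connecting morphism. -/
def presented : ObjectProperty C := fun Z =>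
  ∃ (A B : C) (a : A ⟶ Z) (b : Z ⟶ B) (h : B ⟶ A⟦(1 : ℤ)⟧), Triangle.mk a b h ∈ distTriang C ∧
    sumsOf D.obj A ∧ sumsOf D.obj B ∧ ∀ (p : M) (t : D.obj p ⟶ Z), t ≫ b = 0

instance : D.presented.IsClosedUnderIsomorphisms where
  of_iso {Y Z} e := by
    rintro ⟨A, B, a, b, h, H, hA, hB, H'⟩
    refine ⟨A, B, a ≫ e.hom, e.inv ≫ b, h, dist_of_iso H (Iso.refl _) e (Iso.refl _) (by simp)
      (by simp) (by simp), hA, hB, fun p t => ?_⟩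
    rw [← assoc, H']

lemma sumsOf_X_le_presented : sumsOf D.X ≤ D.presented := by
  have := D.isStableUnderShift_obj
  refine sumsOf_le ?_ ?_ ?_
  · intro Y hY
    exact ⟨Y, 0, 𝟙 Y, 0, 0, contractible_distinguished Y, sumsOf_of_isZero hY,
      sumsOf_of_isZero (isZero_zero C), fun p t => comp_zero⟩
  · intro i
    exact ⟨_, _, _, _, _, dist_rotate (D.dist i), sumsOf_single _ _,
      (sumsOf D.obj).le_shift (1 : ℤ) _ (sumsOf_single _ _), fun p t => D.comp_hm_eq_zero i t⟩
  · rintro Y Y' ⟨A, B, a, b, h, H, hA, hB, H₁⟩ ⟨A', B', a', b', h', H', hA', hB', H₁'⟩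
    obtain ⟨h'', H''⟩ := dist_biprod H H'
    refine ⟨_, _, _, _, h'', H'', sumsOf_biprod hA hA', sumsOf_biprod hB hB', fun p t => ?_⟩
    ext
    · simpa using H₁ p (t ≫ biprod.fst)
    · simpa using H₁' p (t ≫ biprod.snd)

lemma sumsOf_X_le_extensionProduct :
    sumsOf D.X ≤ ObjectProperty.extensionProduct (sumsOf D.obj) (sumsOf D.obj) := fun Z hZ => by
  obtain ⟨A, B, a, b, h, H, hA, hB, -⟩ := D.sumsOf_X_le_presented Z hZ
  exact ⟨A, B, a, b, h, H, hA, hB⟩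

lemma idempotent_X (i : Ival M) (f : D.X i ⟶ D.X i) (hf : f ≫ f = f) : f = 0 ∨ f = 𝟙 _ := by
  obtain ⟨a, rfl⟩ := D.span_b f
  rw [D.b_self] at hf ⊢
  by_cases ha : a = 0
  · left
    rw [ha, zero_smul]
  · right
    have := congrArg (a⁻¹ • ·) hf
    simpa [smul_smul, ha] using this

variable [IsTriangulated C]

/-- Present `Z` as an extension of `B` by `A` with phantom `b`. The octahedron on `a ≫ g` makes the
cone `W` of `A ⟶ Y` an extension of `P⟦1⟧` by `B`. Its connecting morphism is built from `t ≫ b =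
0`, so `W` splits into shifts of sums of the system, and `Y` is an extension of `W` by `A`. -/
lemma sumsOf_X_cone_of_obj {P Z Y : C} {t : P ⟶ Z} {g : Z ⟶ Y} {h : Y ⟶ P⟦(1 : ℤ)⟧}
    (H : Triangle.mk t g h ∈ distTriang C) (hP : sumsOf D.obj P) (hZ : sumsOf D.X Z) :
    sumsOf D.X Y := by
  obtain ⟨A, B, a, b, h', H', hA, hB, hb⟩ := D.sumsOf_X_le_presented Z hZ
  have htb : t ≫ b = 0 := by
    obtain ⟨d⟩ := hP
    calc t ≫ b = ∑ j, d.π j ≫ (d.ι j ≫ t) ≫ b := by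
          have := d.total =≫ (t ≫ b)
          simpa [Preadditive.sum_comp] using this.symm
      _ = 0 := by simp only [hb, comp_zero, Finset.sum_const_zero]
  obtain ⟨W, v, w, HW⟩ := distinguished_cocone_triangle (a ≫ g)
  let o := Triangulated.someOctahedron rfl H' (dist_rotate H) HW
  obtain ⟨e, -⟩ := exists_iso_binaryBiproduct_of_distTriang _ o.mem (by
    change (-t⟦(1 : ℤ)⟧') ≫ b⟦(1 : ℤ)⟧' = 0
    rw [Preadditive.neg_comp, ← Functor.map_comp, htb, Functor.map_zero, neg_zero])
  have := D.isStableUnderShift_obj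
  exact D.extensionProduct_obj_obj_le Y ⟨A, W, _, _, _, HW, hA, (sumsOf D.obj).prop_of_iso e.symm
    (sumsOf_biprod hB ((sumsOf D.obj).le_shift (1 : ℤ) _ hP))⟩

lemma extensionProduct_X_obj_le :
    ObjectProperty.extensionProduct (sumsOf D.X) (sumsOf D.obj) ≤ sumsOf D.X := by
  rintro Y ⟨A, B, f, g, h, H, hA, hB⟩
  have := D.isStableUnderShift_obj
  exact D.sumsOf_X_cone_of_obj (inv_rot_of_distTriang _ H)
    ((sumsOf D.obj).le_shift (-1 : ℤ) _ hB) hA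

/-- A sum of cones is itself an extension of two sums of objects of the system, so associativity
allows absorbing one such sum at a time. -/
lemma extensionProduct_X_X_le :
    ObjectProperty.extensionProduct (sumsOf D.X) (sumsOf D.X) ≤ sumsOf D.X :=
  calc ObjectProperty.extensionProduct (sumsOf D.X) (sumsOf D.X)
      ≤ ObjectProperty.extensionProduct (sumsOf D.X)
          (ObjectProperty.extensionProduct (sumsOf D.obj) (sumsOf D.obj)) :=
        ObjectProperty.monotone_extensionProduct_right _ D.sumsOf_X_le_extensionProduct
    _ = ObjectProperty.extensionProduct
          (ObjectProperty.extensionProduct (sumsOf D.X) (sumsOf D.obj)) (sumsOf D.obj) :=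
        (ObjectProperty.extensionProduct_assoc _ _ _).symm
    _ ≤ ObjectProperty.extensionProduct (sumsOf D.X) (sumsOf D.obj) :=
        ObjectProperty.monotone_extensionProduct_left _ D.extensionProduct_X_obj_le
    _ ≤ sumsOf D.X := D.extensionProduct_X_obj_le

/-- The finite direct sums of cones of morphisms between members of the linear system form a
triangulated subcategory. -/
lemma isTriangulated_sumsOf_X : (sumsOf D.X).IsTriangulated :=
  have := D.isStableUnderShift_X
  have : (sumsOf D.X).IsTriangulatedClosed₂ := .mk' fun _ ht h₁ h₃ =>
    D.extensionProduct_X_X_le _ ⟨_, _, _, _, _, ht, h₁, h₃⟩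
  have : (sumsOf D.X).ContainsZero := ⟨0, isZero_zero C, sumsOf_of_isZero (isZero_zero C)⟩
  { }

/-- If a classical generator is a direct sum of members of a linear system, then all objects are
direct sums of cones of morphisms between members of the linear system. -/
lemma sumsOf_X_eq_top (hC : IsKrullSchmidt C) {G : C}
    (hG : (ObjectProperty.singleton G).IsClassicalTriangulatedGenerator) (hG' : sumsOf D.X G) :
    sumsOf D.X = ⊤ := by
  have := D.isTriangulated_sumsOf_X
  have := hC.isStableUnderRetracts D.idempotent_X
  rw [eq_top_iff, ← (ObjectProperty.isClassicalTriangulatedGenerator_iff _).1 hG,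
    ObjectProperty.triangEnvelope_le_iff]
  rintro Y ⟨_⟩
  exact hG'

end LinSys

end Decompositions

/-! ### Triangles with distinguished image -/

section Preservation

lemma SuspIso.naturality {C : Type u₁} [Category.{v₁} C] [HasShift C ℤ] {C' : Type u₂}
    [Category.{v₂} C'] [HasShift C' ℤ] {Φ : C ⥤ C'} (φ : SuspIso Φ) {Y Z : C} (f : Y ⟶ Z) :
    Φ.map (f⟦(1 : ℤ)⟧') ≫ φ.hom.app Z = φ.hom.app Y ≫ (Φ.map f)⟦(1 : ℤ)⟧' :=
  φ.hom.naturality f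

variable {C : Type u₁} [Category.{v₁} C] [HasShift C ℤ]
  {C' : Type u₂} [Category.{v₂} C'] [Preadditive C'] [HasShift C' ℤ] [HasZeroObject C']
  [∀ n : ℤ, (shiftFunctor C' n).Additive] [Pretriangulated C']
  {Φ : C ⥤ C'} {φ : SuspIso Φ} {X Y Z : C} {f : X ⟶ Y} {g : Y ⟶ Z} {h : Z ⟶ X⟦(1 : ℤ)⟧}

namespace PreservesTriangle

lemma mk_iff : PreservesTriangle Φ φ (Triangle.mk f g h) ↔
    Triangle.mk (Φ.map f) (Φ.map g) (Φ.map h ≫ φ.hom.app X) ∈ distTriang C' := Iff.rfl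

lemma of_iso (H : PreservesTriangle Φ φ (Triangle.mk f g h)) {X' Y' Z' : C} {f' : X' ⟶ Y'}
    {g' : Y' ⟶ Z'} {h' : Z' ⟶ X'⟦(1 : ℤ)⟧} (a : X ≅ X') (b : Y ≅ Y') (c : Z ≅ Z')
    (w₁ : f ≫ b.hom = a.hom ≫ f') (w₂ : g ≫ c.hom = b.hom ≫ g')
    (w₃ : h ≫ a.hom⟦(1 : ℤ)⟧' = c.hom ≫ h') :
    PreservesTriangle Φ φ (Triangle.mk f' g' h') := by
  refine dist_of_iso (mk_iff.1 H) (Φ.mapIso a) (Φ.mapIso b) (Φ.mapIso c) ?_ ?_ ?_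
  · change Φ.map f ≫ Φ.map b.hom = Φ.map a.hom ≫ Φ.map f'
    rw [← Φ.map_comp, ← Φ.map_comp, w₁]
  · change Φ.map g ≫ Φ.map c.hom = Φ.map b.hom ≫ Φ.map g'
    rw [← Φ.map_comp, ← Φ.map_comp, w₂]
  · change (Φ.map h ≫ φ.hom.app X) ≫ (Φ.map a.hom)⟦(1 : ℤ)⟧' =
      Φ.map c.hom ≫ Φ.map h' ≫ φ.hom.app X'
    rw [assoc, ← SuspIso.naturality, ← assoc, ← assoc, ← Φ.map_comp, ← Φ.map_comp, w₃]

/-- The fill-in exists between the images and is brought back by full faithfulness. Neither triangle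
has to be distinguished in the source. -/
lemma fill [Φ.Faithful] [Φ.Full] {X' Y' Z' : C} {f' : X' ⟶ Y'} {g' : Y' ⟶ Z'}
    {h' : Z' ⟶ X'⟦(1 : ℤ)⟧} (H : PreservesTriangle Φ φ (Triangle.mk f g h))
    (H' : PreservesTriangle Φ φ (Triangle.mk f' g' h'))
    (a : X ⟶ X') (b : Y ⟶ Y') (w : f ≫ b = a ≫ f') :
    ∃ c : Z ⟶ Z', g ≫ c = b ≫ g' ∧ h ≫ a⟦(1 : ℤ)⟧' = c ≫ h' := by
  obtain ⟨c, h₁, h₂⟩ := dist_fill (mk_iff.1 H) (mk_iff.1 H') (Φ.map a) (Φ.map b)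
    (by rw [← Φ.map_comp, w, Φ.map_comp])
  obtain ⟨c, rfl⟩ := Φ.map_surjective c
  refine ⟨c, Φ.map_injective (by rw [Φ.map_comp, h₁, Φ.map_comp]), Φ.map_injective ?_⟩
  rw [← cancel_mono (φ.hom.app X'), Φ.map_comp, assoc, SuspIso.naturality, ← assoc, h₂,
    Φ.map_comp, assoc]

variable [Preadditive C]

lemma rotate_iff [Φ.Additive] : PreservesTriangle Φ φ (Triangle.mk g h (-f⟦(1 : ℤ)⟧')) ↔
    PreservesTriangle Φ φ (Triangle.mk f g h) := by
  have e : Triangle.mk (Φ.map g) (Φ.map h) (Φ.map (-f⟦(1 : ℤ)⟧') ≫ φ.hom.app Y) ≅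
      (Triangle.mk (Φ.map f) (Φ.map g) (Φ.map h ≫ φ.hom.app X)).rotate :=
    Triangle.isoMk _ _ (Iso.refl _) (Iso.refl _) (φ.app X)
      ((comp_id _).trans (id_comp _).symm) (id_comp _).symm (by
        change (Φ.map (-f⟦(1 : ℤ)⟧') ≫ φ.hom.app Y) ≫ (shiftFunctor C' (1 : ℤ)).map (𝟙 (Φ.obj Y)) =
          φ.hom.app X ≫ (-(Φ.map f)⟦(1 : ℤ)⟧')
        rw [CategoryTheory.Functor.map_id]
        refine (comp_id _).trans ?_
        rw [Φ.map_neg, Preadditive.neg_comp, SuspIso.naturality, Preadditive.comp_neg])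
  refine (mk_iff.trans ?_).trans mk_iff.symm
  rw [rotate_distinguished_triangle (Triangle.mk (Φ.map f) (Φ.map g) (Φ.map h ≫ φ.hom.app X))]
  exact ⟨fun H => isomorphic_distinguished _ H _ e.symm, fun H => isomorphic_distinguished _ H _ e⟩

section Faithful

variable [Φ.Faithful] [Φ.Additive]

/-- A triangle whose image is distinguished inherits exactness from that image, although it may not
be distinguished itself. This and the next lemmas provide the instances needed. -/
lemma zero₂₃ (H : PreservesTriangle Φ φ (Triangle.mk f g h)) : g ≫ h = 0 := by
  have := dist_zero₂₃ (mk_iff.1 H)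
  rw [← assoc, ← Φ.map_comp] at this
  apply Φ.map_injective
  rw [← cancel_mono (φ.hom.app X), this, Φ.map_zero, zero_comp]

lemma zero₁₂ (H : PreservesTriangle Φ φ (Triangle.mk f g h)) : f ≫ g = 0 := by
  have := dist_zero₁₂ (mk_iff.1 H)
  apply Φ.map_injective
  rw [Φ.map_comp, this, Φ.map_zero]

lemma zero₃₁ (H : PreservesTriangle Φ φ (Triangle.mk f g h)) : h ≫ f⟦(1 : ℤ)⟧' = 0 := by
  have := dist_zero₃₁ (mk_iff.1 H)
  apply Φ.map_injective
  rw [← cancel_mono (φ.hom.app Y), Φ.map_comp, assoc, SuspIso.naturality, ← assoc, this,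
    Φ.map_zero, zero_comp]

variable [Φ.Full]

lemma desc₂ (H : PreservesTriangle Φ φ (Triangle.mk f g h)) {W : C} (a : Y ⟶ W)
    (ha : f ≫ a = 0) : ∃ b : Z ⟶ W, a = g ≫ b := by
  obtain ⟨b, hb⟩ := dist_desc₂ (mk_iff.1 H) (Φ.map a) (by rw [← Φ.map_comp, ha, Φ.map_zero])
  obtain ⟨b, rfl⟩ := Φ.map_surjective b
  exact ⟨b, Φ.map_injective (by rw [hb, Φ.map_comp])⟩

lemma lift₂ (H : PreservesTriangle Φ φ (Triangle.mk f g h)) {W : C} (a : W ⟶ Y)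
    (ha : a ≫ g = 0) : ∃ b : W ⟶ X, a = b ≫ f := by
  obtain ⟨b, hb⟩ := dist_lift₂ (mk_iff.1 H) (Φ.map a) (by rw [← Φ.map_comp, ha, Φ.map_zero])
  obtain ⟨b, rfl⟩ := Φ.map_surjective b
  exact ⟨b, Φ.map_injective (by rw [hb, Φ.map_comp])⟩

lemma lift₃ (H : PreservesTriangle Φ φ (Triangle.mk f g h)) {W : C} (a : W ⟶ Z)
    (ha : a ≫ h = 0) : ∃ b : W ⟶ Y, a = b ≫ g := by
  obtain ⟨b, hb⟩ := dist_lift₃ (mk_iff.1 H) (Φ.map a)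
    (by rw [← assoc, ← Φ.map_comp, ha, Φ.map_zero, zero_comp])
  obtain ⟨b, rfl⟩ := Φ.map_surjective b
  exact ⟨b, Φ.map_injective (by rw [hb, Φ.map_comp])⟩

lemma lift₁ (H : PreservesTriangle Φ φ (Triangle.mk f g h)) {W : C} (a : W ⟶ X⟦(1 : ℤ)⟧)
    (ha : a ≫ f⟦(1 : ℤ)⟧' = 0) : ∃ b : W ⟶ Z, a = b ≫ h := by
  obtain ⟨b, hb⟩ := dist_lift₁ (mk_iff.1 H) (Φ.map a ≫ φ.hom.app X)
    (by rw [assoc, ← SuspIso.naturality, ← assoc, ← Φ.map_comp, ha, Φ.map_zero, zero_comp])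
  obtain ⟨b, rfl⟩ := Φ.map_surjective b
  refine ⟨b, Φ.map_injective ?_⟩
  rw [← cancel_mono (φ.hom.app X), hb, Φ.map_comp, assoc]

variable [HasZeroObject C] [∀ n : ℤ, (shiftFunctor C n).Additive] [Pretriangulated C]
  {k : Type w} [Field k] [Linear k C]

/-- A distinguished triangle is preserved, up to a scalar, if it can be compared with a triangle
on the same morphism whose image is distinguished. -/
lemma of_comparison_smul (H : Triangle.mk f g h ∈ distTriang C) {Z' : C} {g' : Y ⟶ Z'}
    {h' : Z' ⟶ X⟦(1 : ℤ)⟧} (H' : PreservesTriangle Φ φ (Triangle.mk f g' h')) (w : Z ⟶ Z')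
    {a : k} (ha : a ≠ 0) (h₁ : g ≫ w = g') (h₂ : w ≫ h' = a • h) :
    PreservesTriangle Φ φ (Triangle.mk f g (a • h)) := by
  -- A five lemma by hand, since the two triangles are exact for different reasons: `w` gets a left
  -- and a right inverse, each a first approximation plus a correction.
  obtain ⟨x, hx⟩ := dist_lift₁ H h' H'.zero₃₁
  obtain ⟨y, hy⟩ := H'.lift₃ (𝟙 _ - (a⁻¹ • x) ≫ w) (by
    rw [Preadditive.sub_comp, assoc, h₂, id_comp, Linear.smul_comp, Linear.comp_smul, ← hx,
      smul_smul, inv_mul_cancel₀ ha, one_smul, sub_self])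
  have hl : (a⁻¹ • x + y ≫ g) ≫ w = 𝟙 _ := by
    rw [Preadditive.add_comp, assoc, h₁, ← hy, add_sub_cancel]
  obtain ⟨x', hx'⟩ := H'.desc₂ g (dist_zero₁₂ H)
  obtain ⟨y', hy'⟩ := dist_desc₃ H (𝟙 _ - w ≫ x')
    (by rw [Preadditive.comp_sub, ← assoc, h₁, comp_id, ← hx', sub_self])
  have hr : w ≫ (x' + h' ≫ (a⁻¹ • y')) = 𝟙 _ := by
    rw [Preadditive.comp_add, ← assoc w, h₂, Linear.smul_comp, Linear.comp_smul, smul_smul,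
      mul_inv_cancel₀ ha, one_smul, ← hy', add_sub_cancel]
  have hw : IsIso w := by
    refine ⟨a⁻¹ • x + y ≫ g, ?_, hl⟩
    calc w ≫ (a⁻¹ • x + y ≫ g) = w ≫ (a⁻¹ • x + y ≫ g) ≫ w ≫ (x' + h' ≫ (a⁻¹ • y')) := by
          rw [hr, comp_id]
      _ = 𝟙 _ := by rw [← assoc (_ + _) w, hl, id_comp, hr]
  refine H'.of_iso (Iso.refl _) (Iso.refl _) (asIso w).symm (by simp) ?_ ?_
  · simp [← h₁]
  · simp [← h₂]

lemma of_comparison (k : Type w) [Field k] [Linear k C]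
    (H : Triangle.mk f g h ∈ distTriang C) {Z' : C} {g' : Y ⟶ Z'}
    {h' : Z' ⟶ X⟦(1 : ℤ)⟧} (H' : PreservesTriangle Φ φ (Triangle.mk f g' h')) (w : Z ⟶ Z')
    (h₁ : g ≫ w = g') (h₂ : w ≫ h' = h) : PreservesTriangle Φ φ (Triangle.mk f g h) := by
  simpa only [one_smul] using of_comparison_smul H H' w (one_ne_zero (α := k)) h₁
    (by rw [h₂, one_smul])

end Faithful

end PreservesTriangle

end Preservation

/-! ### Objects whose endomorphisms are scalars -/

section Bricks

variable (k : Type w) [Field k] {C : Type u₁} [Category.{v₁} C] [Preadditive C] [Linear k C]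

/-- A nonzero object whose endomorphisms are scalars. -/
def IsBrick (X : C) : Prop := ¬ IsZero X ∧ ∀ f : X ⟶ X, ∃ a : k, f = a • 𝟙 X

variable {k}

lemma IsBrick.id_ne_zero {X : C} (hX : IsBrick k X) : 𝟙 X ≠ 0 := fun h =>
  hX.1 ((IsZero.iff_id_eq_zero X).2 h)

lemma IsBrick.smul_eq_zero {X Y : C} {f : X ⟶ Y} (hf : f ≠ 0) {a : k} (h : a • f = 0) : a = 0 :=
  (_root_.smul_eq_zero.1 h).resolve_right hf

/-- The scalar `f ≫ r` fixes the nonzero morphism `f`, so it is one. -/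
lemma IsBrick.isIso_of_comp_eq_id {X Y : C} (hX : IsBrick k X) (hY : IsBrick k Y) {f : X ⟶ Y}
    {r : Y ⟶ X} (h : r ≫ f = 𝟙 Y) : IsIso f := by
  obtain ⟨a, ha⟩ := hX.2 (f ≫ r)
  refine ⟨r, ?_, h⟩
  have h₁ : f ≠ 0 := by
    rintro rfl
    exact hY.id_ne_zero (by rw [← h, comp_zero])
  have h₂ : (a - 1) • f = 0 := by
    have := ha =≫ f
    rw [assoc, h, comp_id, Linear.smul_comp, id_comp] at this
    rw [sub_smul, one_smul, ← this, sub_self]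
  rw [ha, sub_eq_zero.1 (smul_eq_zero h₁ h₂), one_smul]

lemma IsBrick.isIso_of_comp_eq_id' {X Y : C} (hX : IsBrick k X) (hY : IsBrick k Y) {f : X ⟶ Y}
    {r : Y ⟶ X} (h : f ≫ r = 𝟙 X) : IsIso f := by
  have := hY.isIso_of_comp_eq_id hX h
  have hr : f = inv r := by rw [← cancel_mono r, h, IsIso.inv_hom_id]
  rw [hr]
  infer_instance

lemma IsBrick.shiftBy [HasShift C ℤ] (n : ℤ) [(shiftFunctor C n).Additive]
    [(shiftFunctor C n).Linear k] {X : C} (hX : IsBrick k X) : IsBrick k (X⟦n⟧) := by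
  refine ⟨fun h => hX.id_ne_zero ?_, fun f => ?_⟩
  · apply (shiftFunctor C n).map_injective
    exact h.eq_of_src _ _
  · obtain ⟨f, rfl⟩ := (shiftFunctor C n).map_surjective f
    obtain ⟨a, rfl⟩ := hX.2 f
    exact ⟨a, by rw [Functor.map_smul, CategoryTheory.Functor.map_id]⟩

lemma IsBrick.shift [HasShift C ℤ] [(shiftFunctor C (1 : ℤ)).Additive]
    [(shiftFunctor C (1 : ℤ)).Linear k] {X : C} (hX : IsBrick k X) :
    IsBrick k (X⟦(1 : ℤ)⟧) :=
  hX.shiftBy 1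

lemma IsBrick.eq_zero_or_eq_id {X : C} (hX : IsBrick k X) (f : X ⟶ X) (hf : f ≫ f = f) :
    f = 0 ∨ f = 𝟙 X := by
  obtain ⟨a, rfl⟩ := hX.2 f
  by_cases ha : a = 0
  · left
    rw [ha, zero_smul]
  · right
    have := congrArg (a⁻¹ • ·) hf
    simpa [smul_smul, ha] using this

lemma IsBrick.indecomposable [HasBinaryBiproducts C] {X : C} (hX : IsBrick k X) :
    Indecomposable X :=
  indecomposable_of_idempotents hX.1 hX.eq_zero_or_eq_id

end Bricks

/-! ### The scalar that obstructs preservation of a triangle -/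

section Good

variable {k : Type w} [Field k] {C : Type u₁} [Category.{v₁} C] [Preadditive C] [Linear k C]
  [HasShift C ℤ] [HasZeroObject C] [∀ n : ℤ, (shiftFunctor C n).Additive]
  [Pretriangulated C] [(shiftFunctor C (1 : ℤ)).Linear k]
  {C' : Type u₂} [Category.{v₂} C'] [Preadditive C'] [HasShift C' ℤ] [HasZeroObject C']
  [∀ n : ℤ, (shiftFunctor C' n).Additive] [Pretriangulated C']
  {Φ : C ⥤ C'} (φ : SuspIso Φ)

/-- The triangles on the morphism `f` are preserved. -/
def PreservesCone {X Y : C} (f : X ⟶ Y) : Prop :=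
  ∀ (Z : C) (g : Y ⟶ Z) (h : Z ⟶ X⟦(1 : ℤ)⟧), Triangle.mk f g h ∈ distTriang C →
    PreservesTriangle Φ φ (Triangle.mk f g h)

/-- The image of the morphism `f` has a cone in the image of the functor. -/
def HasImageCone {X Y : C} (f : X ⟶ Y) : Prop :=
  ∃ (Z : C) (g : Y ⟶ Z) (h : Z ⟶ X⟦(1 : ℤ)⟧), PreservesTriangle Φ φ (Triangle.mk f g h)

variable {φ} {X Y : C} {f : X ⟶ Y}

lemma PreservesCone.of_triangle {Z : C} {g : Y ⟶ Z} {h : Z ⟶ X⟦(1 : ℤ)⟧}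
    (H : Triangle.mk f g h ∈ distTriang C) (H' : PreservesTriangle Φ φ (Triangle.mk f g h)) :
    PreservesCone φ f := by
  intro Z' g' h' H''
  obtain ⟨c, h₁, h₂⟩ := dist_fill_iso H H'' (Iso.refl _) (Iso.refl _) (by simp)
  exact H'.of_iso (Iso.refl _) (Iso.refl _) c (by simp) h₁ h₂

variable [Φ.Faithful] [Φ.Full]

/-- Compare a fill-in `c` of the distinguished triangles with a fill-in `d` of the rescaled ones.
The difference `c - d` factors through `h`; if the scalars differed, exactness would make `f⟦1⟧'` a
split epimorphism between bricks, hence invertible. -/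
lemma smul_eq_of_comp_left {W Z Z' : C} {a : W ⟶ X} {g : Y ⟶ Z} {h : Z ⟶ W⟦(1 : ℤ)⟧}
    {g' : Y ⟶ Z'} {h' : Z' ⟶ X⟦(1 : ℤ)⟧} {u u' : k} (hX : IsBrick k X) (hY : IsBrick k Y)
    (hf : ¬ IsIso f) (h₀ : a ≫ f ≠ 0) (H : Triangle.mk (a ≫ f) g h ∈ distTriang C)
    (H' : Triangle.mk f g' h' ∈ distTriang C) (hu' : u' ≠ 0)
    (h₁ : PreservesTriangle Φ φ (Triangle.mk (a ≫ f) g (u • h)))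
    (h₂ : PreservesTriangle Φ φ (Triangle.mk f g' (u' • h'))) : u = u' := by
  obtain ⟨c, hc, hc'⟩ := dist_fill H H' a (𝟙 _) (comp_id _)
  obtain ⟨d, hd, hd'⟩ := h₁.fill h₂ a (𝟙 _) (comp_id _)
  obtain ⟨t, ht⟩ := dist_desc₃ H (c - d) (by rw [Preadditive.comp_sub, hc, hd, sub_self])
  rw [Linear.smul_comp, Linear.comp_smul, eq_comm, ← eq_inv_smul_iff₀ hu', smul_smul] at hd'
  obtain ⟨r, hr⟩ := dist_desc₁ H (t ≫ h' - (1 - u'⁻¹ * u) • a⟦(1 : ℤ)⟧') (by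
    rw [Preadditive.comp_sub, ← assoc, ← ht, Preadditive.sub_comp, ← hc', hd', Linear.comp_smul,
      sub_smul, one_smul, sub_self])
  obtain ⟨v, hv⟩ := hY.shift.2 (r ≫ f⟦(1 : ℤ)⟧')
  have h₀' : (a ≫ f)⟦(1 : ℤ)⟧' ≠ 0 := fun h =>
    h₀ ((shiftFunctor C (1 : ℤ)).map_injective (by rw [h, Functor.map_zero]))
  have h₃ : (v + (1 - u'⁻¹ * u)) • (a ≫ f)⟦(1 : ℤ)⟧' = 0 := by
    have := hr =≫ f⟦(1 : ℤ)⟧'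
    rw [assoc, hv, Linear.comp_smul, comp_id, Preadditive.sub_comp, assoc, dist_zero₃₁ H',
      comp_zero, zero_sub, Linear.smul_comp, ← Functor.map_comp] at this
    rw [add_smul, ← this, neg_add_cancel]
  have hv' := eq_neg_of_add_eq_zero_left (IsBrick.smul_eq_zero h₀' h₃)
  by_contra hne
  have hv₀ : v ≠ 0 := by
    rw [hv', neg_ne_zero, sub_ne_zero]
    intro h
    rw [eq_comm, inv_mul_eq_one₀ hu'] at h
    exact hne h.symm
  have := hX.shift.isIso_of_comp_eq_id hY.shift (f := f⟦(1 : ℤ)⟧') (r := v⁻¹ • r)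
    (by rw [Linear.smul_comp, hv, smul_smul, inv_mul_cancel₀ hv₀, one_smul])
  exact hf (isIso_of_reflects_iso f (shiftFunctor C (1 : ℤ)))

/-- The same comparison of fill-ins; here different scalars would make `f⟦1⟧'` a split monomorphism.
-/
lemma smul_eq_of_comp_right {W Z Z' : C} {b : Y ⟶ W} {g : Y ⟶ Z} {h : Z ⟶ X⟦(1 : ℤ)⟧}
    {g' : W ⟶ Z'} {h' : Z' ⟶ X⟦(1 : ℤ)⟧} {u u' : k} (hX : IsBrick k X) (hY : IsBrick k Y)
    (hf : ¬ IsIso f) (h₀ : f ≫ b ≠ 0) (H : Triangle.mk f g h ∈ distTriang C)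
    (H' : Triangle.mk (f ≫ b) g' h' ∈ distTriang C) (hu' : u' ≠ 0)
    (h₁ : PreservesTriangle Φ φ (Triangle.mk f g (u • h)))
    (h₂ : PreservesTriangle Φ φ (Triangle.mk (f ≫ b) g' (u' • h'))) : u = u' := by
  obtain ⟨c, hc, hc'⟩ := dist_fill H H' (𝟙 _) b (id_comp _).symm
  obtain ⟨d, hd, hd'⟩ := h₁.fill h₂ (𝟙 _) b (id_comp _).symm
  rw [CategoryTheory.Functor.map_id, comp_id] at hc' hd'
  obtain ⟨t, ht⟩ := dist_desc₃ H (c - d) (by rw [Preadditive.comp_sub, hc, hd, sub_self])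
  rw [Linear.comp_smul, eq_comm, ← eq_inv_smul_iff₀ hu', smul_smul] at hd'
  obtain ⟨r, hr⟩ := dist_desc₁ H (t ≫ h' - (1 - u'⁻¹ * u) • 𝟙 _) (by
    rw [Preadditive.comp_sub, ← assoc, ← ht, Preadditive.sub_comp, ← hc', hd', Linear.comp_smul,
      comp_id, sub_smul, one_smul, sub_self])
  obtain ⟨v, hv⟩ := hX.shift.2 (f⟦(1 : ℤ)⟧' ≫ r)
  have h₀' : (f ≫ b)⟦(1 : ℤ)⟧' ≠ 0 := fun h =>
    h₀ ((shiftFunctor C (1 : ℤ)).map_injective (by rw [h, Functor.map_zero]))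
  have h₃ : (v + (1 - u'⁻¹ * u)) • (f ≫ b)⟦(1 : ℤ)⟧' = 0 := by
    have := hr =≫ (f ≫ b)⟦(1 : ℤ)⟧'
    rw [hv, Linear.smul_comp, id_comp, Preadditive.sub_comp, assoc, dist_zero₃₁ H',
      comp_zero, zero_sub, Linear.smul_comp, id_comp] at this
    rw [add_smul, ← this, neg_add_cancel]
  have hv' := eq_neg_of_add_eq_zero_left (IsBrick.smul_eq_zero h₀' h₃)
  by_contra hne
  have hv₀ : v ≠ 0 := by
    rw [hv', neg_ne_zero, sub_ne_zero]
    intro h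
    rw [eq_comm, inv_mul_eq_one₀ hu'] at h
    exact hne h.symm
  have := hX.shift.isIso_of_comp_eq_id' hY.shift (f := f⟦(1 : ℤ)⟧') (r := v⁻¹ • r)
    (by rw [Linear.comp_smul, hv, smul_smul, inv_mul_cancel₀ hv₀, one_smul])
  exact hf (isIso_of_reflects_iso f (shiftFunctor C (1 : ℤ)))

variable [Φ.Additive]

lemma HasImageCone.preservesCone_of_isIso (k : Type w) [Field k] [Linear k C]
    (hf : HasImageCone φ f) [IsIso f] :
    PreservesCone φ f := by
  intro Z g h H
  obtain ⟨Z', g', h', H'⟩ := hf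
  have hg : g = 0 := by rw [← cancel_epi f, dist_zero₁₂ H, comp_zero]
  have hg' : g' = 0 := by rw [← cancel_epi f, H'.zero₁₂, comp_zero]
  have hh : h = 0 := by rw [← cancel_mono (f⟦(1 : ℤ)⟧'), dist_zero₃₁ H, zero_comp]
  exact .of_comparison k H H' 0 (by rw [hg', comp_zero]) (by rw [hh, zero_comp])

lemma HasImageCone.preservesCone_of_eq_zero (k : Type w) [Field k] [Linear k C]
    (hf : HasImageCone φ f) (hf₀ : f = 0) :
    PreservesCone φ f := by
  intro Z g h H
  obtain ⟨Z', g', h', H'⟩ := hf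
  obtain ⟨r, hr⟩ := dist_desc₂ H (𝟙 _) (by rw [hf₀, zero_comp])
  obtain ⟨t, ht⟩ := H'.lift₁ (𝟙 _) (by rw [hf₀, Functor.map_zero, comp_zero])
  -- Both triangles split: `r` is a retraction of `g` and `t` a section of `h'`.
  refine .of_comparison k H H' (r ≫ g' + h ≫ t) ?_ ?_
  · rw [Preadditive.comp_add, ← assoc, ← assoc, ← hr, dist_zero₂₃ H, id_comp, zero_comp, add_zero]
  · rw [Preadditive.add_comp, assoc, assoc, ← ht, H'.zero₂₃, comp_zero, zero_add, comp_id]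

/-- Exactness gives a comparison `w` from the cone to the image cone, compatible with the connecting
morphisms up to an endomorphism of `X⟦1⟧`, that is a scalar. If it were zero, `g` would be a split
monomorphism and `f` zero. -/
lemma HasImageCone.exists_preservesTriangle_smul (hf : HasImageCone φ f) (hX : IsBrick k X)
    (hY : IsBrick k Y) (hf₀ : f ≠ 0) (hf₁ : ¬ IsIso f) {Z : C} {g : Y ⟶ Z}
    {h : Z ⟶ X⟦(1 : ℤ)⟧} (H : Triangle.mk f g h ∈ distTriang C) :
    ∃ a : k, a ≠ 0 ∧ PreservesTriangle Φ φ (Triangle.mk f g (a • h)) := by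
  obtain ⟨Z', g', h', H'⟩ := hf
  obtain ⟨w, hw⟩ := dist_desc₂ H g' H'.zero₁₂
  obtain ⟨v, hv⟩ := dist_desc₃ H (w ≫ h') (by rw [← assoc, ← hw, H'.zero₂₃])
  obtain ⟨a, rfl⟩ := hX.shift.2 v
  rw [Linear.comp_smul, comp_id] at hv
  have ha : a ≠ 0 := by
    rintro rfl
    rw [zero_smul] at hv
    obtain ⟨y, hy⟩ := H'.lift₃ w hv
    obtain ⟨b, hb⟩ := hY.2 (g ≫ y)
    have hg' : g' ≠ 0 := by
      intro h0
      obtain ⟨r, hr⟩ := H'.lift₂ (𝟙 _) (by rw [h0, comp_zero])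
      exact hf₁ (hX.isIso_of_comp_eq_id hY hr.symm)
    have h₁ : (b - 1) • g' = 0 := by
      rw [sub_smul, one_smul, sub_eq_zero]
      conv_rhs => rw [hw, hy, ← assoc, hb, Linear.smul_comp, id_comp]
    rw [sub_eq_zero.1 (IsBrick.smul_eq_zero hg' h₁), one_smul] at hb
    apply hf₀
    rw [← comp_id f, ← hb, ← assoc, dist_zero₁₂ H, zero_comp]
  exact ⟨a, ha, .of_comparison_smul H H' w ha hw.symm hv⟩


/-- Preservation of triangles is insensitive to precomposition. -/
lemma preservesCone_comp_iff_right {W : C} {a : W ⟶ X} (hW : IsBrick k W) (hX : IsBrick k X)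
    (hY : IsBrick k Y) (hf : HasImageCone φ f) (haf : HasImageCone φ (a ≫ f)) (hf₁ : ¬ IsIso f)
    (h₀ : a ≫ f ≠ 0) : PreservesCone φ (a ≫ f) ↔ PreservesCone φ f := by
  obtain ⟨Z, g, h, H⟩ := distinguished_cocone_triangle (a ≫ f)
  obtain ⟨Z', g', h', H'⟩ := distinguished_cocone_triangle f
  constructor
  · intro h₁
    obtain ⟨u', hu', h₂⟩ := hf.exists_preservesTriangle_smul hX hY
      (fun h => h₀ (by rw [h, comp_zero])) hf₁ H'
    have := smul_eq_of_comp_left hX hY hf₁ h₀ H H' (u := (1 : k)) hu'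
      (by rw [one_smul]; exact h₁ _ _ _ H) h₂
    rw [← this, one_smul] at h₂
    exact .of_triangle H' h₂
  · intro h₁
    obtain ⟨u, hu, h₂⟩ := haf.exists_preservesTriangle_smul hW hY h₀ (fun h => hf₁
      (hX.isIso_of_comp_eq_id hY (r := inv (a ≫ f) ≫ a) (by simp))) H
    have := smul_eq_of_comp_left hX hY hf₁ h₀ H H' (u' := (1 : k)) one_ne_zero h₂
      (by rw [one_smul]; exact h₁ _ _ _ H')
    rw [this, one_smul] at h₂
    exact .of_triangle H h₂

/-- Preservation of triangles is insensitive to postcomposition. -/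
lemma PreservesCone.comp {W : C} {b : Y ⟶ W} (h₁ : PreservesCone φ f) (hX : IsBrick k X)
    (hY : IsBrick k Y) (hW : IsBrick k W) (hfb : HasImageCone φ (f ≫ b)) (hf₁ : ¬ IsIso f)
    (h₀ : f ≫ b ≠ 0) : PreservesCone φ (f ≫ b) := by
  obtain ⟨Z, g, h, H⟩ := distinguished_cocone_triangle f
  obtain ⟨Z', g', h', H'⟩ := distinguished_cocone_triangle (f ≫ b)
  obtain ⟨u', hu', h₂⟩ := hfb.exists_preservesTriangle_smul hX hW h₀ (fun h => hf₁
    (hX.isIso_of_comp_eq_id' hY (r := b ≫ inv (f ≫ b)) (by rw [← assoc, IsIso.hom_inv_id]))) H'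
  have := smul_eq_of_comp_right hX hY hf₁ h₀ H H' (u := (1 : k)) hu'
    (by rw [one_smul]; exact h₁ _ _ _ H) h₂
  rw [← this, one_smul] at h₂
  exact .of_triangle H' h₂

end Good

/-! ### Preservation of triangles on morphisms between cones -/

section ConePreservation

open scoped ZeroObject

variable {k : Type w} [Field k] {M : Type*} [LinearOrder M] [OrderTop M]
  {s : M → M} {c : M → M → k}
  {C : Type u₁} [Category.{v₁} C] [Preadditive C] [Linear k C] [HasShift C ℤ] [HasZeroObject C]
  [∀ n : ℤ, (shiftFunctor C n).Additive] [Pretriangulated C] (D : LinSys s c C)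
  {C' : Type u₂} [Category.{v₂} C'] [Preadditive C'] [Linear k C'] [HasShift C' ℤ]
  [HasZeroObject C'] [∀ n : ℤ, (shiftFunctor C' n).Additive] [Pretriangulated C']
  (D' : LinSys s c C')

namespace LinSys

lemma isBrick_X (i : Ival M) : IsBrick k (D.X i) := by
  refine ⟨fun h => ((D.b_eq_zero_iff i i).1 (h.eq_of_src _ _)).1 (C1_self i), fun f => ?_⟩
  obtain ⟨a, ha⟩ := D.span_b f
  exact ⟨a, by rw [ha, b_self]⟩

/-- Writes the connecting morphism of a standard triangle through `b` and `rho`, whose images are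
known, with a scalar that depends only on `c`. -/
lemma hm_qm (i : Ival M) (hp : i.p ≠ ⊤) : D.hm i ≫ (D.qm (topIval hp))⟦(1 : ℤ)⟧' =
    (c ⊤ i.p)⁻¹ • D.b i (D.shiftIval (topIval hp)) ≫ (D.rho (topIval hp)).hom := by
  have h : C2 s i (D.shiftIval (topIval hp)) := ⟨D.s_mono i.lt, le_rfl, D.s_mono hp.lt_top⟩
  have h₁ := D.σ_qm (topIval hp)
  rw [← Iso.eq_inv_comp] at h₁
  rw [h₁, D.b_of_C2 h, ph, eS, D.e_self, comp_id, Linear.comp_smul, Linear.comp_smul, assoc,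
    assoc]

/-- The cone of a morphism between members of the linear system, as a distinguished triangle whose
objects are cones. -/
lemma dist_X (i : Ival M) (hp : i.p ≠ ⊤) (hq : i.q ≠ ⊤) :
    Triangle.mk (D.b (topIval hp) (topIval hq)) (D.b (topIval hq) i)
      (D.hm i ≫ (D.qm (topIval hp))⟦(1 : ℤ)⟧') ∈ distTriang C := by
  refine dist_of_iso (D.dist i) (D.objIso hp) (D.objIso hq) (Iso.refl _) ?_ ?_ ?_
  · exact (D.qm_b (i := topIval hp) (j := topIval hq) ⟨i.lt.le, hp.lt_top, le_rfl⟩).symm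
  · have h := D.qm_b (i := topIval hq) (j := i) ⟨le_rfl, i.lt, le_top⟩
    rw [D.e_self, id_comp] at h
    exact (comp_id _).trans h.symm
  · exact (id_comp _).symm

section

variable (dec : ∀ Y, Decomp D.X Y)

lemma sumsOf_functor_obj (Y : C) : sumsOf D'.X ((functor D D' dec).obj Y) :=
  sumsOf_trans ⟨(dec Y).map (functor D D' dec)⟩ fun i =>
    (sumsOf D'.X).prop_of_iso (functorIso D D' dec i).symm (sumsOf_single _ _)

lemma sumsOf_X_le_essImage : sumsOf D'.X ≤ (functor D D' dec).essImage := by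
  refine sumsOf_le ?_ ?_ ?_
  · intro Y hY
    exact ⟨0, ⟨((functor D D' dec).map_isZero (isZero_zero C)).iso hY⟩⟩
  · intro i
    exact ⟨_, ⟨functorIso D D' dec i⟩⟩
  · rintro Y Y' ⟨A, ⟨e⟩⟩ ⟨A', ⟨e'⟩⟩
    have := preservesBinaryBiproducts_of_preservesBiproducts (functor D D' dec)
    exact ⟨A ⊞ A', ⟨(functor D D' dec).mapBiprod A A' ≪≫ biprod.mapIso e e'⟩⟩

/-- The sums of cones in the target form a triangulated subcategory contained in the essential
image, and fullness lifts the morphisms of the triangle. -/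
lemma hasImageCone [IsTriangulated C'] (φ : SuspIso (functor D D' dec)) {X Y : C} (f : X ⟶ Y) :
    HasImageCone φ f := by
  obtain ⟨W, g, h, H⟩ := distinguished_cocone_triangle ((functor D D' dec).map f)
  have := D'.isTriangulated_sumsOf_X
  obtain ⟨Z, ⟨e⟩⟩ : (functor D D' dec).essImage W := sumsOf_X_le_essImage D D' dec _
    ((sumsOf D'.X).ext_of_isTriangulatedClosed₃ _ H (sumsOf_functor_obj D D' dec X)
      (sumsOf_functor_obj D D' dec Y))
  obtain ⟨g', hg'⟩ := (functor D D' dec).map_surjective (g ≫ e.inv)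
  obtain ⟨h', hh'⟩ := (functor D D' dec).map_surjective (e.hom ≫ h ≫ φ.inv.app X)
  refine ⟨Z, g', h', dist_of_iso H (Iso.refl _) (Iso.refl _) e.symm ?_ ?_ ?_⟩
  · exact (comp_id _).trans (id_comp _).symm
  · exact hg'.symm.trans (id_comp _).symm
  · change h ≫ (𝟙 ((functor D D' dec).obj X))⟦(1 : ℤ)⟧' =
      e.inv ≫ (functor D D' dec).map h' ≫ φ.hom.app X
    rw [hh', assoc, assoc, Iso.inv_hom_id_app, Iso.inv_hom_id_assoc,
      CategoryTheory.Functor.map_id]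
    rfl

variable {φ : SuspIso (functor D D' dec)}

/-- The functor sends `b` to `b`, and the suspension isomorphism is made from `rho`, so by `hm_qm`
the standard triangle goes to the standard triangle. -/
lemma preservesTriangle_dist_X (hφ : ∀ i, φ.hom.app (D.X i) = (suspApp D D' dec i).hom)
    (i : Ival M) (hp : i.p ≠ ⊤) (hq : i.q ≠ ⊤) :
    PreservesTriangle (functor D D' dec) φ (Triangle.mk (D.b (topIval hp) (topIval hq))
      (D.b (topIval hq) i) (D.hm i ≫ (D.qm (topIval hp))⟦(1 : ℤ)⟧')) := by
  have hn : ∀ {i j : Ival M} (f : D.X i ⟶ D.X j), psi D D' i j f ≫ (functorIso D D' dec j).inv =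
      (functorIso D D' dec i).inv ≫ (functor D D' dec).map f := by
    intro i j f
    rw [Iso.comp_inv_eq, assoc, functorIso_naturality, Iso.inv_hom_id_assoc]
  refine dist_of_iso (D'.dist_X i hp hq) (functorIso D D' dec _).symm (functorIso D D' dec _).symm
    (functorIso D D' dec _).symm ?_ ?_ ?_
  · have := hn (D.b (topIval hp) (topIval hq))
    rwa [psi_b] at this
  · have := hn (D.b (topIval hq) i)
    rwa [psi_b] at this
  · change (D'.hm i ≫ (D'.qm (topIval hp))⟦(1 : ℤ)⟧') ≫
        ((functorIso D D' dec (topIval hp)).inv)⟦(1 : ℤ)⟧' =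
      (functorIso D D' dec i).inv ≫ (functor D D' dec).map (D.hm i ≫
        (D.qm (topIval hp))⟦(1 : ℤ)⟧') ≫ φ.hom.app (D.X (topIval hp))
    rw [hφ, suspApp, hm_qm, hm_qm, ← Linear.smul_comp, ← Linear.smul_comp,
      ← psi_smul_b D D', (functor D D' dec).map_comp]
    have h₁ := functorIso_naturality D D' dec
      ((c ⊤ i.p)⁻¹ • D.b i (D.shiftIval (topIval hp)))
    simp only [Iso.trans_hom, Functor.mapIso_hom, Iso.symm_hom, assoc]
    rw [← assoc ((functor D D' dec).map (D.rho (topIval hp)).hom), ← Functor.map_comp,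
      Iso.hom_inv_id, CategoryTheory.Functor.map_id, id_comp, reassoc_of% h₁,
      Iso.inv_hom_id_assoc]

section

lemma preservesCone_b_top_top (hφ : ∀ i, φ.hom.app (D.X i) = (suspApp D D' dec i).hom)
    {p q : M} (h : q < p) (hp : p ≠ ⊤) (hq : q ≠ ⊤) :
    PreservesCone φ (D.b (topIval hp) (topIval hq)) :=
  .of_triangle (D.dist_X ⟨p, q, h⟩ hp hq)
    (preservesTriangle_dist_X D D' dec hφ ⟨p, q, h⟩ hp hq)

lemma preservesCone_b_top (hφ : ∀ i, φ.hom.app (D.X i) = (suspApp D D' dec i).hom)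
    (i : Ival M) (hp : i.p ≠ ⊤) (hq : i.q ≠ ⊤) : PreservesCone φ (D.b (topIval hq) i) :=
  .of_triangle (dist_rotate (D.dist_X i hp hq))
    (PreservesTriangle.rotate_iff.2 (preservesTriangle_dist_X D D' dec hφ _ hp hq))

lemma preservesCone_hm_qm (hφ : ∀ i, φ.hom.app (D.X i) = (suspApp D D' dec i).hom)
    (i : Ival M) (hp : i.p ≠ ⊤) (hq : i.q ≠ ⊤) :
    PreservesCone φ (D.hm i ≫ (D.qm (topIval hp))⟦(1 : ℤ)⟧') :=
  .of_triangle (dist_rotate (dist_rotate (D.dist_X i hp hq))) (PreservesTriangle.rotate_iff.2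
    (PreservesTriangle.rotate_iff.2 (preservesTriangle_dist_X D D' dec hφ _ hp hq)))

end

variable [(shiftFunctor C (1 : ℤ)).Linear k] [IsTriangulated C']

/-- The source is an object of the system, so `f` is a precomposite of a morphism of a standard
triangle: the canonical one into `X j`, or, if `j.p = ⊤`, the generator itself. -/
lemma preservesCone_top (hφ : ∀ i, φ.hom.app (D.X i) = (suspApp D D' dec i).hom)
    {q : M} (hq : q ≠ ⊤) (j : Ival M) (f : D.X (topIval hq) ⟶ D.X j) (hf : f ≠ 0)
    (hf' : ¬ IsIso f) : PreservesCone φ f := by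
  obtain ⟨a, rfl⟩ := D.span_b f
  have ha : a ≠ 0 := fun h => hf (by rw [h, zero_smul])
  have hb : D.b (topIval hq) j ≠ 0 := fun h => hf (by rw [h, smul_zero])
  have h : C1 (topIval hq) j := by
    by_contra h
    refine hb ((D.b_eq_zero_iff _ _).2 ⟨h, fun h' => ?_⟩)
    have := h'.2.2
    rw [D.s_top] at this
    exact not_top_lt this
  by_cases hj : j.p = ⊤
  · obtain ⟨p, q', hq'⟩ := j
    obtain rfl : p = ⊤ := hj
    have hqq' : q' < q := by
      refine lt_of_le_of_ne h.1 ?_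
      rintro rfl
      exact hf' (by
        rw [D.b_self]
        exact inferInstanceAs (IsIso (smulIso ha (Iso.refl (D.X _))).hom))
    have h₁ : (a • 𝟙 _) ≫ D.b (topIval hq) (topIval hq'.ne) =
        a • D.b (topIval hq) (topIval hq'.ne) := by
      rw [Linear.smul_comp, id_comp]
    have h₂ : ¬ IsIso (D.b (topIval hq) (topIval hq'.ne)) := fun _ => hf'
      (inferInstanceAs (IsIso (smulIso ha (asIso (D.b (topIval hq) (topIval hq'.ne)))).hom))
    have h₃ := preservesCone_comp_iff_right (a := a • 𝟙 _) (D.isBrick_X _) (D.isBrick_X _)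
      (D.isBrick_X _) (hasImageCone D D' dec φ _) (hasImageCone D D' dec φ _) h₂ (by rwa [h₁])
    rw [h₁] at h₃
    exact h₃.2 (preservesCone_b_top_top D D' dec hφ hqq' hq hq'.ne)
  · have hq' := j.lt.ne_top
    have h₁ : (a • D.b (topIval hq) (topIval hq')) ≫ D.b (topIval hq') j =
        a • D.b (topIval hq) j := by
      rw [Linear.smul_comp, D.b_comp_of_C1_of_C1 (j := topIval hq') (l := j)
        ⟨h.1, hq.lt_top, le_rfl⟩ ⟨le_rfl, j.lt, le_top⟩]
    have h₂ : ¬ IsIso (D.b (topIval hq') j) := by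
      intro _
      have := dist_zero₁₂ (D.dist_X j hj hq')
      exact ((D.b_eq_zero_iff _ _).1 (zero_of_comp_mono _ this)).1 ⟨j.lt.le, Ne.lt_top hj, le_rfl⟩
    rw [← h₁]
    exact (preservesCone_comp_iff_right (D.isBrick_X _) (D.isBrick_X _) (D.isBrick_X _)
      (hasImageCone D D' dec φ _) (hasImageCone D D' dec φ _) h₂ (by rwa [h₁])).2
      (preservesCone_b_top D D' dec hφ j hj hq')

/-- The functor preserves all triangles on morphisms between cones of morphisms between members of
the linear system. -/
lemma preservesCone_X (hφ : ∀ i, φ.hom.app (D.X i) = (suspApp D D' dec i).hom)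
    (i j : Ival M) (f : D.X i ⟶ D.X j) : PreservesCone φ f := by
  by_cases hf : f = 0
  · exact (hasImageCone D D' dec φ f).preservesCone_of_eq_zero k hf
  by_cases hf' : IsIso f
  · exact (hasImageCone D D' dec φ f).preservesCone_of_isIso k
  obtain ⟨a, rfl⟩ := D.span_b f
  have ha : a ≠ 0 := fun h => hf (by rw [h, zero_smul])
  have hb : D.b i j ≠ 0 := fun h => hf (by rw [h, smul_zero])
  have hq := i.lt.ne_top
  by_cases h : C1 i j
  -- A morphism visible on the system stays nonzero after precomposition with `obj i.q ⟶ X i`, which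
  -- moves its source into the system.
  · have h₁ : D.b (topIval hq) i ≫ (a • D.b i j) = a • D.b (topIval hq) j := by
      rw [Linear.comp_smul, D.b_comp_of_C1_of_C1 (i := topIval hq) (j := i)
        ⟨le_rfl, i.lt, le_top⟩ h]
    have h₂ : D.b (topIval hq) i ≫ (a • D.b i j) ≠ 0 := by
      rw [h₁]
      exact smul_ne_zero ha fun h' =>
        ((D.b_eq_zero_iff _ _).1 h').1 ⟨h.1, h.2.1, le_top⟩
    refine (preservesCone_comp_iff_right (D.isBrick_X _) (D.isBrick_X _) (D.isBrick_X _)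
      (hasImageCone D D' dec φ _) (hasImageCone D D' dec φ _) hf' h₂).1 ?_
    by_cases h₃ : IsIso (D.b (topIval hq) i ≫ (a • D.b i j))
    · exact (hasImageCone D D' dec φ _).preservesCone_of_isIso k
    · exact preservesCone_top D D' dec hφ hq j _ h₂ h₃
  · have h₁ : C2 s i j := by
      by_contra h'
      exact hb ((D.b_eq_zero_iff _ _).2 ⟨h, h'⟩)
    have hp : i.p ≠ ⊤ := by
      intro hp
      have := h₁.2.2
      rw [hp, D.s_top] at this
      exact not_top_lt this
    have h₂ : C2 s i (D.shiftIval (topIval hp)) := ⟨D.s_mono i.lt, le_rfl, D.s_mono hp.lt_top⟩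
    have h₃ : C1 (D.shiftIval (topIval hp)) j := ⟨h₁.2.1, h₁.2.2, by
      change j.p ≤ s ⊤
      rw [D.s_top]
      exact le_top⟩
    -- A phantom is a postcomposite of the connecting morphism of a standard triangle; the factor `c
    -- ⊤ i.p` cancels the scalar in `hm_qm`.
    have h₄ : (D.hm i ≫ (D.qm (topIval hp))⟦(1 : ℤ)⟧') ≫ ((c ⊤ i.p * a) •
        ((D.rho (topIval hp)).inv ≫ D.b (D.shiftIval (topIval hp)) j)) = a • D.b i j := by
      rw [hm_qm, Linear.smul_comp, Linear.comp_smul, assoc, Iso.hom_inv_id_assoc, smul_smul,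
        ← mul_assoc, inv_mul_cancel₀ (D.c_ne _ _), one_mul, D.b_of_C2 h₂, D.ph_comp_b h₂ h₃,
        D.b_of_C2 h₁]
    have h₅ : ¬ IsIso (D.hm i ≫ (D.qm (topIval hp))⟦(1 : ℤ)⟧') := by
      intro _
      have := dist_zero₂₃ (D.dist_X i hp hq)
      exact ((D.b_eq_zero_iff _ _).1 (zero_of_comp_mono _ this)).1 ⟨le_rfl, i.lt, le_top⟩
    rw [← h₄]
    exact (preservesCone_hm_qm D D' dec hφ i hp hq).comp (D.isBrick_X _) (D.isBrick_X _).shift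
      (D.isBrick_X _) (hasImageCone D D' dec φ _) h₅ (by rwa [h₄])

lemma preservesCone_of_iso (hφ : ∀ i, φ.hom.app (D.X i) = (suspApp D D' dec i).hom)
    {i j : Ival M} {X Y : C} (e : X ≅ D.X i) (e' : Y ≅ D.X j) (f : X ⟶ Y) :
    PreservesCone φ f := by
  obtain ⟨f', rfl⟩ : ∃ f', f = e.hom ≫ f' ≫ e'.inv := ⟨e.inv ≫ f ≫ e'.hom, by simp⟩
  intro Z g h H
  have := preservesCone_X D D' dec hφ i j f' Z (e'.inv ≫ g) (h ≫ e.hom⟦(1 : ℤ)⟧')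
    (dist_of_iso H e e' (Iso.refl _) (by simp) (by simp) (by simp))
  exact this.of_iso e.symm e'.symm (Iso.refl _) (by simp) (by simp) (by
    dsimp only [Iso.symm_hom, Iso.refl_hom]
    rw [assoc, ← Functor.map_comp, Iso.hom_inv_id, CategoryTheory.Functor.map_id, comp_id,
      id_comp])

/-- Up to rotation the two indecomposable terms are the source and target of the first morphism, and
indecomposables are cones. -/
lemma preservesTriangle_of_hasTwoIndecomposableTerms
    (hφ : ∀ i, φ.hom.app (D.X i) = (suspApp D D' dec i).hom) (t : Triangle C)
    (ht : t ∈ distTriang C) (h : HasTwoIndecomposableTerms t) :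
    PreservesTriangle (functor D D' dec) φ t := by
  obtain ⟨X, Y, Z, f, g, h', rfl⟩ : ∃ (X Y Z : C) (f : X ⟶ Y) (g : Y ⟶ Z) (h' : Z ⟶ X⟦(1 : ℤ)⟧),
      t = Triangle.mk f g h' := ⟨_, _, _, t.mor₁, t.mor₂, t.mor₃, rfl⟩
  have hX : ∀ {Y : C}, Indecomposable Y → ∃ i, Nonempty (Y ≅ D.X i) := fun hY =>
    exists_iso_of_indecomposable hY ⟨dec _⟩
  rcases h with ⟨h₁, h₂⟩ | ⟨h₁, h₂⟩ | ⟨h₁, h₂⟩ <;> obtain ⟨i, ⟨e⟩⟩ := hX h₁ <;>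
    obtain ⟨j, ⟨e'⟩⟩ := hX h₂
  · exact preservesCone_of_iso D D' dec hφ e e' f _ _ _ ht
  · exact PreservesTriangle.rotate_iff.1
      (preservesCone_of_iso D D' dec hφ e e' g _ _ _ (dist_rotate ht))
  · exact PreservesTriangle.rotate_iff.1 (PreservesTriangle.rotate_iff.1
      (preservesCone_of_iso D D' dec hφ e'
        ((shiftFunctor C (1 : ℤ)).mapIso e ≪≫ (D.rho i).symm) h' _ _ _
        (dist_rotate (dist_rotate ht))))

end

end LinSys

end ConePreservation

/-! ### Normalized generators and construction of linear systems -/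

section Construction

open scoped ZeroObject

variable {k : Type w} [Field k] {C : Type u₁} [Category.{v₁} C] [Preadditive C] [Linear k C]

lemma exists_generator_of_homLE {X Y : C} (h : HomLE k Y X) :
    ∃ f : X ⟶ Y, f ≠ 0 ∧ ∀ g : X ⟶ Y, ∃ a : k, g = a • f := by
  obtain ⟨e⟩ := h
  refine ⟨e.symm 1, by simp, fun g => ⟨e g, ?_⟩⟩
  rw [← map_smul, smul_eq_mul, mul_one, LinearEquiv.symm_apply_apply]

/-- One-dimensional Hom spaces over a linear order for which the composition is nonzero have
generators that are compatible with the composition. -/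
lemma exists_multiplicative_generators {L : Type*} [LinearOrder L] (P : L → C)
    (h₁ : ∀ p q, q ≤ p → HomLE k (P q) (P p)) (h₂ : ∀ p q, p < q → ∀ f : P p ⟶ P q, f = 0)
    (h₃ : ∀ p q r, r ≤ q → q ≤ p → ∀ f : P p ⟶ P r, ∃ (g : P p ⟶ P q) (h : P q ⟶ P r), g ≫ h = f) :
    ∃ e : ∀ p q, P p ⟶ P q, (∀ p, e p p = 𝟙 _) ∧
      (∀ p q r, q ≤ p → r ≤ q → e p q ≫ e q r = e p r) ∧ (∀ p q, q ≤ p → e p q ≠ 0) ∧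
      (∀ p q, ¬ q ≤ p → e p q = 0) ∧ ∀ p q (f : P p ⟶ P q), ∃ a : k, f = a • e p q := by
  classical
  rcases isEmpty_or_nonempty L with hL | ⟨⟨o⟩⟩
  · exact ⟨fun p => isEmptyElim p, fun p => isEmptyElim p, fun p => isEmptyElim p,
      fun p => isEmptyElim p, fun p => isEmptyElim p, fun p => isEmptyElim p⟩
  choose x hx hx' using fun p q h => exists_generator_of_homLE (h₁ p q h)
  have hid : ∀ p, 𝟙 (P p) ≠ 0 := fun p h =>
    hx p p le_rfl (by rw [← comp_id (x p p _), h, comp_zero])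
  -- Some nonzero morphism from `P p` to `P r` factors through `P q`; as the Hom spaces are lines,
  -- no composite of nonzero morphisms can vanish.
  have hcomp : ∀ {p q r} (_ : r ≤ q) (_ : q ≤ p) {f : P p ⟶ P q} {g : P q ⟶ P r},
      f ≠ 0 → g ≠ 0 → f ≫ g ≠ 0 := by
    intro p q r hr hq f g hf hg h
    obtain ⟨f', g', h'⟩ := h₃ p q r hr hq (x p r (hr.trans hq))
    obtain ⟨a, ha⟩ := hx' p q hq f
    obtain ⟨b, hb⟩ := hx' q r hr g
    obtain ⟨a', ha'⟩ := hx' p q hq f'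
    obtain ⟨b', hb'⟩ := hx' q r hr g'
    have ha₀ : a ≠ 0 := fun h => hf (by rw [ha, h, zero_smul])
    have hb₀ : b ≠ 0 := fun h => hg (by rw [hb, h, zero_smul])
    rw [ha, hb, Linear.smul_comp, Linear.comp_smul, smul_smul] at h
    have := (smul_eq_zero.1 h).resolve_left (mul_ne_zero ha₀ hb₀)
    refine hx p r (hr.trans hq) ?_
    rw [← h', ha', hb', Linear.smul_comp, Linear.comp_smul, this, smul_zero, smul_zero]
  obtain ⟨u, hu, huo⟩ : ∃ u : ∀ p, P p ⟶ P o, (∀ p, o ≤ p → u p ≠ 0) ∧ u o = 𝟙 _ :=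
    ⟨fun p => if h : p = o then eqToHom (by rw [h]) else if h : o ≤ p then x p o h else 0, by
      intro p hp
      by_cases h : p = o
      · subst h
        simpa using hid p
      · simp [h, hp, hx], by simp⟩
  obtain ⟨v, hv⟩ : ∃ v : ∀ p, P o ⟶ P p, ∀ p, p < o → v p ≠ 0 :=
    ⟨fun p => if h : p ≤ o then x o p h else 0, fun p hp => by simp [hp.le, hx]⟩
  -- Fix morphisms `u` to the base point `o` from above and `v` from it to everything below.
  -- Compatibility with them singles out one generator of each line and is stable under composition.
  let N : ∀ {p q}, (P p ⟶ P q) → Prop := fun {p q} f =>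
    (o ≤ q → f ≫ u q = u p) ∧ (q < o → o ≤ p → f = u p ≫ v q) ∧ (p < o → v p ≫ f = v q)
  have hN : ∀ p q, q ≤ p → ∃ f : P p ⟶ P q, N f := by
    intro p q hq
    rcases le_or_gt o q with ho | ho
    · have hne := hcomp ho hq (hx p q hq) (hu q ho)
      obtain ⟨a, ha⟩ := hx' p o (ho.trans hq) (x p q hq ≫ u q)
      obtain ⟨b, hb⟩ := hx' p o (ho.trans hq) (u p)
      have ha₀ : a ≠ 0 := fun h => hne (by rw [ha, h, zero_smul])
      refine ⟨(b * a⁻¹) • x p q hq, fun _ => ?_, fun h => absurd ho (not_le.2 h),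
        fun h => absurd (ho.trans hq) (not_le.2 h)⟩
      rw [Linear.smul_comp, ha, smul_smul, mul_assoc, inv_mul_cancel₀ ha₀, mul_one, ← hb]
    · rcases le_or_gt o p with hp | hp
      · exact ⟨u p ≫ v q, fun h => absurd h (not_le.2 ho), fun _ _ => rfl,
          fun h => absurd hp (not_le.2 h)⟩
      · have hne := hcomp hq hp.le (hv p hp) (hx p q hq)
        obtain ⟨a, ha⟩ := hx' o q ho.le (v p ≫ x p q hq)
        obtain ⟨b, hb⟩ := hx' o q ho.le (v q)
        have ha₀ : a ≠ 0 := fun h => hne (by rw [ha, h, zero_smul])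
        refine ⟨(b * a⁻¹) • x p q hq, fun h => absurd h (not_le.2 ho),
          fun _ h => absurd h (not_le.2 hp), fun _ => ?_⟩
        rw [Linear.comp_smul, ha, smul_smul, mul_assoc, inv_mul_cancel₀ ha₀, mul_one, ← hb]
  have hN' : ∀ {p q}, q ≤ p → ∀ {f f' : P p ⟶ P q}, N f → N f' → f = f' := by
    intro p q hq f f' hf hf'
    rcases le_or_gt o q with ho | ho
    · by_contra hne
      refine hcomp ho hq (sub_ne_zero.2 hne) (hu q ho) ?_
      rw [Preadditive.sub_comp, hf.1 ho, hf'.1 ho, sub_self]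
    · rcases le_or_gt o p with hp | hp
      · rw [hf.2.1 ho hp, hf'.2.1 ho hp]
      · by_contra hne
        refine hcomp hq hp.le (hv p hp) (sub_ne_zero.2 hne) ?_
        rw [Preadditive.comp_sub, hf.2.2 hp, hf'.2.2 hp, sub_self]
  have hN₀ : ∀ {p q}, q ≤ p → ∀ {f : P p ⟶ P q}, N f → f ≠ 0 := by
    rintro p q hq f hf rfl
    rcases le_or_gt o q with ho | ho
    · exact hu p (ho.trans hq) (by rw [← hf.1 ho, zero_comp])
    · rcases le_or_gt o p with hp | hp
      · exact hcomp ho.le hp (hu p hp) (hv q ho) (hf.2.1 ho hp).symm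
      · exact hv q ho (by rw [← hf.2.2 hp, comp_zero])
  let e : ∀ p q, P p ⟶ P q := fun p q => if h : q ≤ p then (hN p q h).choose else 0
  have he : ∀ p q, q ≤ p → N (e p q) := fun p q h => by
    simp only [e, dif_pos h]
    exact (hN p q h).choose_spec
  refine ⟨e, fun p => hN' le_rfl (he p p le_rfl) ⟨fun _ => id_comp _,
    fun h h' => absurd h' (not_le.2 h), fun _ => comp_id _⟩, ?_,
    fun p q h => hN₀ h (he p q h), fun p q h => dif_neg h, ?_⟩
  · intro p q r hq hr
    have h₁ := he p q hq
    have h₂ := he q r hr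
    refine hN' (hr.trans hq) ⟨fun h => ?_, fun hr' hp => ?_, fun h => ?_⟩ (he p r (hr.trans hq))
    · rw [assoc, h₂.1 h, h₁.1 (h.trans hr)]
    · rcases le_or_gt o q with ho | ho
      · rw [h₂.2.1 hr' ho, ← assoc, h₁.1 ho]
      · rw [h₁.2.1 ho hp, assoc, h₂.2.2 ho]
    · rw [← assoc, h₁.2.2 h, h₂.2.2 (hq.trans_lt h)]
  · intro p q f
    by_cases h : q ≤ p
    · obtain ⟨a, ha⟩ := hx' p q h f
      obtain ⟨b, hb⟩ := hx' p q h (e p q)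
      have hb₀ : b ≠ 0 := fun h' => hN₀ h (he p q h) (by rw [hb, h', zero_smul])
      exact ⟨a * b⁻¹, by rw [hb, smul_smul, mul_assoc, inv_mul_cancel₀ hb₀, mul_one, ← ha]⟩
    · exact ⟨0, by rw [zero_smul, h₂ p q (not_le.1 h) f]⟩

namespace LinSys

/-- The image of a linear system under a fully faithful functor that commutes with the shift. -/
def map {M : Type*} [LinearOrder M] [OrderTop M] {s : M → M} {c : M → M → k} [HasShift C ℤ]
    (D : LinSys s c C) {C' : Type u₂} [Category.{v₂} C'] [Preadditive C'] [Linear k C']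
    [HasShift C' ℤ] (F : C ⥤ C') [F.Full] [F.Faithful] [F.Additive] [F.Linear k]
    (φ : SuspIso F) : LinSys s c C' where
  obj p := F.obj (D.obj p)
  e p q := F.map (D.e p q)
  σ p := F.mapIso (D.σ p) ≪≫ φ.app _
  isZero_top := F.map_isZero D.isZero_top
  e_self p := by rw [D.e_self, CategoryTheory.Functor.map_id]
  e_comp p q r h h' := by rw [← F.map_comp, D.e_comp p q r h h']
  e_ne_zero p q hp h := (F.map_eq_zero_iff).not.2 (D.e_ne_zero p q hp h)
  e_eq_zero p q h := by rw [D.e_eq_zero p q h, F.map_zero]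
  span p q f := by
    obtain ⟨f, rfl⟩ := F.map_surjective f
    obtain ⟨a, rfl⟩ := D.span p q f
    exact ⟨a, F.map_smul _ _⟩
  σ_nat p q := by
    change (F.map (D.σ p).hom ≫ φ.hom.app (D.obj p)) ≫ (F.map (D.e p q))⟦(1 : ℤ)⟧' =
      c p q • F.map (D.e (s p) (s q)) ≫ F.map (D.σ q).hom ≫ φ.hom.app (D.obj q)
    rw [assoc, ← SuspIso.naturality, ← assoc, ← F.map_comp, D.σ_nat, F.map_smul, Linear.smul_comp,
      F.map_comp, assoc]
  s_mono := D.s_mono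
  le_s := D.le_s
  s_surj := D.s_surj
  c_ne := D.c_ne

/-- Adding a zero object to a family of objects with compatible generators of the Hom spaces
gives a linear system. -/
lemma exists_of_generators [HasZeroObject C] [HasShift C ℤ] [∀ n : ℤ, (shiftFunctor C n).Additive]
    {L : Type*} [LinearOrder L] {s : L → L} (s_mono : StrictMono s) (le_s : ∀ p, p ≤ s p)
    (s_surj : Function.Surjective s) {P : L → C} (e : ∀ p q, P p ⟶ P q) (e_self : ∀ p, e p p = 𝟙 _)
    (e_comp : ∀ p q r, q ≤ p → r ≤ q → e p q ≫ e q r = e p r) (e_ne_zero : ∀ p q, q ≤ p → e p q ≠ 0)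
    (e_eq_zero : ∀ p q, ¬ q ≤ p → e p q = 0) (span : ∀ p q (f : P p ⟶ P q), ∃ a : k, f = a • e p q)
    (σ : ∀ p, P (s p) ≅ (P p)⟦(1 : ℤ)⟧) :
    ∃ (c : WithTop L → WithTop L → k) (D : LinSys (WithTop.map s) c C), ∀ p : L, D.obj p = P p := by
  have hc : ∀ p q, ∃ a : k, a ≠ 0 ∧
      (σ p).hom ≫ (e p q)⟦(1 : ℤ)⟧' = a • e (s p) (s q) ≫ (σ q).hom := by
    intro p q
    by_cases h : q ≤ p
    · obtain ⟨a, ha⟩ := span _ _ ((σ p).hom ≫ (e p q)⟦(1 : ℤ)⟧' ≫ (σ q).inv)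
      have ha' : (σ p).hom ≫ (e p q)⟦(1 : ℤ)⟧' = a • e (s p) (s q) ≫ (σ q).hom := by
        rw [← Linear.smul_comp, ← ha, assoc, assoc, Iso.inv_hom_id, comp_id]
      refine ⟨a, ?_, ha'⟩
      rintro rfl
      rw [zero_smul, ← comp_zero (X := P (s p)), cancel_epi] at ha'
      exact e_ne_zero p q h
        ((shiftFunctor C (1 : ℤ)).map_injective (by rw [ha', Functor.map_zero]))
    -- Both sides are zero, so any scalar works; it has to be nonzero for `c_ne`.
    · refine ⟨1, one_ne_zero, ?_⟩
      rw [e_eq_zero p q h, e_eq_zero _ _ (mt s_mono.le_iff_le.1 h), Functor.map_zero, comp_zero,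
        zero_comp, smul_zero]
  choose c hc hc' using hc
  let obj : WithTop L → C := fun | ⊤ => 0 | (p : L) => P p
  have hz : IsZero (obj ⊤) := isZero_zero C
  let D : LinSys (WithTop.map s) (fun | (p : L), (q : L) => c p q | _, _ => 1) C :=
    { obj := obj
      e := fun | (p : L), (q : L) => e p q | ⊤, _ => 0 | _, ⊤ => 0
      σ := fun | (p : L) => σ p | ⊤ => hz.iso ((shiftFunctor C (1 : ℤ)).map_isZero hz)
      isZero_top := hz
      e_self := fun | (p : L) => e_self p | ⊤ => hz.eq_of_src _ _
      e_comp := by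
        rintro (_ | p) (_ | q) (_ | r) h h'
        all_goals try exact hz.eq_of_src _ _
        all_goals try exact hz.eq_of_tgt _ _
        · exact absurd h (WithTop.coe_lt_top p).not_ge
        · exact e_comp p q r (WithTop.coe_le_coe.1 h) (WithTop.coe_le_coe.1 h')
      e_ne_zero := by
        rintro (_ | p) (_ | q) h h'
        · exact absurd rfl h
        · exact absurd rfl h
        · exact absurd h' (WithTop.coe_lt_top p).not_ge
        · exact e_ne_zero p q (WithTop.coe_le_coe.1 h')
      e_eq_zero := by
        rintro (_ | p) (_ | q) h
        · rfl
        · rfl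
        · rfl
        · exact e_eq_zero p q (mt WithTop.coe_le_coe.2 h)
      span := by
        rintro (_ | p) (_ | q) f
        · exact ⟨0, hz.eq_of_src _ _⟩
        · exact ⟨0, hz.eq_of_src _ _⟩
        · exact ⟨0, hz.eq_of_tgt _ _⟩
        · exact span p q f
      σ_nat := by
        rintro (_ | p) (_ | q)
        · exact hz.eq_of_src _ _
        · exact hz.eq_of_src _ _
        · exact ((shiftFunctor C (1 : ℤ)).map_isZero hz).eq_of_tgt _ _
        · exact hc' p q
      s_mono := s_mono.withTop_map
      le_s := by
        rintro (_ | p)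
        · exact le_rfl
        · exact WithTop.coe_le_coe.2 (le_s p)
      s_surj := by
        rintro (_ | p)
        · exact ⟨⊤, rfl⟩
        · obtain ⟨p, rfl⟩ := s_surj p
          exact ⟨p, rfl⟩
      c_ne := by
        rintro (_ | p) (_ | q)
        · exact one_ne_zero
        · exact one_ne_zero
        · exact one_ne_zero
        · exact hc p q }
  exact ⟨_, D, fun _ => rfl⟩

end LinSys

end Construction

/-! ### The linear system of a linear generator -/

section Family

/-- Applied to indecomposables, the antisymmetrization of `HomLE` is the set of isomorphism classes,
and `f` chooses representatives. -/
lemma exists_linearOrder_of_total {α : Type u₁} (r : α → α → Prop) (h₁ : ∀ a, r a a)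
    (h₂ : ∀ a b c, r a b → r b c → r a c) (h₃ : ∀ a b, r a b ∨ r b a) :
    ∃ (L : Type u₁) (_ : LinearOrder L) (f : L → α), (∀ p q, p ≤ q ↔ r (f p) (f q)) ∧
      ∀ a, ∃ p, r a (f p) ∧ r (f p) a := by
  classical
  let _ : Preorder α := { le := r, le_refl := h₁, le_trans := h₂ }
  have : @Std.Total α (· ≤ ·) := ⟨h₃⟩
  refine ⟨Antisymmetrization α (· ≤ ·), inferInstance, ofAntisymmetrization (· ≤ ·),
    fun p q => ofAntisymmetrization_le_ofAntisymmetrization_iff.symm, fun a =>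
    ⟨toAntisymmetrization (· ≤ ·) a, ?_⟩⟩
  have h := toAntisymmetrization_ofAntisymmetrization (· ≤ ·)
    (toAntisymmetrization (α := α) (· ≤ ·) a)
  exact ⟨toAntisymmetrization_le_toAntisymmetrization_iff.1 h.ge,
    toAntisymmetrization_le_toAntisymmetrization_iff.1 h.le⟩

/-- A fully faithful additive functor reflects decompositions. -/
noncomputable def Decomp.ofMap {C : Type u₁} [Category.{v₁} C] [Preadditive C] {C' : Type u₂}
    [Category.{v₂} C'] [Preadditive C'] (F : C ⥤ C') [F.Full] [F.Faithful] [F.Additive]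
    {I : Type*} {X : I → C} {Y : C} (d : Decomp (fun i => F.obj (X i)) (F.obj Y)) :
    Decomp X Y where
  J := d.J
  fin := d.fin
  idx := d.idx
  ι j := F.preimage (d.ι j)
  π j := F.preimage (d.π j)
  ι_π_self j := F.map_injective (by simp [d.ι_π_self])
  ι_π_ne j j' h := F.map_injective (by simp [d.ι_π_ne _ _ h])
  total := F.map_injective (by
    have := d.total
    simpa [Functor.map_sum] using this)

variable {k : Type w} [Field k] {C : Type u₁} [Category.{v₁} C] [Preadditive C] [Linear k C]

lemma homLE_map_iff {C' : Type u₂} [Category.{v₂} C'] [Preadditive C'] [Linear k C'] (F : C ⥤ C')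
    [F.Full] [F.Faithful] [F.Additive] [F.Linear k] {X Y : C} :
    HomLE k (F.obj X) (F.obj Y) ↔ HomLE k X Y := by
  let e : (Y ⟶ X) ≃ₗ[k] (F.obj Y ⟶ F.obj X) :=
    LinearEquiv.ofBijective (F.mapLinearMap k) ⟨F.map_injective, F.map_surjective⟩
  exact ⟨fun ⟨h⟩ => ⟨e.trans h⟩, fun ⟨h⟩ => ⟨e.symm.trans h⟩⟩

lemma homLE_of_iso {X X' Y Y' : C} (e : X ≅ X') (e' : Y ≅ Y') (h : HomLE k X Y) :
    HomLE k X' Y' :=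
  h.map fun h => (Linear.homCongr k e'.symm e.symm).trans h

lemma langOne_self {C : Type u₁} [Category.{v₁} C] [HasShift C ℤ] (G : C) : langOne G G :=
  ObjectProperty.le_retractClosure _ _ (ObjectProperty.le_limitsClosure _ _ _
    (ObjectProperty.le_shiftClosure _ _ (by simp)))

variable [HasZeroObject C] [HasShift C ℤ] [∀ n : ℤ, (shiftFunctor C n).Additive]
  [Pretriangulated C] {G : C}

lemma langOne_biprod {Y Y' : C} (h : langOne G Y) (h' : langOne G Y') : langOne G (Y ⊞ Y') := by
  obtain ⟨Z, hZ, ⟨r⟩⟩ := h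
  obtain ⟨Z', hZ', ⟨r'⟩⟩ := h'
  refine ⟨Z ⊞ Z', ?_, ⟨⟨biprod.map r.i r'.i, biprod.map r.r r'.r, ?_⟩⟩⟩
  · exact ObjectProperty.prop_of_isLimit_binaryFan _ (BinaryBiproduct.isLimit Z Z') hZ hZ'
  · ext <;> simp

lemma sumsOf_le_langOne {I : Type*} {X : I → C} (h : ∀ i, langOne G (X i)) :
    sumsOf X ≤ langOne G :=
  sumsOf_le (fun _ hY => (langOne G).prop_of_retract
    ⟨0, 0, hY.eq_of_src _ _⟩ (langOne_self G)) h fun _ _ => langOne_biprod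

namespace IsLinearGenerator

lemma isBrick (hG : IsLinearGenerator k G) {P : C} (hP : IsIndIn G P) : IsBrick k P := by
  refine ⟨hP.1.1, fun f => ?_⟩
  obtain ⟨g, hg, hg'⟩ := exists_generator_of_homLE (hG.le_refl P hP)
  obtain ⟨a, ha⟩ := hg' (𝟙 P)
  obtain ⟨b, rfl⟩ := hg' f
  have ha₀ : a ≠ 0 := by
    rintro rfl
    exact hP.1.1 ((IsZero.iff_id_eq_zero P).2 (by rw [ha, zero_smul]))
  exact ⟨b * a⁻¹, by rw [ha, smul_smul, mul_assoc, inv_mul_cancel₀ ha₀, mul_one]⟩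

lemma isIndIn_shift (hG : IsLinearGenerator k G) (n : ℤ) [(shiftFunctor C n).Linear k] {P : C}
    (hP : IsIndIn G P) : IsIndIn G (P⟦n⟧) :=
  ⟨((hG.isBrick hP).shiftBy n).indecomposable, (langOne G).le_shift n _ hP.2⟩

/-- By totality the alternative is an upward morphism, which is zero unless the objects are
isomorphic. -/
lemma homLE_of_ne_zero (hG : IsLinearGenerator k G) {P Q : C} (hP : IsIndIn G P)
    (hQ : IsIndIn G Q) (f : P ⟶ Q) (hf : f ≠ 0) : HomLE k Q P := by
  rcases hG.le_total P Q hP hQ with h | h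
  · exact h
  · by_cases hPQ : Nonempty (P ≅ Q)
    · obtain ⟨e⟩ := hPQ
      exact homLE_of_iso e (Iso.refl P) (hG.le_refl P hP)
    · exact (hf (hG.hom_eq_zero Q P hQ hP h hPQ f)).elim

/-- A linear generator gives rise to a linear system. -/
lemma exists_linSys (hG : IsLinearGenerator k G) (hC : IsKrullSchmidt C)
    [∀ n : ℤ, (shiftFunctor C n).Linear k] :
    ∃ (L : Type u₁) (_ : LinearOrder L) (s : L → L) (c : WithTop L → WithTop L → k)
      (D : LinSys (WithTop.map s) c (langOne G).FullSubcategory), ∀ Y, sumsOf D.obj Y := by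
  obtain ⟨L, _, P, hP, hP'⟩ := exists_linearOrder_of_total
    (fun P Q : {P : C // IsIndIn G P} => HomLE k P.1 Q.1) (fun P => hG.le_refl _ P.2)
    (fun P Q R h h' => hG.le_trans _ _ _ R.2 Q.2 P.2 h h') (fun P Q => hG.le_total _ _ Q.2 P.2)
  have hiso : ∀ {Q : C}, IsIndIn G Q → ∃ p, Nonempty ((P p).1 ≅ Q) := fun {Q} hQ => by
    obtain ⟨p, h₁, h₂⟩ := hP' ⟨Q, hQ⟩
    exact ⟨p, hG.le_antisymm _ _ hQ (P p).2 h₂ h₁⟩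
  have hle : ∀ {p q}, p ≤ q ↔ HomLE k (P p).1 (P q).1 := hP _ _
  have heq : ∀ {p q}, Nonempty ((P p).1 ≅ (P q).1) → p = q := fun {p q} ⟨e⟩ =>
    _root_.le_antisymm (hle.2 (homLE_of_iso (Iso.refl _) e (hG.le_refl _ (P p).2)))
      (hle.2 (homLE_of_iso e (Iso.refl _) (hG.le_refl _ (P p).2)))
  choose s hs using fun p => hiso (hG.isIndIn_shift 1 (P p).2)
  have s_le : ∀ {p q}, s p ≤ s q ↔ p ≤ q := fun {p q} => by
    rw [hle, hle, ← homLE_map_iff (shiftFunctor C (1 : ℤ)) (X := (P p).1)]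
    exact ⟨homLE_of_iso (hs p).some (hs q).some, homLE_of_iso (hs p).some.symm (hs q).some.symm⟩
  have le_s : ∀ p, p ≤ s p := fun p =>
    hle.2 (homLE_of_iso (Iso.refl _) (hs p).some.symm (hG.le_shift _ (P p).2))
  have s_surj : Function.Surjective s := fun q => by
    obtain ⟨p, ⟨e⟩⟩ := hiso (hG.isIndIn_shift (-1) (P q).2)
    exact ⟨p, heq ⟨(hs p).some ≪≫ (shiftFunctor C (1 : ℤ)).mapIso e ≪≫
      shiftNegShift (P q).1 (1 : ℤ)⟩⟩
  let P' : L → (langOne G).FullSubcategory := fun p => ⟨(P p).1, (P p).2.2⟩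
  obtain ⟨e, e_self, e_comp, e_ne_zero, e_eq_zero, span⟩ :=
    exists_multiplicative_generators (k := k) P'
      (fun p q h => (homLE_map_iff (langOne G).ι).1 (hle.1 h))
      (fun p q h f => (langOne G).hom_ext (hG.hom_eq_zero _ _ (P q).2 (P p).2 (hle.1 h.le)
        (fun h' => h.ne (heq h')) f.hom))
      (fun p q r h h' f => by
        obtain ⟨g, g', hg⟩ := hG.factors _ _ _ (P p).2 (P q).2 (P r).2 (hle.1 h) (hle.1 h') f.hom
        exact ⟨ObjectProperty.homMk g, ObjectProperty.homMk g', (langOne G).hom_ext hg⟩)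
  obtain ⟨c, D, hD⟩ := LinSys.exists_of_generators (strictMono_of_le_iff_le fun p q => s_le.symm)
    le_s s_surj e e_self e_comp e_ne_zero e_eq_zero span
    (fun p => (langOne G).isoMk ((hs p).some ≪≫
      (((langOne G).ι.commShiftIso (1 : ℤ)).app (P' p)).symm))
  refine ⟨L, _, s, c, D, fun Y => ?_⟩
  have hY : sumsOf (fun p => (P p).1) Y.obj := by
    refine hC.sumsOf_of_isStableUnderRetracts (langOne G) (fun Z _ hZ => ?_) Y.property
    obtain ⟨p, ⟨e⟩⟩ := hiso ⟨indecomposable_of_idempotents not_isZero_of_isLocalRing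
      isIso_or_eq_zero_of_idempotent, hZ⟩
    exact (sumsOf _).prop_of_iso e (sumsOf_single _ p)
  obtain ⟨d⟩ := hY
  refine sumsOf_trans ⟨Decomp.ofMap (langOne G).ι (X := P') d⟩ fun p => ?_
  rw [← hD]
  exact sumsOf_single _ _

end IsLinearGenerator

end Family

/-! ### Values of the functor on the objects of the system -/

section Comparison

variable {k : Type w} [Field k] {M : Type*} [LinearOrder M] [OrderTop M]
  {s : M → M} {c : M → M → k}
  {C : Type u₁} [Category.{v₁} C] [Preadditive C] [Linear k C] [HasShift C ℤ] [HasZeroObject C]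
  [∀ n : ℤ, (shiftFunctor C n).Additive] [Pretriangulated C] (D : LinSys s c C)
  {C' : Type u₂} [Category.{v₂} C'] [Preadditive C'] [Linear k C'] [HasShift C' ℤ]
  [HasZeroObject C'] [∀ n : ℤ, (shiftFunctor C' n).Additive] [Pretriangulated C']
  (D' : LinSys s c C') (dec : ∀ Y, Decomp D.X Y)

namespace LinSys

lemma isBrick_obj {k : Type w} [Field k] {s : M → M} {c : M → M → k}
    {C : Type u₁} [Category.{v₁} C] [Preadditive C] [Linear k C] [HasShift C ℤ]
    (D : LinSys s c C) {p : M} (hp : p ≠ ⊤) : IsBrick k (D.obj p) := by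
  refine ⟨fun h => D.e_ne_zero p p hp le_rfl (h.eq_of_src _ _), fun f => ?_⟩
  obtain ⟨a, ha⟩ := D.span p p f
  exact ⟨a, by rw [ha, e_self]⟩

lemma qm_ne_zero (i : Ival M) : D.qm i ≠ 0 := fun h =>
  (D.e_qm_eq_zero_iff i i.q).1 (by rw [h, comp_zero]) ⟨le_rfl, i.lt⟩

lemma e_objIso {p q : M} (h : q ≤ p) (hp : p ≠ ⊤) (hq : q ≠ ⊤) :
    D.e p q ≫ (D.objIso hq).hom = (D.objIso hp).hom ≫ D.b (topIval hp) (topIval hq) :=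
  (D.qm_b (i := topIval hp) (j := topIval hq) ⟨h, hp.lt_top, le_rfl⟩).symm

/-- The functor sends the objects of the first linear system to those of the second one. -/
noncomputable def functorObjIso {p : M} (hp : p ≠ ⊤) :
    (functor D D' dec).obj (D.obj p) ≅ D'.obj p :=
  (functor D D' dec).mapIso (D.objIso hp) ≪≫ functorIso D D' dec (topIval hp) ≪≫
    (D'.objIso hp).symm

lemma functorObjIso_naturality {p q : M} (h : q ≤ p) (hp : p ≠ ⊤) (hq : q ≠ ⊤) (a : k) :
    (functor D D' dec).map (a • D.e p q) ≫ (functorObjIso D D' dec hq).hom =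
      (functorObjIso D D' dec hp).hom ≫ (a • D'.e p q) := by
  have h₁ : (a • D'.b (topIval hp) (topIval hq)) ≫ (D'.objIso hq).inv =
      (D'.objIso hp).inv ≫ (a • D'.e p q) := by
    rw [Iso.comp_inv_eq, assoc, Linear.smul_comp, D'.e_objIso h hp hq, Linear.comp_smul,
      Iso.inv_hom_id_assoc]
  have h₂ := functorIso_naturality D D' dec (a • D.b (topIval hp) (topIval hq))
  rw [psi_smul_b] at h₂
  simp only [functorObjIso, Iso.trans_hom, Functor.mapIso_hom, Iso.symm_hom, assoc]
  rw [← h₁, ← reassoc_of% h₂, ← assoc, ← Functor.map_comp, Linear.smul_comp,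
    D.e_objIso h hp hq, ← Linear.comp_smul, Functor.map_comp, assoc]

end LinSys

end Comparison

/-! ### Restriction and essential surjectivity of the extended functor -/

section Extension

universe v₃ u₃

variable {k : Type w} [Field k] {M : Type*} [LinearOrder M] [OrderTop M]
  {s : M → M} {c : M → M → k}
  {A : Type u₃} [Category.{v₃} A] [Preadditive A] [Linear k A] [HasShift A ℤ] (D : LinSys s c A)
  (hD : ∀ Y, sumsOf D.obj Y)
  {C : Type u₁} [Category.{v₁} C] [Preadditive C] [Linear k C] [HasShift C ℤ] [HasZeroObject C]
  [∀ n : ℤ, (shiftFunctor C n).Additive] [Pretriangulated C]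
  {C' : Type u₂} [Category.{v₂} C'] [Preadditive C'] [Linear k C'] [HasShift C' ℤ]
  [HasZeroObject C'] [∀ n : ℤ, (shiftFunctor C' n).Additive] [Pretriangulated C']
  (E : A ⥤ C) [E.Full] [E.Faithful] [E.Additive] [E.Linear k] (ε : SuspIso E)
  (F : A ⥤ C') [F.Full] [F.Faithful] [F.Additive] [F.Linear k] (φ : SuspIso F)
  (dec : ∀ Y, Decomp (D.map E ε).X Y)

namespace LinSys

/-- An object of the system is the cone on an interval with top end, where the functor is known;
zero objects are treated apart, and the rest follows additively. -/
lemma exists_restriction_iso (hD : ∀ Y, sumsOf D.obj Y) :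
    Nonempty (E ⋙ functor (D.map E ε) (D.map F φ) dec ≅ F) := by
  classical
  have hz : ∀ {p}, p = ⊤ → IsZero (D.obj p) := by
    rintro _ rfl
    exact D.isZero_top
  let α : ∀ p, (E ⋙ functor (D.map E ε) (D.map F φ) dec).obj (D.obj p) ≅ F.obj (D.obj p) :=
    fun p => if hp : p = ⊤ then
      (Functor.map_isZero (E ⋙ functor (D.map E ε) (D.map F φ) dec) (hz hp)).iso
        (F.map_isZero (hz hp))
    else functorObjIso (D.map E ε) (D.map F φ) dec hp
  have hα : ∀ {p} (hp : p ≠ ⊤), α p = functorObjIso (D.map E ε) (D.map F φ) dec hp :=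
    fun hp => dif_neg hp
  obtain ⟨e, -⟩ := exists_iso_of_family (fun Y => (hD Y).some) α (fun p q f => by
    by_cases hp : p = ⊤
    · exact (Functor.map_isZero (E ⋙ functor (D.map E ε) (D.map F φ) dec)
        (hz hp)).eq_of_src _ _
    by_cases hq : q = ⊤
    · exact (F.map_isZero (hz hq)).eq_of_tgt _ _
    obtain ⟨a, rfl⟩ := D.span p q f
    by_cases h : q ≤ p
    · rw [hα hp, hα hq]
      have := functorObjIso_naturality (D.map E ε) (D.map F φ) dec h hp hq a
      rw [F.map_smul]
      change (functor (D.map E ε) (D.map F φ) dec).map (E.map (a • D.e p q)) ≫ _ = _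
      rw [E.map_smul]
      exact this
    · rw [D.e_eq_zero p q h, smul_zero, Functor.map_zero, Functor.map_zero, zero_comp, comp_zero])
  exact ⟨e⟩

lemma exists_decomp_X [IsTriangulated C] (hD : ∀ Y, sumsOf D.obj Y) (hC : IsKrullSchmidt C)
    {G : A} (hG : (ObjectProperty.singleton (E.obj G)).IsClassicalTriangulatedGenerator) (Y : C) :
    sumsOf (D.map E ε).X Y := by
  have h := (D.map E ε).sumsOf_X_eq_top hC hG
    ((D.map E ε).sumsOf_obj_le _ ((hD G).map fun d => d.map E))
  rw [h]
  trivial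

/-- Once `F` reaches the generator `G'`, it is a sum of cones of the image system, so all objects
are such sums, and these are in the essential image. -/
lemma essSurj_functor [IsTriangulated C'] (hC' : IsKrullSchmidt C') {G' : C'}
    (hG' : (ObjectProperty.singleton G').IsClassicalTriangulatedGenerator)
    (hD : ∀ Y, sumsOf D.obj Y) (h : F.essImage G') :
    (functor (D.map E ε) (D.map F φ) dec).EssSurj where
  mem_essImage Y := by
    obtain ⟨e⟩ := exists_restriction_iso D E ε F φ dec hD
    obtain ⟨Z, ⟨e'⟩⟩ := h
    have hS : sumsOf (D.map F φ).X G' := (sumsOf _).prop_of_iso (e.app Z ≪≫ e')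
      (sumsOf_functor_obj _ _ dec _)
    refine sumsOf_X_le_essImage _ _ dec _ ?_
    rw [(D.map F φ).sumsOf_X_eq_top hC' hG' hS]
    trivial

/-- If a summand of the preimage of `Y` were a cone with `i.p ≠ ⊤`, then `e i.p i.q` and `qm i`
would be nonzero morphisms between indecomposables in `Q`. By `hQ` there would be a nonzero morphism
from `obj i.p` to `X i`, but that Hom space is zero. So all summands lie in the system. -/
lemma mem_essImage_of_essSurj_functor (Q : ObjectProperty C') [Q.IsStableUnderRetracts]
    (hQ : ∀ {X Y Z : C'}, Indecomposable X → Indecomposable Y → Indecomposable Z →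
      Q X → Q Y → Q Z → ∀ (f : X ⟶ Y) (g : Y ⟶ Z), f ≠ 0 → g ≠ 0 → ∃ h : X ⟶ Z, h ≠ 0)
    (hE : ∀ Y, sumsOf (D.map E ε).obj Y → E.essImage Y) (hD : ∀ Y, sumsOf D.obj Y)
    (hF : ∀ Y, Q (F.obj Y)) (h : (functor (D.map E ε) (D.map F φ) dec).EssSurj) {Y : C'}
    (hY : Q Y) : F.essImage Y := by
  obtain ⟨X, ⟨e⟩⟩ := h.mem_essImage Y
  obtain ⟨e'⟩ := exists_restriction_iso D E ε F φ dec hD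
  have hX : sumsOf (D.map E ε).obj X := by
    refine ⟨(dec X).trans fun j => Nonempty.some ?_⟩
    have hj : Q ((D.map F φ).X ((dec X).idx j)) := by
      refine Q.prop_of_retract (Retract.trans ?_ (Retract.ofIso e)) hY
      exact (Retract.ofIso (functorIso (D.map E ε) (D.map F φ) dec _).symm).trans
        (((dec X).retract j).map (functor (D.map E ε) (D.map F φ) dec))
    generalize (dec X).idx j = i at hj
    have hp : i.p = ⊤ := by
      by_contra hp
      have hq := i.lt.ne_top
      obtain ⟨f, hf⟩ := hQ ((D.map F φ).isBrick_obj hp).indecomposable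
        ((D.map F φ).isBrick_obj hq).indecomposable ((D.map F φ).isBrick_X i).indecomposable (hF _) (hF _) hj
        ((D.map F φ).e i.p i.q) ((D.map F φ).qm i)
        ((D.map F φ).e_ne_zero _ _ hp i.lt.le) ((D.map F φ).qm_ne_zero i)
      exact hf ((D.map F φ).hom_X_eq_zero i (fun h => lt_irrefl _ h.2) f)
    obtain ⟨p, q, hpq⟩ := i
    obtain rfl : p = ⊤ := hp
    exact (sumsOf _).prop_of_iso ((D.map E ε).objIso hpq.ne) (sumsOf_single _ _)
  obtain ⟨Z, ⟨e''⟩⟩ := hE X hX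
  exact ⟨Z, ⟨(e'.app Z).symm ≪≫ (functor (D.map E ε) (D.map F φ) dec).mapIso e'' ≪≫ e⟩⟩

end LinSys

/-- The extension of a linear functor between subcategories with linear systems. -/
theorem exists_extension [IsTriangulated C] [IsTriangulated C']
    [(shiftFunctor C (1 : ℤ)).Linear k] [(shiftFunctor C' (1 : ℤ)).Linear k]
    (hC : IsKrullSchmidt C) (hC' : IsKrullSchmidt C') {G : A}
    (hG : (ObjectProperty.singleton (E.obj G)).IsClassicalTriangulatedGenerator) {G' : C'}
    (hG' : (ObjectProperty.singleton G').IsClassicalTriangulatedGenerator)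
    (Q : ObjectProperty C') [Q.IsStableUnderRetracts]
    (hQ : ∀ {X Y Z : C'}, Indecomposable X → Indecomposable Y → Indecomposable Z →
      Q X → Q Y → Q Z → ∀ (f : X ⟶ Y) (g : Y ⟶ Z), f ≠ 0 → g ≠ 0 → ∃ h : X ⟶ Z, h ≠ 0) (hQ' : Q G')
    (hE : ∀ Y, sumsOf (fun p => E.obj (D.obj p)) Y → E.essImage Y) (hD : ∀ Y, sumsOf D.obj Y)
    (hF : ∀ Y, Q (F.obj Y)) (ε : SuspIso E) (φ : SuspIso F) :
    ∃ (Φ : C ⥤ C') (φ : SuspIso Φ), Φ.Full ∧ Φ.Faithful ∧ Φ.Additive ∧ Nonempty (E ⋙ Φ ≅ F) ∧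
      (∀ t ∈ distTriang C, HasTwoIndecomposableTerms t → PreservesTriangle Φ φ t) ∧
      (Φ.EssSurj ↔ Q ≤ F.essImage) := by
  let dec : ∀ Y, Decomp (D.map E ε).X Y := fun Y => (D.exists_decomp_X E ε hD hC hG Y).some
  obtain ⟨ψ, hψ⟩ := LinSys.exists_suspIso (D.map E ε) (D.map F φ) dec
  exact ⟨LinSys.functor (D.map E ε) (D.map F φ) dec, ψ, inferInstance, inferInstance,
    inferInstance, D.exists_restriction_iso E ε F φ dec hD, fun t ht h =>
      LinSys.preservesTriangle_of_hasTwoIndecomposableTerms _ _ dec hψ t ht h,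
    fun h Y hY => D.mem_essImage_of_essSurj_functor E ε F φ dec Q hQ hE hD hF h hY,
    fun h => D.essSurj_functor E ε F φ dec hC' hG' hD (h _ hQ')⟩

end Extension

/-! ### Semilinearity of additive functors -/

section Twist

universe v₃ u₃

variable {k : Type w} [Field k]

/-- The restriction of the scalars of a linear category along a ring homomorphism. -/
abbrev twistLinear (θ : k →+* k) (C : Type u₁) [Category.{v₁} C] [Preadditive C] [Linear k C] :
    Linear k C where
  homModule X Y := Module.compHom (X ⟶ Y) θ
  smul_comp X Y Z a f g := Linear.smul_comp X Y Z (θ a) f g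
  comp_smul X Y Z f a g := Linear.comp_smul X Y Z f (θ a) g

/-- On a brick the image of `a • 𝟙 _` is a scalar, and this defines `θ`. It is the same for all
objects of the system, since any two nonzero ones are joined by a nonzero morphism. -/
lemma exists_semilinear {M : Type*} [LinearOrder M] [OrderTop M] {s : M → M} {c : M → M → k}
    {A : Type u₃} [Category.{v₃} A] [Preadditive A] [Linear k A] [HasShift A ℤ] (D : LinSys s c A)
    (hD : ∀ Y, sumsOf D.obj Y) {C : Type u₁} [Category.{v₁} C] [Preadditive C] [Linear k C]
    (F : A ⥤ C) [F.Faithful] [F.Additive] (hF : ∀ p, p ≠ ⊤ → IsBrick k (F.obj (D.obj p))) :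
    ∃ θ : k →+* k, ∀ {X Y : A} (a : k) (f : X ⟶ Y), F.map (a • f) = θ a • F.map f := by
  by_cases hM : ∀ p : M, p = ⊤
  · refine ⟨RingHom.id k, fun {X Y} a f => ?_⟩
    have hX : IsZero X := by
      obtain ⟨d⟩ := hD X
      rw [IsZero.iff_id_eq_zero, ← d.total]
      refine Finset.sum_eq_zero fun j _ => ?_
      have : IsZero (D.obj (d.idx j)) := by
        rw [hM (d.idx j)]
        exact D.isZero_top
      rw [this.eq_of_tgt (d.π j) 0, zero_comp]
    exact (F.map_isZero hX).eq_of_src _ _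
  · push Not at hM
    obtain ⟨o, ho⟩ := hM
    choose θ hθ using fun a : k => (hF o ho).2 (F.map (a • 𝟙 _))
    have hinj : ∀ {a b : k}, a • 𝟙 (F.obj (D.obj o)) = b • 𝟙 _ → a = b :=
      fun h => smul_left_injective k (hF o ho).id_ne_zero h
    let Θ : k →+* k :=
      { toFun := θ
        map_one' := hinj (by rw [← hθ, one_smul, one_smul, CategoryTheory.Functor.map_id])
        map_zero' := hinj (by rw [← hθ, zero_smul, zero_smul, Functor.map_zero])
        map_add' := fun a b => hinj (by
          rw [← hθ, add_smul, add_smul, ← hθ, ← hθ, Functor.map_add])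
        map_mul' := fun a b => hinj (by
          have h : (a * b) • 𝟙 (D.obj o) = (b • 𝟙 _) ≫ (a • 𝟙 _) := by
            rw [Linear.smul_comp, id_comp, smul_smul, mul_comm]
          rw [← hθ, h, F.map_comp, hθ, hθ, Linear.smul_comp, id_comp, smul_smul, mul_comm]) }
    -- Scalars commute with the generator joining `obj p` and `obj o`, whose image is nonzero, so
    -- they agree at both ends.
    have h₁ : ∀ p (a : k), F.map (a • 𝟙 (D.obj p)) = Θ a • 𝟙 _ := by
      intro p a
      by_cases hp : p = ⊤
      · subst hp
        exact (F.map_isZero D.isZero_top).eq_of_src _ _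
      obtain ⟨b, hb⟩ := (hF p hp).2 (F.map (a • 𝟙 _))
      rw [hb]
      congr 1
      rcases le_total p o with h | h
      · refine smul_left_injective k ((F.map_eq_zero_iff).not.2 (D.e_ne_zero o p ho h)) ?_
        change b • F.map (D.e o p) = θ a • F.map (D.e o p)
        calc b • F.map (D.e o p) = F.map (D.e o p) ≫ (b • 𝟙 _) := by
              rw [Linear.comp_smul, comp_id]
          _ = (θ a • 𝟙 _) ≫ F.map (D.e o p) := by
              rw [← hb, ← hθ, ← F.map_comp, ← F.map_comp, Linear.comp_smul, Linear.smul_comp,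
                id_comp, comp_id]
          _ = _ := by rw [Linear.smul_comp, id_comp]
      · refine smul_left_injective k ((F.map_eq_zero_iff).not.2 (D.e_ne_zero p o hp h)) ?_
        change b • F.map (D.e p o) = θ a • F.map (D.e p o)
        calc b • F.map (D.e p o) = (b • 𝟙 _) ≫ F.map (D.e p o) := by
              rw [Linear.smul_comp, id_comp]
          _ = F.map (D.e p o) ≫ (θ a • 𝟙 _) := by
              rw [← hb, ← hθ, ← F.map_comp, ← F.map_comp, Linear.comp_smul, Linear.smul_comp,
                id_comp, comp_id]
          _ = _ := by rw [Linear.comp_smul, comp_id]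
    have h₂ : ∀ (Y : A) (a : k), F.map (a • 𝟙 Y) = Θ a • 𝟙 _ := by
      intro Y a
      obtain ⟨d⟩ := hD Y
      have h₃ : a • 𝟙 Y = ∑ j, d.π j ≫ (a • 𝟙 _) ≫ d.ι j := by
        rw [← d.total, Finset.smul_sum]
        refine Finset.sum_congr rfl fun j _ => ?_
        rw [Linear.smul_comp, id_comp, Linear.comp_smul]
      rw [h₃, F.map_sum, ← CategoryTheory.Functor.map_id, ← d.total, F.map_sum, Finset.smul_sum]
      refine Finset.sum_congr rfl fun j _ => ?_
      rw [F.map_comp, F.map_comp, h₁, Linear.smul_comp, id_comp, Linear.comp_smul, F.map_comp]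
    refine ⟨Θ, fun {X Y} a f => ?_⟩
    have h₃ : a • f = f ≫ (a • 𝟙 _) := by rw [Linear.comp_smul, comp_id]
    rw [h₃, F.map_comp, h₂, Linear.comp_smul, comp_id]

end Twist

/-! ### Assembly of the theorem -/

section Main

universe v₃ u₃

variable {k : Type w} [Field k]
    {T : Type u₁} [Category.{v₁} T] [Preadditive T] [Linear k T] [HasZeroObject T] [HasShift T ℤ]
    [∀ n : ℤ, (shiftFunctor T n).Additive] [∀ n : ℤ, (shiftFunctor T n).Linear k]
    [Pretriangulated T] [IsTriangulated T]
    {S : Type u₂} [Category.{v₂} S] [Preadditive S] [Linear k S] [HasZeroObject S] [HasShift S ℤ]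
    [∀ n : ℤ, (shiftFunctor S n).Additive] [(shiftFunctor S (1 : ℤ)).Linear k]
    [Pretriangulated S] [IsTriangulated S]

/-- The extension of a semilinear functor between subcategories with linear systems. -/
theorem exists_extension_of_semilinear {M : Type*} [LinearOrder M] [OrderTop M]
    {s : M → M} {c : M → M → k}
    {A : Type u₃} [Category.{v₃} A] [Preadditive A] [Linear k A] [HasShift A ℤ] (D : LinSys s c A)
    (E : A ⥤ T) [E.Full] [E.Faithful] [E.Additive] [E.Linear k]
    (F : A ⥤ S) [F.Full] [F.Faithful] [F.Additive]
    (θ : k →+* k) (hθ : ∀ {X Y : A} (a : k) (f : X ⟶ Y), F.map (a • f) = θ a • F.map f)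
    (hT : IsKrullSchmidt T) (hS : IsKrullSchmidt S) {G : A}
    (hG : (ObjectProperty.singleton (E.obj G)).IsClassicalTriangulatedGenerator) {G' : S}
    (hG' : (ObjectProperty.singleton G').IsClassicalTriangulatedGenerator)
    (Q : ObjectProperty S) [Q.IsStableUnderRetracts]
    (hQ : ∀ {X Y Z : S}, Indecomposable X → Indecomposable Y → Indecomposable Z →
      Q X → Q Y → Q Z → ∀ (f : X ⟶ Y) (g : Y ⟶ Z), f ≠ 0 → g ≠ 0 → ∃ h : X ⟶ Z, h ≠ 0) (hQ' : Q G')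
    (hE : ∀ Y, sumsOf (fun p => E.obj (D.obj p)) Y → E.essImage Y) (hD : ∀ Y, sumsOf D.obj Y)
    (hF : ∀ Y, Q (F.obj Y)) (ε : SuspIso E) (φ : SuspIso F) :
    ∃ (Φ : T ⥤ S) (φ : SuspIso Φ), Φ.Full ∧ Φ.Faithful ∧ Φ.Additive ∧ Nonempty (E ⋙ Φ ≅ F) ∧
      (∀ t ∈ distTriang T, HasTwoIndecomposableTerms t → PreservesTriangle Φ φ t) ∧
      (Φ.EssSurj ↔ Q ≤ F.essImage) := by
  -- Recorded for the original scalar action, before the twisted one replaces it.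
  have h : ∀ {X Y : S} (a : k) (f : X ⟶ Y),
      (shiftFunctor S (1 : ℤ)).map (θ a • f) = θ a • (shiftFunctor S (1 : ℤ)).map f :=
    fun a f => (shiftFunctor S (1 : ℤ)).map_smul (θ a) f
  let _ : Linear k S := twistLinear θ S
  have : F.Linear k := ⟨fun f a => hθ a f⟩
  have : (shiftFunctor S (1 : ℤ)).Linear k := ⟨fun f a => h a f⟩
  exact exists_extension D E F hT hS hG hG' Q hQ hQ' hE hD hF ε φ

end Main

end LinearGen

theorem mainTheorem3 (k : Type w) [Field k]
    {T : Type u₁} [Category.{v₁} T] [Preadditive T] [Linear k T] [HasZeroObject T] [HasShift T ℤ]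
    [∀ n : ℤ, (shiftFunctor T n).Additive] [∀ n : ℤ, (shiftFunctor T n).Linear k]
    [Pretriangulated T] [IsTriangulated T]
    {S : Type u₂} [Category.{v₂} S] [Preadditive S] [Linear k S] [HasZeroObject S] [HasShift S ℤ]
    [∀ n : ℤ, (shiftFunctor S n).Additive] [∀ n : ℤ, (shiftFunctor S n).Linear k]
    [Pretriangulated S] [IsTriangulated S]
    (hT₁ : LinearGen.IsHomFinite k T) (hT₂ : LinearGen.IsKrullSchmidt T)
    (hS₁ : LinearGen.IsHomFinite k S) (hS₂ : LinearGen.IsKrullSchmidt S)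
    (G : T) (hG : LinearGen.IsLinearGenerator k G)
    (G' : S) (hG' : LinearGen.IsLinearGenerator k G')
    (F : (LinearGen.langOne G).FullSubcategory ⥤ (LinearGen.langOne G').FullSubcategory)
    [F.Full] [F.Faithful] [F.Additive] (hF : Nonempty (LinearGen.SuspIso F)) :
    ∃ (Φ : T ⥤ S) (φ : LinearGen.SuspIso Φ),
      Φ.Full ∧ Φ.Faithful ∧ Φ.Additive ∧
      Nonempty ((LinearGen.langOne G).ι ⋙ Φ ≅ F ⋙ (LinearGen.langOne G').ι) ∧
      (∀ t ∈ distTriang T, LinearGen.HasTwoIndecomposableTerms t →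
        LinearGen.PreservesTriangle Φ φ t) ∧
      (Φ.IsEquivalence ↔ F.IsEquivalence) := by
  obtain ⟨φF⟩ := hF
  obtain ⟨L, _, s, c, D, hD⟩ := hG.exists_linSys hT₂
  -- Full faithfulness reflects idempotents, so the image of `D.obj p` is indecomposable in `langOne
  -- G'`, hence a brick.
  have hind : ∀ p, p ≠ ⊤ → LinearGen.IsBrick k ((F ⋙ (LinearGen.langOne G').ι).obj (D.obj p)) := by
    intro p hp
    refine hG'.isBrick ⟨LinearGen.indecomposable_of_idempotents (fun h => ?_) (fun f hf => ?_),
      (F.obj (D.obj p)).property⟩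
    · refine (D.isBrick_obj hp).id_ne_zero ?_
      exact (F ⋙ (LinearGen.langOne G').ι).map_injective (h.eq_of_src _ _)
    · obtain ⟨f, rfl⟩ := (F ⋙ (LinearGen.langOne G').ι).map_surjective f
      rcases (D.isBrick_obj hp).eq_zero_or_eq_id f ((F ⋙ (LinearGen.langOne G').ι).map_injective
        (by rw [Functor.map_comp, hf])) with h | h
      · left
        rw [h, Functor.map_zero]
      · right
        rw [h, CategoryTheory.Functor.map_id]
  obtain ⟨θ, hθ⟩ := LinearGen.exists_semilinear D hD (F ⋙ (LinearGen.langOne G').ι) hind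
  -- Transitivity of the order on the target, phrased without scalars so that it survives the twist
  -- of the linear structure.
  have hcomp : ∀ {X Y Z : S}, Indecomposable X → Indecomposable Y → Indecomposable Z →
      LinearGen.langOne G' X → LinearGen.langOne G' Y → LinearGen.langOne G' Z →
      ∀ (f : X ⟶ Y) (g : Y ⟶ Z), f ≠ 0 → g ≠ 0 → ∃ h : X ⟶ Z, h ≠ 0 := by
    intro X Y Z hX hY hZ hX' hY' hZ' f g hf hg
    obtain ⟨h, hh, -⟩ := LinearGen.exists_generator_of_homLE (hG'.le_trans _ _ _ ⟨hX, hX'⟩ ⟨hY, hY'⟩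
      ⟨hZ, hZ'⟩ (hG'.homLE_of_ne_zero ⟨hY, hY'⟩ ⟨hZ, hZ'⟩ g hg)
      (hG'.homLE_of_ne_zero ⟨hX, hX'⟩ ⟨hY, hY'⟩ f hf))
    exact ⟨h, hh⟩
  obtain ⟨Φ, φ, h₁, h₂, h₃, h₄, h₅, h₆⟩ := LinearGen.exists_extension_of_semilinear D
    (LinearGen.langOne G).ι (F ⋙ (LinearGen.langOne G').ι) θ hθ hT₂ hS₂
    (G := ⟨G, LinearGen.langOne_self G⟩) hG.classical hG'.classical (LinearGen.langOne G')
    hcomp (LinearGen.langOne_self G')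
    (fun Y hY => ⟨⟨Y, LinearGen.sumsOf_le_langOne (fun p => (D.obj p).property) _ hY⟩,
      ⟨Iso.refl _⟩⟩) hD
    (fun Y => (F.obj Y).property) ((LinearGen.langOne G).ι.commShiftIso (1 : ℤ))
    ((Functor.associator _ _ _).symm ≪≫ Functor.isoWhiskerRight φF _ ≪≫
      Functor.associator _ _ _ ≪≫ Functor.isoWhiskerLeft F
        ((LinearGen.langOne G').ι.commShiftIso (1 : ℤ)) ≪≫ (Functor.associator _ _ _).symm)
  refine ⟨Φ, φ, h₁, h₂, h₃, h₄, h₅, ?_⟩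
  have hΦ : Φ.IsEquivalence ↔ Φ.EssSurj := ⟨fun h => inferInstance, fun h => { }⟩
  have hF' : F.IsEquivalence ↔ F.EssSurj := ⟨fun h => inferInstance, fun h => { }⟩
  rw [hΦ, hF', h₆]
  constructor
  · refine fun h => ⟨fun Y => ?_⟩
    obtain ⟨X, ⟨e⟩⟩ := h _ Y.property
    exact ⟨X, ⟨(LinearGen.langOne G').isoMk e⟩⟩
  · rintro h Y hY
    obtain ⟨X, ⟨e⟩⟩ := h.mem_essImage ⟨Y, hY⟩
    exact ⟨X, ⟨(LinearGen.langOne G').ι.mapIso e⟩⟩
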